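/- Consider Online Generalized Scheduling with $n\ge 1$ jobs, $m\ge 1$ machines and $r\ge 1$ ways of processing. Known in advance are $n,m,r$, an aggregate cost function $f:\mathbb{R}_{\ge 0}^m\to\mathbb{R}_{\ge 0}$, and for every machine $i$ a norm $\|\cdot\|_i$ on $\mathbb{R}^{nr}$ that is monotone ($\|x\|_i\le\|y\|_i$ whenever $0\le x\le y$ coordinatewise) and symmetric (invariant under all permutations of the $nr$ coordinates). The jobs $j=1,\dots,n$ arrive one at a time; job $j$ reveals, on arrival, the loads $p_{ijk}\in[0,\infty]$ that it incurs if it is scheduled on machine $i$ in way $k\in\{1,\dots,r\}$, where $p_{ijk}=\infty$ means that this option is not available, and it must be assigned immediately and irrevocably to exactly one available pair $(i,k)$ (every job has at least one). Writing $x_{ijk}\in\{0,1\}$ for the resulting allocation, its cost is $f(\Lambda(x))$ with $\Lambda_i(x)=\|(x_{ijk}p_{ijk})_{j,k}\|_i$, where $x_{ijk}p_{ijk}=0$ if $x_{ijk}=0$. A randomized online algorithm is $\rho$-competitive if, on every fixed sequence of jobs, it assigns all jobs and its expected cost is at most $\rho$ times the least cost of an allocation of that sequence. For a real number $p\ge 1$,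 the function $f$ is $p$-bounded if it is monotone, convex and differentiable on $\mathbb{R}_{\ge 0}^m$ (one-sidedly at the boundary), its gradient is coordinatewise monotone increasing, and $\langle\nabla f(y),y\rangle\le p\,f(y)$ for all $y\in\mathbb{R}_{\ge 0}^m$. Theorem. There is an absolute constant $K>0$ such that for all $n,m,r\ge1$, all real $p\ge1$, every $p$-bounded $f$ and all monotone symmetric norms $\|\cdot\|_1,\dots,\|\cdot\|_m$ there is a randomized integral online algorithm for this problem that is $\rho$-competitive with $$\rho=\Big(K\,p^2\,(1+\log m)^2\,(1+\log n)\,\big(1+\log(1+\log n)\big)\Big)^p .$$ In particular, for $m\ge2$ and $n\ge3$ it is $O\big(p^2(\log m)^2\log n\,\log\log n\big)^p$-competitive. -/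

import Mathlib

/-!
Online generalized scheduling with a `p`-bounded aggregate cost and symmetric machine norms.
-/

namespace GenSched

/-- The nonnegative orthant of `ℝ^m`. -/
def orthant (m : ℕ) : Set (Fin m → ℝ) := Set.Ici 0

/-- The `i`-th partial derivative at `y` of a function on the nonnegative orthant.
The derivative is taken within the orthant, where derivatives are unique also at boundary points. -/
noncomputable def partialDeriv {m : ℕ} (f : (Fin m → ℝ) → ℝ) (i : Fin m) (y : Fin m → ℝ) : ℝ :=
  fderivWithin ℝ f (orthant m) y (Pi.single i 1)

/-- `p`-bounded functions `f : ℝ_{≥0}^m → ℝ_{≥0}`. Only the values of `f` on the nonnegative orthant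
matter. The growth condition `⟨∇f(y), y⟩ / f(y) ≤ p` is written without the division. -/
structure IsPBounded {m : ℕ} (p : ℝ) (f : (Fin m → ℝ) → ℝ) : Prop where
  one_le : 1 ≤ p
  nonneg : ∀ y ∈ orthant m, 0 ≤ f y
  monotone : MonotoneOn f (orthant m)
  convex : ConvexOn ℝ (orthant m) f
  differentiable : DifferentiableOn ℝ f (orthant m)
  gradient_monotone : ∀ i, MonotoneOn (partialDeriv f i) (orthant m)
  growth : ∀ y ∈ orthant m, ∑ i, partialDeriv f i y * y i ≤ p * f y

/-- A seminorm on `ℝ^ι` is a monotone symmetric norm: it is definite, monotone on nonnegative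
vectors and invariant under all permutations of the coordinates. -/
structure IsMonotoneSymmetricNorm {ι : Type} (N : Seminorm ℝ (ι → ℝ)) : Prop where
  definite : ∀ x, N x = 0 → x = 0
  monotone : ∀ x y : ι → ℝ, 0 ≤ x → x ≤ y → N x ≤ N y
  symmetric : ∀ (σ : Equiv.Perm ι) (x : ι → ℝ), N (x ∘ σ) = N x

/-- A job, given by the load `p_{ik} ∈ [0, ∞]` that it incurs when it is scheduled on machine `i` in
way `k`; the value `∞` says that the job cannot be scheduled on machine `i` in way `k`. -/
abbrev Job (m r : ℕ) : Type := Fin m → Fin r → ENNReal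

/-- An integral allocation of `n` jobs: job `j` is scheduled on machine `(x j).1` in way `(x j).2`. -/
abbrev Allocation (n m r : ℕ) : Type := Fin n → Fin m × Fin r

/-- All jobs are scheduled in ways that are available to them. -/
def Feasible {n m r : ℕ} (jobs : Fin n → Job m r) (x : Allocation n m r) : Prop :=
  ∀ j, jobs j (x j).1 (x j).2 ≠ ⊤

/-- The vector `(x_{ijk} p_{ijk})_{j,k}` of the loads on machine `i`. -/
noncomputable def loadVector {n m r : ℕ} (jobs : Fin n → Job m r) (x : Allocation n m r)
    (i : Fin m) : Fin n × Fin r → ℝ :=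
  fun q => if x q.1 = (i, q.2) then (jobs q.1 i q.2).toReal else 0

/-- The cost `f(Λ(x))` of an allocation, where `Λ_i(x)` is the `i`-th norm of the `i`-th load
vector. -/
noncomputable def cost {n m r : ℕ} (f : (Fin m → ℝ) → ℝ)
    (N : Fin m → Seminorm ℝ (Fin n × Fin r → ℝ)) (jobs : Fin n → Job m r)
    (x : Allocation n m r) : ℝ :=
  f (fun i => N i (loadVector jobs x i))

/-- The offline optimum: the least cost of a feasible allocation (of which there are finitely
many). -/
noncomputable def opt {n m r : ℕ} (f : (Fin m → ℝ) → ℝ)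
    (N : Fin m → Seminorm ℝ (Fin n × Fin r → ℝ)) (jobs : Fin n → Job m r) : ℝ :=
  sInf {c | ∃ x, Feasible jobs x ∧ c = cost f N jobs x}

/-- A randomized integral online algorithm for `n` jobs: a probability space of random seeds and,
for every seed, a decision for each job that depends only on that job and the earlier ones. -/
structure OnlineAlgorithm (n m r : ℕ) where
  /-- The random seeds. -/
  Ω : Type
  [measurableSpace : MeasurableSpace Ω]
  /-- The distribution of the seed. -/
  P : MeasureTheory.Measure Ω
  [isProbabilityMeasure : MeasureTheory.IsProbabilityMeasure P]
  /-- The allocation that is produced on a sequence of jobs. -/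
  alloc : (Fin n → Job m r) → Ω → Allocation n m r
  measurable_alloc : ∀ jobs j, Measurable fun ω => alloc jobs ω j
  /-- Decisions are irrevocable and made without knowledge of the future. -/
  online : ∀ jobs jobs' j, (∀ j' ≤ j, jobs j' = jobs' j') →
    ∀ ω, alloc jobs ω j = alloc jobs' ω j

attribute [instance] OnlineAlgorithm.measurableSpace OnlineAlgorithm.isProbabilityMeasure

/-- The expected cost of an online algorithm on a fixed sequence of jobs. The integrand is measurable
and takes finitely many values. -/
noncomputable def OnlineAlgorithm.expectedCost {n m r : ℕ} (A : OnlineAlgorithm n m r)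
    (f : (Fin m → ℝ) → ℝ) (N : Fin m → Seminorm ℝ (Fin n × Fin r → ℝ))
    (jobs : Fin n → Job m r) : ℝ :=
  ∫ ω, cost f N jobs (A.alloc jobs ω) ∂A.P

/-- `A` is `ρ`-competitive: on every sequence of jobs that can be scheduled at all, it always
produces a feasible allocation, and its expected cost is at most `ρ` times the offline optimum. -/
def OnlineAlgorithm.IsCompetitive {n m r : ℕ} (A : OnlineAlgorithm n m r)
    (f : (Fin m → ℝ) → ℝ) (N : Fin m → Seminorm ℝ (Fin n × Fin r → ℝ)) (ρ : ℝ) : Prop :=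
  ∀ jobs : Fin n → Job m r, (∃ x, Feasible jobs x) →
    (∀ ω, Feasible jobs (A.alloc jobs ω)) ∧ A.expectedCost f N jobs ≤ ρ * opt f N jobs

end GenSched

set_option linter.unusedSectionVars false

namespace GenSched

open MeasureTheory unitInterval

/-! Only three consequences of `p`-boundedness are used: convexity, the scaling bound `f (c • y) ≤ c
^ p * f y`, and supermodularity, i.e. marginal costs only grow with the load.

Suppose an upper bound `O` of the optimum is known. Let `τ` be the load of a machine that alone
costs `2 * O`. Loads `T = τ / 2 ^ h` with `O(log m)` scales `h` suffice, because the load `τ / m` on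
every machine at once still costs at most `2 * O`. A facility is a machine, a scale and one of
`O(log n)` size classes `s` of jobs whose solo load is about `T / 2 ^ s`. A copy of it adds the load
`T` and, since a monotone symmetric norm of equal loads depends only on their number, holds up to
`K` jobs, where `K` is the largest number of unit loads with norm at most `2 ^ (s + 1)` times that
of one. Scheduling becomes online opening of capacitated facilities under the cost `f`.

Fractional part. The expected numbers `z` of open copies are raised multiplicatively, cheapest next
price first, until the levels of the raised facilities sum to one or direct processing is cheaper
(`exists_raise`). The cost is at most `f 0` plus twice the sum of the prices. As marginals only
grow, all prices can be charged at the final state to the options of an offline solution with loads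
`T` (`sum_fracPrice_le`). This bounds the expected cost of the random load `X` by a multiple of `E
[f (X + T) - f X]`, which `add_le_weighted` absorbs at the price of a factor `p` in the argument
(`meanCost_fracRun_le_offline`).

Rounding. One uniform seed `u` per facility opens `⌊z + u⌋₊` copies. A served job goes greedily to
one of its fresh facilities, whose first copy opened only recently relative to the growth of `z`.
Freshness bounds the use of a facility by its open copies for every seed and without a logarithmic
loss (`sum_freshWeight_le`), so the greedy loads cost no more than a constant multiple of the open
copies (`greedyRun_cost_le`). A job whose fresh facilities have too little weight falls back on the
candidate of least boost `B`. The Chernoff bound `exp (-B / 24)` controls the `p`-th moment of the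
number of fallbacks relative to a smaller capacity `κ` (`integral_badCount_le`); `κ` is `g` size
classes below, with `2 ^ g` at least twice the number of facilities, so that all fallback loads
together are dominated by an average over the facilities.

Boosts are of order `p * log (K / (y₀ * κ))`. Since `K` and `κ` are capacities `g + 1` classes
apart, the logarithms telescope over the size classes to about `(g + 1) * log n` with `g = O(log m +
log log n)` (`sum_shifted_sub_le`). This yields `log n * log log n` instead of `(log n) ^ 2`.

Finally `O` is guessed as the optimum of the current prefix, rounded up to a power of `2 ^ p`. The
costs of the phases form a geometric sum (`integral_cost_sum_le`). -/

/-- The consequences of `p`-boundedness that the analysis uses: the derivative-free form. -/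
structure IsSmoothCost {m : ℕ} (p : ℝ) (f : (Fin m → ℝ) → ℝ) : Prop where
  one_le : 1 ≤ p
  nonneg : ∀ y, 0 ≤ y → 0 ≤ f y
  mono : ∀ x y, 0 ≤ x → x ≤ y → f x ≤ f y
  convex : ConvexOn ℝ (Set.Ici 0) f
  scale : ∀ (c : ℝ) y, 1 ≤ c → 0 ≤ y → f (c • y) ≤ c ^ p * f y
  supermod : ∀ a u v, 0 ≤ a → 0 ≤ u → 0 ≤ v → f (a + u) + f (a + v) ≤ f (a + u + v) + f a
  cont : ContinuousOn f (Set.Ici 0)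

/-! ### From the gradient conditions to scaling and supermodularity -/

section FromGradient

variable {m : ℕ} {p : ℝ} {f : (Fin m → ℝ) → ℝ}

lemma fderivWithin_apply_eq_sum (y v : Fin m → ℝ) :
    fderivWithin ℝ f (orthant m) y v = ∑ i, partialDeriv f i y * v i := by
  conv_lhs => rw [pi_eq_sum_univ' v]
  simp only [map_sum, map_smul, smul_eq_mul, partialDeriv]
  refine Finset.sum_congr rfl fun i _ => ?_
  rw [mul_comm]

/-- For `t > 0` the parameter is interior to `[0, ∞)`, so the derivative within the orthant yields a
two-sided derivative along the ray even if `a` lies on the boundary. -/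
lemma hasDerivAt_along (hf : DifferentiableOn ℝ f (orthant m)) {a v : Fin m → ℝ} (ha : 0 ≤ a)
    (hv : 0 ≤ v) {t : ℝ} (ht : 0 < t) :
    HasDerivAt (fun s : ℝ => f (a + s • v)) (∑ i, partialDeriv f i (a + t • v) * v i) t := by
  have hmem : ∀ s : ℝ, 0 ≤ s → a + s • v ∈ orthant m := fun s hs =>
    add_nonneg ha (smul_nonneg hs hv)
  have h1 : HasDerivWithinAt (fun s : ℝ => a + s • v) v (Set.Ici 0) t := by
    simpa using ((hasDerivAt_id t).smul_const v).const_add a |>.hasDerivWithinAt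
  have h2 := (hf _ (hmem t ht.le)).hasFDerivWithinAt.comp_hasDerivWithinAt t h1
    (fun s hs => hmem s hs)
  rw [fderivWithin_apply_eq_sum] at h2
  exact h2.hasDerivAt (Ici_mem_nhds ht)

lemma continuousOn_along (hf : ContinuousOn f (orthant m)) {a v : Fin m → ℝ} (ha : 0 ≤ a)
    (hv : 0 ≤ v) : ContinuousOn (fun s : ℝ => f (a + s • v)) (Set.Ici 0) := by
  refine hf.comp (by fun_prop) fun s hs => ?_
  exact add_nonneg ha (smul_nonneg hs hv)

/-- The growth condition says that `s ↦ f (s • y) * s ^ (-p)` has nonpositive derivative, which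
gives `scale`. The monotone gradient makes `f (a + u + s • v) - f (a + s • v)` nondecreasing in `s`;
comparing `s = 0` with `s = 1` gives `supermod`. -/
theorem IsPBounded.isSmoothCost (h : IsPBounded p f) : IsSmoothCost p f where
  one_le := h.one_le
  nonneg := h.nonneg
  mono x y hx hxy := h.monotone hx (le_trans hx hxy) hxy
  convex := h.convex
  cont := h.differentiable.continuousOn
  scale := by
    intro c y hc hy
    have hd : ∀ t : ℝ, 0 < t → HasDerivAt (fun s : ℝ => f (s • y) * s ^ (-p))
        ((∑ i, partialDeriv f i (t • y) * y i) * t ^ (-p) + f (t • y) * (-p * t ^ (-p - 1))) t := by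
      intro t ht
      have h1 := hasDerivAt_along h.differentiable (le_refl 0) hy ht
      simp only [zero_add] at h1
      exact h1.mul (Real.hasDerivAt_rpow_const (Or.inl ht.ne'))
    have anti : AntitoneOn (fun s : ℝ => f (s • y) * s ^ (-p)) (Set.Ici 1) := by
      refine antitoneOn_of_deriv_nonpos (convex_Ici 1) ?_ ?_ ?_
      · intro t ht
        exact (hd t (lt_of_lt_of_le one_pos ht)).continuousAt.continuousWithinAt
      · intro t ht
        rw [interior_Ici] at ht
        exact (hd t (one_pos.trans ht)).differentiableAt.differentiableWithinAt
      · intro t ht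
        rw [interior_Ici] at ht
        have ht0 : 0 < t := one_pos.trans ht
        rw [(hd t ht0).deriv]
        have hg := h.growth (t • y) (smul_nonneg ht0.le hy)
        have e1 : t ^ (-p) = t * t ^ (-p - 1) := by
          rw [Real.rpow_sub_one ht0.ne']; field_simp
        have e2 : ∑ i, partialDeriv f i (t • y) * (t • y) i
            = t * ∑ i, partialDeriv f i (t • y) * y i := by
          rw [Finset.mul_sum]
          refine Finset.sum_congr rfl fun i _ => ?_
          simp only [Pi.smul_apply, smul_eq_mul]; ring
        rw [e2] at hg
        have : (∑ i, partialDeriv f i (t • y) * y i) * t ^ (-p) + f (t • y) * (-p * t ^ (-p - 1))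
            = (t * (∑ i, partialDeriv f i (t • y) * y i) - p * f (t • y)) * t ^ (-p - 1) := by
          rw [e1]; ring
        rw [this]
        exact mul_nonpos_of_nonpos_of_nonneg (by linarith) (Real.rpow_nonneg ht0.le _)
    have := anti (Set.mem_Ici.2 le_rfl) (Set.mem_Ici.2 hc) hc
    have hc0 : 0 < c := lt_of_lt_of_le one_pos hc
    simp only [one_smul, Real.one_rpow, mul_one] at this
    rw [Real.rpow_neg hc0.le, ← div_eq_mul_inv, div_le_iff₀ (Real.rpow_pos_of_pos hc0 _)] at this
    linarith
  supermod := by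
    intro a u v ha hu hv
    have mono : MonotoneOn (fun s : ℝ => f (a + u + s • v) - f (a + s • v)) (Set.Icc 0 1) := by
      have hc := h.differentiable.continuousOn
      have hd : ∀ t : ℝ, 0 < t → HasDerivAt (fun s : ℝ => f (a + u + s • v) - f (a + s • v))
          ((∑ i, partialDeriv f i (a + u + t • v) * v i)
            - ∑ i, partialDeriv f i (a + t • v) * v i) t := fun t ht =>
        (hasDerivAt_along h.differentiable (add_nonneg ha hu) hv ht).sub
          (hasDerivAt_along h.differentiable ha hv ht)
      refine monotoneOn_of_deriv_nonneg (convex_Icc 0 1) ?_ ?_ ?_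
      · exact ((continuousOn_along hc (add_nonneg ha hu) hv).sub
          (continuousOn_along hc ha hv)).mono Set.Icc_subset_Ici_self
      · intro t ht
        rw [interior_Icc] at ht
        exact (hd t ht.1).differentiableAt.differentiableWithinAt
      · intro t ht
        rw [interior_Icc] at ht
        rw [(hd t ht.1).deriv, ← Finset.sum_sub_distrib]
        refine Finset.sum_nonneg fun i _ => ?_
        rw [← sub_mul]
        refine mul_nonneg (sub_nonneg.2 ?_) (hv i)
        have htv : 0 ≤ t • v := smul_nonneg ht.1.le hv
        refine h.gradient_monotone i (add_nonneg ha htv)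
          (add_nonneg (add_nonneg ha hu) htv) ?_
        have : a ≤ a + u := le_add_of_nonneg_right hu
        exact add_le_add this le_rfl
    have := mono (Set.mem_Icc.2 ⟨le_rfl, zero_le_one⟩) (Set.mem_Icc.2 ⟨zero_le_one, le_rfl⟩)
      zero_le_one
    simp only [zero_smul, add_zero, one_smul] at this
    linarith

end FromGradient

/-! ### Inequalities for smooth costs -/

namespace IsSmoothCost

variable {m : ℕ} {p : ℝ} {f : (Fin m → ℝ) → ℝ}

lemma p_pos (h : IsSmoothCost p f) : 0 < p := lt_of_lt_of_le one_pos h.one_le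

lemma combo_le (h : IsSmoothCost p f) {x y : Fin m → ℝ} (hx : 0 ≤ x) (hy : 0 ≤ y) {a b : ℝ}
    (ha : 0 ≤ a) (hb : 0 ≤ b) (hab : a + b = 1) : f (a • x + b • y) ≤ a * f x + b * f y :=
  h.convex.2 hx hy ha hb hab

lemma marginal_mono (h : IsSmoothCost p f) {a b w : Fin m → ℝ} (ha : 0 ≤ a) (hab : a ≤ b)
    (hw : 0 ≤ w) : f (a + w) - f a ≤ f (b + w) - f b := by
  have := h.supermod a (b - a) w ha (sub_nonneg.2 hab) hw
  simp only [add_sub_cancel] at this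
  linarith

lemma marginal_nonneg (h : IsSmoothCost p f) {a w : Fin m → ℝ} (ha : 0 ≤ a) (hw : 0 ≤ w) :
    0 ≤ f (a + w) - f a :=
  sub_nonneg.2 (h.mono _ _ ha (le_add_of_nonneg_right hw))

lemma chord_le (h : IsSmoothCost p f) {a w : Fin m → ℝ} (ha : 0 ≤ a) (hw : 0 ≤ w) {θ : ℝ}
    (h0 : 0 ≤ θ) (h1 : θ ≤ 1) : f (a + θ • w) - f a ≤ θ * (f (a + w) - f a) := by
  have := h.combo_le ha (add_nonneg ha hw) (sub_nonneg.2 h1) h0 (by ring)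
  have e : (1 - θ) • a + θ • (a + w) = a + θ • w := by
    ext i; simp only [Pi.add_apply, Pi.smul_apply, smul_eq_mul]; ring
  rw [e] at this
  linarith

/-- Supermodularity makes marginals at a common point superadditive. Charges to separate copies or
machines thus merge into one joint marginal. -/
lemma sum_marginal_le (h : IsSmoothCost p f) {κ : Type*} (s : Finset κ) {a : Fin m → ℝ}
    (ha : 0 ≤ a) (w : κ → Fin m → ℝ) (hw : ∀ k ∈ s, 0 ≤ w k) :
    ∑ k ∈ s, (f (a + w k) - f a) ≤ f (a + ∑ k ∈ s, w k) - f a := by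
  classical
  induction s using Finset.induction_on with
  | empty => simp
  | insert k s hk ih =>
    rw [Finset.sum_insert hk, Finset.sum_insert hk]
    have hs : ∀ k ∈ s, 0 ≤ w k := fun k hk => hw k (Finset.mem_insert_of_mem hk)
    have hsum : 0 ≤ ∑ k ∈ s, w k := Finset.sum_nonneg hs
    have h1 := ih hs
    have h2 := h.supermod a (w k) (∑ k ∈ s, w k) ha (hw k (Finset.mem_insert_self _ _)) hsum
    rw [add_assoc] at h2
    linarith

lemma natCast_mul_marginal_le (h : IsSmoothCost p f) {a w : Fin m → ℝ} (ha : 0 ≤ a) (hw : 0 ≤ w)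
    (n : ℕ) : (n : ℝ) * (f (a + w) - f a) ≤ f (a + (n : ℝ) • w) - f a := by
  have := h.sum_marginal_le (Finset.range n) ha (fun _ => w) (fun _ _ => hw)
  rwa [Finset.sum_const, Finset.sum_const, Finset.card_range, nsmul_eq_mul,
    ← Nat.cast_smul_eq_nsmul ℝ] at this

/-- Splitting off a part of the argument, at the price of a small blow-up. -/
lemma add_le_weighted (h : IsSmoothCost p f) {x v : Fin m → ℝ} (hx : 0 ≤ x) (hv : 0 ≤ v) {γ : ℝ}
    (hγ : 1 ≤ γ) :
    γ * (f (x + v) - f x) ≤ f x / 2 + 1 / 2 * f ((4 * γ * p) • v) := by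
  have hp := h.one_le
  have hp0 := h.p_pos
  have hγ0 : 0 < γ := by linarith
  -- In `x + v = (1 - ε) (x / (1 - ε)) + ε (v / ε)` this `ε` costs only the factor `(1 - ε)⁻¹ ^ p ≤
  -- 1 + 1 / (2 γ)` on `f x`, so that `γ` times the loss is `f x / 2`.
  set ε : ℝ := 1 / (4 * γ * p) with hε
  have hden : 4 ≤ 4 * γ * p := by nlinarith
  have hε0 : 0 < ε := by positivity
  have hε1 : ε ≤ 1 / 4 := by
    rw [hε]; exact one_div_le_one_div_of_le (by norm_num) hden
  have hone : 0 < 1 - ε := by linarith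
  have e : x + v = (1 - ε) • ((1 - ε)⁻¹ • x) + ε • (ε⁻¹ • v) := by
    rw [smul_smul, smul_smul, mul_inv_cancel₀ hone.ne', mul_inv_cancel₀ hε0.ne', one_smul, one_smul]
  have h1 : f (x + v) ≤ (1 - ε) * f ((1 - ε)⁻¹ • x) + ε * f (ε⁻¹ • v) := by
    rw [e]
    exact h.combo_le (smul_nonneg (inv_nonneg.2 hone.le) hx) (smul_nonneg (inv_nonneg.2 hε0.le) hv)
      hone.le hε0.le (by ring)
  have h2 : f ((1 - ε)⁻¹ • x) ≤ ((1 - ε)⁻¹) ^ p * f x :=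
    h.scale _ _ ((one_le_inv₀ hone).2 (by linarith)) hx
  have hb : 1 - p * ε ≤ (1 - ε) ^ p := by
    have := one_add_mul_self_le_rpow_one_add (s := -ε) (by linarith) hp
    simpa [sub_eq_add_neg] using this
  have hpε : p * ε = 1 / (4 * γ) := by rw [hε]; field_simp
  have hpε4 : p * ε ≤ 1 / 4 := by
    rw [hpε]; exact one_div_le_one_div_of_le (by norm_num) (by linarith)
  have hpos : 0 < 1 - p * ε := by linarith
  have h3 : ((1 - ε)⁻¹) ^ p ≤ 1 + 2 * (p * ε) := by
    rw [Real.inv_rpow hone.le]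
    calc ((1 - ε) ^ p)⁻¹ ≤ (1 - p * ε)⁻¹ := by gcongr
      _ ≤ 1 + 2 * (p * ε) := by
        rw [inv_le_iff_one_le_mul₀ hpos]
        have : 0 ≤ p * ε := by positivity
        nlinarith
  have hfx := h.nonneg x hx
  have hfv := h.nonneg (ε⁻¹ • v) (smul_nonneg (inv_nonneg.2 hε0.le) hv)
  have hinv : ε⁻¹ = 4 * γ * p := by rw [hε]; simp
  have h4 : f (x + v) ≤ (1 + 2 * (p * ε)) * f x + ε * f (ε⁻¹ • v) := by
    have : (1 - ε) * f ((1 - ε)⁻¹ • x) ≤ f ((1 - ε)⁻¹ • x) := by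
      have := h.nonneg ((1 - ε)⁻¹ • x) (smul_nonneg (inv_nonneg.2 hone.le) hx)
      nlinarith
    have : ((1 - ε)⁻¹) ^ p * f x ≤ (1 + 2 * (p * ε)) * f x := by gcongr
    linarith
  have h5 : γ * (f (x + v) - f x) ≤ γ * (2 * (p * ε) * f x + ε * f (ε⁻¹ • v)) := by
    gcongr; linarith
  have h6 : γ * (2 * (p * ε) * f x) = f x / 2 := by rw [hpε]; field_simp; norm_num
  have h7 : γ * ε ≤ 1 / 2 := by
    have : γ * ε = 1 / (4 * p) := by rw [hε]; field_simp
    rw [this]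
    exact one_div_le_one_div_of_le (by norm_num) (by linarith)
  rw [← hinv]
  nlinarith

/-- Self-bounding: `add_le_weighted` returns half of `f x`, which moves to the left-hand side. -/
lemma le_of_le_add_marginal (h : IsSmoothCost p f) {x v : Fin m → ℝ} (hx : 0 ≤ x) (hv : 0 ≤ v)
    {γ c : ℝ} (hγ : 1 ≤ γ) (hle : f x ≤ c + γ * (f (x + v) - f x)) :
    f x ≤ 2 * c + f ((4 * γ * p) • v) := by
  have := h.add_le_weighted hx hv hγ
  linarith

lemma add_le_half (h : IsSmoothCost p f) {x y : Fin m → ℝ} (hx : 0 ≤ x) (hy : 0 ≤ y) :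
    f (x + y) ≤ 1 / 2 * f ((2 : ℝ) • x) + 1 / 2 * f ((2 : ℝ) • y) := by
  have := h.combo_le (x := (2 : ℝ) • x) (y := (2 : ℝ) • y) (smul_nonneg zero_le_two hx)
    (smul_nonneg zero_le_two hy) (a := 1 / 2) (b := 1 / 2) (by norm_num) (by norm_num) (by norm_num)
  rwa [smul_smul, smul_smul, show (1 / 2 : ℝ) * 2 = 1 by norm_num, one_smul, one_smul] at this

lemma add_le_rpow (h : IsSmoothCost p f) {x y : Fin m → ℝ} (hx : 0 ≤ x) (hy : 0 ≤ y) :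
    f (x + y) ≤ 1 / 2 * 2 ^ p * (f x + f y) := by
  have h1 := h.add_le_half hx hy
  have h2 := h.scale 2 x one_le_two hx
  have h3 := h.scale 2 y one_le_two hy
  linarith

/-- Jensen's inequality for uniform weights. -/
lemma sum_le_average (h : IsSmoothCost p f) {κ : Type*} (s : Finset κ) (hs : s.Nonempty)
    (w : κ → Fin m → ℝ) (hw : ∀ k ∈ s, 0 ≤ w k) :
    f (∑ k ∈ s, (1 / (s.card : ℝ)) • w k) ≤ ∑ k ∈ s, 1 / (s.card : ℝ) * f (w k) := by
  have hc : (0 : ℝ) < s.card := by exact_mod_cast hs.card_pos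
  have := h.convex.map_sum_le (t := s) (w := fun _ => 1 / (s.card : ℝ)) (p := w)
    (fun _ _ => by positivity) (by simp [hc.ne']) hw
  simpa using this

lemma scale_mul_le (h : IsSmoothCost p f) {c : ℝ} {y : Fin m → ℝ} (hc : 0 ≤ c) (hy : 0 ≤ y) :
    f (c • y) ≤ (1 + c ^ p) * f y := by
  have hf := h.nonneg y hy
  have hcp := Real.rpow_nonneg hc p
  rcases le_total 1 c with h1 | h1
  · have := h.scale c y h1 hy
    nlinarith
  · have : f (c • y) ≤ f y := by
      refine h.mono _ _ (smul_nonneg hc hy) fun i => ?_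
      simp only [Pi.smul_apply, smul_eq_mul]
      exact mul_le_of_le_one_left (hy i) h1
    nlinarith

/-- A direction along which the cost stays constant from the origin is irrelevant everywhere. -/
lemma add_free (h : IsSmoothCost p f) {v : Fin m → ℝ} (hv : 0 ≤ v)
    (hfree : ∀ t : ℝ, 0 ≤ t → f (t • v) = f 0) {y : Fin m → ℝ} (hy : 0 ≤ y) {t : ℝ} (ht : 0 ≤ t) :
    f (y + t • v) = f y := by
  refine le_antisymm ?_ (h.mono _ _ hy (le_add_of_nonneg_right (smul_nonneg ht hv)))
  -- An `ε` fraction of a convex combination carries the whole free direction, where the cost is `f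
  -- 0`. As `ε → 0` the blow-up of `y` disappears.
  have key : ∀ ε : ℝ, 0 < ε → ε < 1 → f (y + t • v) ≤ ((1 - ε)⁻¹) ^ p * f y + ε * f 0 := by
    intro ε h0 h1
    have hone : 0 < 1 - ε := by linarith
    have e : y + t • v = (1 - ε) • ((1 - ε)⁻¹ • y) + ε • ((ε⁻¹ * t) • v) := by
      rw [smul_smul, smul_smul, mul_inv_cancel₀ hone.ne', one_smul, ← mul_assoc,
        mul_inv_cancel₀ h0.ne', one_mul]
    have hz := smul_nonneg (inv_nonneg.2 hone.le) hy
    have h2 := h.combo_le hz (smul_nonneg (mul_nonneg (inv_nonneg.2 h0.le) ht) hv)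
      hone.le h0.le (by ring)
    rw [← e, hfree _ (mul_nonneg (inv_nonneg.2 h0.le) ht)] at h2
    have h3 := h.scale _ _ ((one_le_inv₀ hone).2 (by linarith)) hy
    have h4 := h.nonneg _ hz
    have : (1 - ε) * f ((1 - ε)⁻¹ • y) ≤ f ((1 - ε)⁻¹ • y) := by nlinarith
    linarith
  have hlim : Filter.Tendsto (fun ε : ℝ => ((1 - ε)⁻¹) ^ p * f y + ε * f 0)
      (nhdsWithin 0 (Set.Ioi 0)) (nhds (((1 - 0)⁻¹) ^ p * f y + 0 * f 0)) := by
    refine Filter.Tendsto.mono_left ?_ nhdsWithin_le_nhds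
    refine ContinuousAt.tendsto (f := fun ε : ℝ => ((1 - ε)⁻¹) ^ p * f y + ε * f 0) ?_
    have : ContinuousAt (fun ε : ℝ => (1 - ε)⁻¹) 0 :=
      (continuousAt_const.sub continuousAt_id).inv₀ (by simp)
    exact ((this.rpow_const (Or.inl (by simp))).mul continuousAt_const).add
      (continuousAt_id.mul continuousAt_const)
  simp only [sub_zero, inv_one, Real.one_rpow, one_mul, zero_mul, add_zero] at hlim
  refine ge_of_tendsto hlim ?_
  filter_upwards [Ioo_mem_nhdsGT (zero_lt_one' ℝ)] with ε hε
  exact key ε hε.1 hε.2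

end IsSmoothCost

/-! ### Rounding one number with a uniform seed -/

section Rounding

/-- Randomized rounding of `z` with the uniform seed `u`. -/
noncomputable def roundUp (z : ℝ) (u : I) : ℕ := ⌊z + u⌋₊

lemma roundUp_mono {z z' : ℝ} (h : z ≤ z') (u : I) : roundUp z u ≤ roundUp z' u :=
  Nat.floor_mono (by linarith)

lemma roundUp_lt {z : ℝ} (hz : 0 ≤ z) (u : I) : roundUp z u < ⌊z⌋₊ + 2 := by
  rw [roundUp, Nat.floor_lt (by have := u.2.1; linarith)]
  have := Nat.lt_floor_add_one z
  have := u.2.2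
  push_cast
  linarith

lemma measurable_roundUp (z : ℝ) : Measurable (roundUp z) :=
  Nat.measurable_floor.comp (measurable_const.add measurable_subtype_coe)

lemma roundUp_eq {z : ℝ} (hz : 0 ≤ z) (u : I) (hu : (u : ℝ) ≠ 1) :
    roundUp z u = if 1 - (z - ⌊z⌋₊) ≤ u then ⌊z⌋₊ + 1 else ⌊z⌋₊ := by
  have h0 := u.2.1
  have h1 : (u : ℝ) < 1 := lt_of_le_of_ne u.2.2 hu
  have hf := Nat.floor_le hz
  have hf' := Nat.lt_floor_add_one z
  split_ifs with h
  · rw [roundUp, Nat.floor_eq_iff (by linarith)]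
    push_cast; constructor <;> linarith
  · rw [roundUp, Nat.floor_eq_iff (by linarith)]
    push Not at h
    constructor <;> linarith

/-- `g` is arbitrary; integrability rests on finitely many values in a discrete space. -/
lemma integrable_comp_of_finite {Ω α : Type*} [MeasurableSpace Ω] {μ : Measure Ω}
    [IsFiniteMeasure μ] [MeasurableSpace α] [DiscreteMeasurableSpace α] (g : α → ℝ) {X : Ω → α}
    (hX : Measurable X) (s : Finset α) (hs : ∀ ω, X ω ∈ s) : Integrable (fun ω => g (X ω)) μ := by
  refine Integrable.of_bound (C := ∑ a ∈ s, |g a|)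
    (Measurable.of_discrete.comp hX).aestronglyMeasurable (Filter.Eventually.of_forall fun ω => ?_)
  rw [Real.norm_eq_abs]
  exact Finset.single_le_sum (f := fun a => |g a|) (fun _ _ => abs_nonneg _) (hs ω)

/-- The fractional part of `z` is the probability of rounding up, so the mean is the piecewise
linear interpolation of `h`. -/
lemma integral_roundUp {z : ℝ} (hz : 0 ≤ z) (h : ℕ → ℝ) :
    ∫ u : I, h (roundUp z u)
      = (1 - (z - ⌊z⌋₊)) * h ⌊z⌋₊ + (z - ⌊z⌋₊) * h (⌊z⌋₊ + 1) := by
  set θ : ℝ := z - ⌊z⌋₊ with hθ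
  have hf := Nat.floor_le hz
  have hf' := Nat.lt_floor_add_one z
  have hθI : 1 - θ ∈ Set.Icc (0 : ℝ) 1 := ⟨by linarith, by linarith⟩
  have hae : (fun u : I => h (roundUp z u)) =ᵐ[volume]
      fun u => h ⌊z⌋₊ + (Set.Ici (⟨1 - θ, hθI⟩ : I)).indicator
        (fun _ => h (⌊z⌋₊ + 1) - h ⌊z⌋₊) u := by
    have hne : ∀ᵐ u : I, u ≠ 1 := by
      rw [ae_iff]; simp
    filter_upwards [hne] with u hu
    rw [roundUp_eq hz u (fun hc => hu (Subtype.ext hc))]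
    simp only [Set.indicator, Set.mem_Ici, ← Subtype.coe_le_coe, ← hθ]
    split_ifs <;> ring
  rw [integral_congr_ae hae, integral_add (integrable_const _)
    ((integrable_const _).indicator measurableSet_Ici), integral_indicator measurableSet_Ici]
  simp [Measure.real, unitInterval.volume_Ici]
  rw [ENNReal.toReal_ofReal (by linarith)]
  ring

/-- The interpolation of a convex sequence is convex, and the mean of `h (roundUp z u + 1)` is its
value at `z + 1`: this is the chord inequality on `[z, z + 1]`. The two cases are whether `z + δ`
reaches the next integer. -/
lemma integral_roundUp_add_le {z δ : ℝ} (hz : 0 ≤ z) (h0 : 0 ≤ δ) (h1 : δ ≤ 1) (h : ℕ → ℝ)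
    (hconv : ∀ k, h (k + 1) - h k ≤ h (k + 2) - h (k + 1)) :
    (∫ u : I, h (roundUp (z + δ) u)) - ∫ u : I, h (roundUp z u)
      ≤ δ * ((∫ u : I, h (roundUp z u + 1)) - ∫ u : I, h (roundUp z u)) := by
  rw [integral_roundUp hz h, integral_roundUp hz (fun k => h (k + 1)),
    integral_roundUp (add_nonneg hz h0) h]
  have hf := Nat.floor_le hz
  have hf' := Nat.lt_floor_add_one z
  have hc := hconv ⌊z⌋₊
  set n := ⌊z⌋₊ with hn
  by_cases hlt : z + δ < n + 1
  · have : ⌊z + δ⌋₊ = n := by rw [Nat.floor_eq_iff (by linarith)]; constructor <;> linarith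
    rw [this]
    have : 0 ≤ δ * (z - n) := mul_nonneg h0 (by linarith)
    simp only [add_assoc, Nat.reduceAdd] at *
    nlinarith
  · have : ⌊z + δ⌋₊ = n + 1 := by
      rw [Nat.floor_eq_iff (by linarith)]; push_cast; constructor <;> linarith
    rw [this]
    push_cast
    have : 0 ≤ (1 - δ) * (1 - (z - n)) := mul_nonneg (by linarith) (by linarith)
    simp only [add_assoc, Nat.reduceAdd] at *
    nlinarith

end Rounding

/-! ### Independent seeds and the expected cost of open copies -/

section Product

variable {ι : Type} [Fintype ι] [DecidableEq ι]

/-- Resampling one coordinate keeps the law of a product measure. This isolates the seed of one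
facility while the others are fixed. -/
lemma measurePreserving_update (F : ι) :
    MeasurePreserving (fun q : (ι → I) × I => Function.update q.1 F q.2)
      (volume.prod volume) volume where
  measurable := by
    refine measurable_pi_lambda _ fun G => ?_
    by_cases h : G = F
    · subst h; simpa using measurable_snd
    · simp only [Function.update_of_ne h]; exact (measurable_pi_apply G).comp measurable_fst
  map_eq := by
    symm
    refine Measure.pi_eq fun s hs => ?_
    have hm : Measurable (fun q : (ι → I) × I => Function.update q.1 F q.2) := by
      refine measurable_pi_lambda _ fun G => ?_
      by_cases h : G = F
      · subst h; simpa using measurable_snd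
      · simp only [Function.update_of_ne h]; exact (measurable_pi_apply G).comp measurable_fst
    rw [Measure.map_apply hm (MeasurableSet.univ_pi hs)]
    have : (fun q : (ι → I) × I => Function.update q.1 F q.2) ⁻¹' (Set.univ.pi s)
        = (Set.univ.pi (Function.update s F Set.univ)) ×ˢ s F := by
      ext ⟨U, u⟩
      simp only [Set.mem_preimage, Set.mem_univ_pi, Set.mem_prod]
      constructor
      · intro h
        refine ⟨fun G => ?_, by simpa using h F⟩
        by_cases hG : G = F
        · subst hG; simp
        · simpa [Function.update_of_ne hG] using h G
      · rintro ⟨h, hF⟩ G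
        by_cases hG : G = F
        · subst hG; simpa using hF
        · simpa [Function.update_of_ne hG] using h G
    rw [this, Measure.prod_prod, volume_pi, Measure.pi_pi,
      ← Finset.mul_prod_erase Finset.univ _ (Finset.mem_univ F),
      ← Finset.mul_prod_erase Finset.univ (fun i => volume (s i)) (Finset.mem_univ F)]
    simp only [Function.update_self, measure_univ, one_mul]
    rw [mul_comm]
    congr 1
    exact Finset.prod_congr rfl fun G hG => by
      rw [Function.update_of_ne (Finset.ne_of_mem_erase hG)]

lemma integral_update (F : ι) {g : (ι → I) → ℝ} (hg : Integrable g) :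
    ∫ U, g U = ∫ U, ∫ u, g (Function.update U F u) := by
  have hmp := measurePreserving_update (ι := ι) F
  have hi : Integrable (fun q : (ι → I) × I => g (Function.update q.1 F q.2))
      (volume.prod volume) := hmp.integrable_comp_of_integrable hg
  rw [← integral_prod _ hi]
  have := integral_map (μ := volume.prod volume) hmp.measurable.aemeasurable
    (f := g) (by rw [hmp.map_eq]; exact hg.aestronglyMeasurable)
  rwa [hmp.map_eq] at this

/-- The number of copies of each facility that are open when the expected numbers are `z`. -/
noncomputable def copies (z : ι → ℝ) (U : ι → I) : ι → ℕ := fun F => roundUp (z F) (U F)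

lemma measurable_copies (z : ι → ℝ) : Measurable (copies z) :=
  measurable_pi_lambda _ fun F => (measurable_roundUp _).comp (measurable_pi_apply F)

lemma integrable_copies {z : ι → ℝ} (hz : 0 ≤ z) (g : (ι → ℕ) → ℝ) :
    Integrable (fun U : ι → I => g (copies z U)) :=
  integrable_comp_of_finite g (measurable_copies z)
    (Fintype.piFinset fun F => Finset.range (⌊z F⌋₊ + 2)) fun U => by
      simp only [Fintype.mem_piFinset, Finset.mem_range]
      exact fun F => roundUp_lt (hz F) _

variable {m : ℕ} {p : ℝ} {f : (Fin m → ℝ) → ℝ} (w : ι → Fin m → ℝ)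

/-- The load vector that consists of `D` and of `a F` copies of `w F` for every facility `F`. -/
def openLoad (D : Fin m → ℝ) (a : ι → ℕ) : Fin m → ℝ := D + ∑ F, (a F : ℝ) • w F

variable {w}

lemma openLoad_mono (hw : ∀ F, 0 ≤ w F) {D D' : Fin m → ℝ} (hD : D ≤ D') {a a' : ι → ℕ}
    (ha : a ≤ a') : openLoad w D a ≤ openLoad w D' a' := by
  refine add_le_add hD (Finset.sum_le_sum fun F _ => ?_)
  exact smul_le_smul_of_nonneg_right (by exact_mod_cast ha F) (hw F)

lemma openLoad_nonneg (hw : ∀ F, 0 ≤ w F) {D : Fin m → ℝ} (hD : 0 ≤ D) (a : ι → ℕ) :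
    0 ≤ openLoad w D a :=
  add_nonneg hD (Finset.sum_nonneg fun F _ => smul_nonneg (Nat.cast_nonneg _) (hw F))

lemma copies_mono {z z' : ι → ℝ} (h : z ≤ z') (U : ι → I) : copies z U ≤ copies z' U :=
  fun F => roundUp_mono (h F) _

variable (f w)

/-- The expected cost of the random load vector. -/
noncomputable def meanCost (D : Fin m → ℝ) (z : ι → ℝ) : ℝ :=
  ∫ U : ι → I, f (openLoad w D (copies z U))

/-- The expected increase of the cost when `v` is added to the random load vector. -/
noncomputable def meanMarginal (D : Fin m → ℝ) (z : ι → ℝ) (v : Fin m → ℝ) : ℝ :=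
  ∫ U : ι → I, (f (openLoad w D (copies z U) + v) - f (openLoad w D (copies z U)))

variable {f w}

lemma integrable_meanMarginal {z : ι → ℝ} (hz : 0 ≤ z) (D v : Fin m → ℝ) :
    Integrable fun U : ι → I =>
      (f (openLoad w D (copies z U) + v) - f (openLoad w D (copies z U))) :=
  integrable_copies hz fun a => f (openLoad w D a + v) - f (openLoad w D a)

lemma integrable_meanCost {z : ι → ℝ} (hz : 0 ≤ z) (D : Fin m → ℝ) :
    Integrable fun U : ι → I => f (openLoad w D (copies z U)) :=
  integrable_copies hz fun a => f (openLoad w D a)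

lemma meanMarginal_nonneg (hf : IsSmoothCost p f) (hw : ∀ F, 0 ≤ w F) {D : Fin m → ℝ}
    (hD : 0 ≤ D) (z : ι → ℝ) {v : Fin m → ℝ} (hv : 0 ≤ v) : 0 ≤ meanMarginal f w D z v :=
  integral_nonneg fun _ => hf.marginal_nonneg (openLoad_nonneg hw hD _) hv

/-- Common seeds make `copies` monotone in `z` pointwise, so supermodularity applies for every seed.
Prices charged early are therefore dominated by marginals at the end of the run. -/
lemma meanMarginal_mono (hf : IsSmoothCost p f) (hw : ∀ F, 0 ≤ w F) {D D' : Fin m → ℝ}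
    (hD : 0 ≤ D) (hDD : D ≤ D') {z z' : ι → ℝ} (hz : 0 ≤ z) (hzz : z ≤ z') {v : Fin m → ℝ}
    (hv : 0 ≤ v) : meanMarginal f w D z v ≤ meanMarginal f w D' z' v :=
  integral_mono (integrable_meanMarginal hz D v) (integrable_meanMarginal (hz.trans hzz) D' v)
    fun U => hf.marginal_mono (openLoad_nonneg hw hD _)
      (openLoad_mono hw hDD (copies_mono hzz U)) hv

lemma meanMarginal_chord (hf : IsSmoothCost p f) (hw : ∀ F, 0 ≤ w F) {D : Fin m → ℝ}
    (hD : 0 ≤ D) {z : ι → ℝ} (hz : 0 ≤ z) {v : Fin m → ℝ} (hv : 0 ≤ v) {θ : ℝ} (h0 : 0 ≤ θ)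
    (h1 : θ ≤ 1) : meanMarginal f w D z (θ • v) ≤ θ * meanMarginal f w D z v := by
  unfold meanMarginal
  rw [← integral_const_mul]
  exact integral_mono (integrable_meanMarginal hz D _)
    ((integrable_meanMarginal hz D v).const_mul _)
    fun U => hf.chord_le (openLoad_nonneg hw hD _) hv h0 h1

lemma meanMarginal_sum (hf : IsSmoothCost p f) (hw : ∀ F, 0 ≤ w F) {D : Fin m → ℝ}
    (hD : 0 ≤ D) {z : ι → ℝ} (hz : 0 ≤ z) {κ : Type*} (s : Finset κ) (v : κ → Fin m → ℝ)
    (hv : ∀ k ∈ s, 0 ≤ v k) :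
    ∑ k ∈ s, meanMarginal f w D z (v k) ≤ meanMarginal f w D z (∑ k ∈ s, v k) := by
  unfold meanMarginal
  rw [← integral_finsetSum _ fun k _ => integrable_meanMarginal hz D (v k)]
  exact integral_mono (integrable_finsetSum _ fun k _ => integrable_meanMarginal hz D (v k))
    (integrable_meanMarginal hz D _)
    fun U => hf.sum_marginal_le s (openLoad_nonneg hw hD _) v hv

lemma meanCost_add {D : Fin m → ℝ} {z : ι → ℝ} (hz : 0 ≤ z) (v : Fin m → ℝ) :
    meanCost f w (D + v) z - meanCost f w D z = meanMarginal f w D z v := by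
  unfold meanCost meanMarginal
  rw [← integral_sub (integrable_meanCost hz _) (integrable_meanCost hz _)]
  simp only [openLoad, add_right_comm]

lemma openLoad_update (D : Fin m → ℝ) (a : ι → ℕ) (F : ι) (k : ℕ) :
    openLoad w D (Function.update a F k)
      = openLoad w D (Function.update a F 0) + (k : ℝ) • w F := by
  unfold openLoad
  rw [add_assoc, ← Finset.add_sum_erase _ _ (Finset.mem_univ F),
    ← Finset.add_sum_erase _ (fun G => ((Function.update a F 0 G : ℕ) : ℝ) • w G)
      (Finset.mem_univ F)]
  simp only [Function.update_self, Nat.cast_zero, zero_smul, zero_add]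
  rw [add_comm ((k : ℝ) • w F)]
  congr 2
  exact Finset.sum_congr rfl fun G hG => by
    rw [Function.update_of_ne (Finset.ne_of_mem_erase hG),
      Function.update_of_ne (Finset.ne_of_mem_erase hG)]

/-- Raising the expected number of copies of `F` by `δ ≤ 1` costs at most `δ` times the expected
marginal cost of a copy. -/
lemma meanCost_raise_le (hf : IsSmoothCost p f) (hw : ∀ F, 0 ≤ w F) {D : Fin m → ℝ}
    (hD : 0 ≤ D) {z : ι → ℝ} (hz : 0 ≤ z) (F : ι) {δ : ℝ} (h0 : 0 ≤ δ) (h1 : δ ≤ 1) :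
    meanCost f w D (Function.update z F (z F + δ)) - meanCost f w D z
      ≤ δ * meanMarginal f w D z (w F) := by
  have hz' : 0 ≤ Function.update z F (z F + δ) := by
    intro G
    by_cases hG : G = F
    · subst hG; simpa using add_nonneg (hz G) h0
    · simpa [Function.update_of_ne hG] using hz G
  have hmarg : meanMarginal f w D z (w F)
      = (∫ U : ι → I, f (openLoad w D (copies z U) + w F)) - meanCost f w D z := by
    unfold meanCost meanMarginal
    exact integral_sub (integrable_copies hz fun a => f (openLoad w D a + w F))
      (integrable_meanCost hz D)
  rw [hmarg]
  unfold meanCost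
  have hi1 := integrable_meanCost (f := f) (w := w) hz' D
  have hi2 := integrable_meanCost (f := f) (w := w) hz D
  have hi3 := integrable_copies hz fun a => f (openLoad w D a + w F)
  have hmp := measurePreserving_update (ι := ι) F
  have hI : ∀ {g : (ι → I) → ℝ}, Integrable g →
      Integrable (fun U => ∫ u, g (Function.update U F u)) := fun hg =>
    (hmp.integrable_comp_of_integrable hg).integral_prod_left
  rw [integral_update F hi1, integral_update F hi2, integral_update F hi3,
    ← integral_sub (hI hi1) (hI hi2), ← integral_sub (hI hi3) (hI hi2), ← integral_const_mul]
  refine integral_mono ((hI hi1).sub (hI hi2)) (((hI hi3).sub (hI hi2)).const_mul _) fun U => ?_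
  -- With the other seeds fixed, the cost is a convex sequence `h` in the number of copies of `F`,
  -- evaluated at the rounding of `z F`.
  set base := openLoad w D (Function.update (copies z U) F 0) with hbase
  set h : ℕ → ℝ := fun k => f (base + (k : ℝ) • w F) with hh
  have hb0 : 0 ≤ base := openLoad_nonneg hw hD _
  have hcop : ∀ (y : ι → ℝ) (u : I), copies y (Function.update U F u)
      = Function.update (copies y U) F (roundUp (y F) u) := by
    intro y u
    ext G
    by_cases hG : G = F
    · subst hG; simp [copies]
    · simp [copies, Function.update_of_ne hG]
  have hcop' : ∀ k, Function.update (copies (Function.update z F (z F + δ)) U) F k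
      = Function.update (copies z U) F k := by
    intro k
    ext G
    by_cases hG : G = F
    · subst hG; simp
    · simp [copies, Function.update_of_ne hG]
  have e2 : ∀ u : I, f (openLoad w D (copies z (Function.update U F u))) = h (roundUp (z F) u) := by
    intro u; rw [hcop, openLoad_update]
  have e3 : ∀ u : I, f (openLoad w D (copies z (Function.update U F u)) + w F)
      = h (roundUp (z F) u + 1) := by
    intro u
    rw [hcop, openLoad_update, hh]
    simp only [Nat.cast_add, Nat.cast_one, add_smul, one_smul, add_assoc, hbase]
  have e1 : ∀ u : I, f (openLoad w D (copies (Function.update z F (z F + δ))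
      (Function.update U F u))) = h (roundUp (z F + δ) u) := by
    intro u
    rw [hcop, hcop', openLoad_update, Function.update_self]
  simp only [e1, e2, e3]
  refine integral_roundUp_add_le (hz F) h0 h1 h fun k => ?_
  have hk : 0 ≤ base + (k : ℝ) • w F := add_nonneg hb0 (smul_nonneg (Nat.cast_nonneg _) (hw F))
  have := hf.marginal_mono hk (le_add_of_nonneg_right (hw F)) (hw F)
  have e1 : base + ((k + 1 : ℕ) : ℝ) • w F = base + (k : ℝ) • w F + w F := by push_cast; module
  have e2 : base + ((k + 2 : ℕ) : ℝ) • w F = base + (k : ℝ) • w F + w F + w F := by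
    push_cast; module
  simp only [hh, e1, e2]
  exact this

end Product

/-! ### Multiplicative raising of facilities for one job -/

section Raise

variable {ι : Type} [Fintype ι] [DecidableEq ι]

/-- The parameters of the facilities: the base level `y₀`, capacities `K` and boosts `B`. -/
structure FacilityParams (ι : Type) where
  p : ℝ
  K : ι → ℝ
  B : ι → ℝ
  y₀ : ℝ

namespace FacilityParams

/-- The admissible parameters. -/
structure Valid (P : FacilityParams ι) : Prop where
  one_le_p : 1 ≤ P.p
  p_le_K : ∀ F, P.p ≤ P.K F
  p_le_B : ∀ F, P.p ≤ P.B F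
  y₀_pos : 0 < P.y₀

/-- The fractional extent to which `F` is open, capped at one. -/
noncomputable def level (P : FacilityParams ι) (F : ι) (z : ℝ) : ℝ := min (z / P.B F + P.y₀) 1

variable {P : FacilityParams ι}

lemma Valid.p_pos (h : P.Valid) : 0 < P.p := lt_of_lt_of_le one_pos h.one_le_p

lemma Valid.K_pos (h : P.Valid) (F : ι) : 0 < P.K F := h.p_pos.trans_le (h.p_le_K F)

lemma Valid.B_pos (h : P.Valid) (F : ι) : 0 < P.B F := h.p_pos.trans_le (h.p_le_B F)

lemma Valid.level_pos (h : P.Valid) {F : ι} {z : ℝ} (hz : 0 ≤ z) : 0 < P.level F z :=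
  lt_min (add_pos_of_nonneg_of_pos (div_nonneg hz (h.B_pos F).le) h.y₀_pos) one_pos

lemma level_le_one (F : ι) (z : ℝ) : P.level F z ≤ 1 := min_le_right _ _

lemma Valid.level_mono (h : P.Valid) (F : ι) {z z' : ℝ} (hzz : z ≤ z') :
    P.level F z ≤ P.level F z' :=
  min_le_min_right _ (by have := div_le_div_of_nonneg_right hzz (h.B_pos F).le; linarith)

lemma Valid.log_level_mono (h : P.Valid) (F : ι) {z z' : ℝ} (hz : 0 ≤ z) (hzz : z ≤ z') :
    Real.log (P.level F z) ≤ Real.log (P.level F z') :=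
  Real.log_le_log (h.level_pos hz) (h.level_mono F hzz)

lemma Valid.log_level_nonpos (h : P.Valid) {F : ι} {z : ℝ} (hz : 0 ≤ z) :
    Real.log (P.level F z) ≤ 0 :=
  Real.log_nonpos (h.level_pos hz).le (level_le_one F z)

/-- The increment of one elementary raise. -/
noncomputable def increment (P : FacilityParams ι) (F : ι) (z : ℝ) : ℝ := P.p / P.K F * P.level F z

lemma Valid.div_K_le_one (h : P.Valid) (F : ι) : P.p / P.K F ≤ 1 :=
  (div_le_one (h.K_pos F)).2 (h.p_le_K F)

lemma Valid.increment_nonneg (h : P.Valid) {F : ι} {z : ℝ} (hz : 0 ≤ z) : 0 ≤ P.increment F z :=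
  mul_nonneg (div_nonneg h.p_pos.le (h.K_pos F).le) (h.level_pos hz).le

lemma Valid.increment_le_one (h : P.Valid) {F : ι} {z : ℝ} (hz : 0 ≤ z) : P.increment F z ≤ 1 :=
  mul_le_one₀ (h.div_K_le_one F) (h.level_pos hz).le (level_le_one F z)

lemma Valid.rate_le_one (h : P.Valid) (F : ι) : P.p / P.K F / P.B F ≤ 1 :=
  (div_le_one (h.B_pos F)).2 ((h.div_K_le_one F).trans (h.one_le_p.trans (h.p_le_B F)))

/-- A raise adds `p / K` times the level before it. As the level at most doubles, it also adds `p /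
(2 K)` times the level after it, which is the form of `gain` in `RaiseInv`. -/
lemma Valid.level_increment_le (h : P.Valid) {F : ι} {z : ℝ} (hz : 0 ≤ z) :
    P.level F (z + P.increment F z) ≤ 2 * P.level F z := by
  have hl := (h.level_pos (F := F) hz).le
  have hr := h.rate_le_one F
  have e : (z + P.increment F z) / P.B F + P.y₀
      = (z / P.B F + P.y₀) + P.p / P.K F / P.B F * P.level F z := by
    rw [increment]; ring
  have h1 : P.p / P.K F / P.B F * P.level F z ≤ P.level F z := mul_le_of_le_one_left hl hr
  have h2 : P.level F z ≤ z / P.B F + P.y₀ := min_le_left _ _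
  conv_lhs => rw [level]
  rw [e]
  rcases le_total (z / P.B F + P.y₀) 1 with h3 | h3
  · have : P.level F z = z / P.B F + P.y₀ := min_eq_left h3
    exact (min_le_left _ _).trans (by linarith)
  · have : P.level F z = 1 := min_eq_right h3
    exact (min_le_right _ _).trans (by linarith)

lemma Valid.level_increment_eq (h : P.Valid) {F : ι} {z : ℝ} (hz : 0 ≤ z)
    (hlt : P.level F (z + P.increment F z) < 1) :
    P.level F (z + P.increment F z) = (1 + P.p / P.K F / P.B F) * P.level F z := by
  have hlt' : P.level F z < 1 :=
    (h.level_mono F (le_add_of_nonneg_right (h.increment_nonneg hz))).trans_lt hlt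
  have e1 : ∀ y, P.level F y < 1 → P.level F y = y / P.B F + P.y₀ := by
    intro y hy
    rcases min_lt_iff.1 hy with h1 | h1
    · exact min_eq_left h1.le
    · exact absurd h1 (lt_irrefl _)
  rw [e1 _ hlt, increment, e1 _ hlt']
  ring

lemma half_le_log {x : ℝ} (h0 : 0 ≤ x) (h1 : x ≤ 1) : x / 2 ≤ Real.log (1 + x) := by
  have h := Real.one_sub_inv_le_log_of_pos (x := 1 + x) (by linarith)
  have : x / 2 ≤ 1 - (1 + x)⁻¹ := by
    have : (1 + x)⁻¹ ≤ 1 - x / 2 := by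
      rw [inv_le_iff_one_le_mul₀ (by linarith)]
      nlinarith
    linarith
  linarith

/-- A raise makes the fractional extent grow by a definite factor until it reaches one. -/
lemma Valid.log_level_increment (h : P.Valid) {F : ι} {z : ℝ} (hz : 0 ≤ z)
    (hlt : P.level F (z + P.increment F z) < 1) :
    Real.log (P.level F z) + P.p / P.K F / P.B F / 2
      ≤ Real.log (P.level F (z + P.increment F z)) := by
  have hr0 : 0 ≤ P.p / P.K F / P.B F :=
    div_nonneg (div_nonneg h.p_pos.le (h.K_pos F).le) (h.B_pos F).le
  rw [h.level_increment_eq hz hlt, Real.log_mul (by linarith) (h.level_pos hz).ne']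
  have := half_le_log hr0 (h.rate_le_one F)
  linarith

end FacilityParams

/-- The outcome of processing one job fractionally. -/
structure RaiseOutcome (P : FacilityParams ι) (G : (ι → ℝ) → ℝ) (C : (ι → ℝ) → ι → ℝ)
    (dd : (ι → ℝ) → ℝ) (fac : Finset ι) (z z' : ι → ℝ) (t : ℝ) : Prop where
  le : z ≤ z'
  off : ∀ F ∉ fac, z' F = z F
  t_nonneg : 0 ≤ t
  t_le_direct : t ≤ dd z'
  t_le_price : ∀ F ∈ fac, t ≤ C z' F * (P.p / P.K F
    + 2 * P.B F * (Real.log (P.level F (z' F)) - Real.log (P.level F (z F))))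

/-- The invariant of the raising procedure. -/
structure RaiseInv (P : FacilityParams ι) (G : (ι → ℝ) → ℝ) (C : (ι → ℝ) → ι → ℝ)
    (dd : (ι → ℝ) → ℝ) (fac : Finset ι) (z zc : ι → ℝ) (τ : ι → ℝ) (R : Finset ι) (t : ℝ) :
    Prop where
  le : z ≤ zc
  off : ∀ F ∉ fac, zc F = z F
  subset : R ⊆ fac
  -- `τ F` is the price at the last raise of `F`, zero before any raise, and `t` is the latest
  -- price. The next price of `F` is `τ F + p / K * C`; by `next` the prices are nondecreasing.
  τ_nonneg : ∀ F, 0 ≤ τ F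
  τ_le : ∀ F, τ F ≤ t
  t_nonneg : 0 ≤ t
  τ_off : ∀ F ∉ R, τ F = 0
  cost : G zc - G z ≤ ∑ F ∈ R, τ F * P.level F (zc F)
  next : ∀ F ∈ fac, t ≤ τ F + P.p / P.K F * C zc F
  τ_le_price : ∀ F ∈ fac, τ F ≤ C zc F
    * (2 * P.B F * (Real.log (P.level F (zc F)) - Real.log (P.level F (z F))))
  t_le_direct : t ≤ dd zc
  gain : ∀ F ∈ R, P.p / (2 * P.K F) * P.level F (zc F) ≤ zc F - z F
  small : ∑ F ∈ R, P.level F (zc F) < 1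

/-- Always raise the facility `F₀` with the least next price. A raise by `p / K * level` costs at
most the increase of the price of `F₀` times its level. The total cost is thus at most the sum of
price times level over `R`, hence at most `t` while these levels sum to less than one. The potential
`∑ -log level` drops by at least `c` in every raise that does not end the loop, which bounds the
number of raises. -/
lemma raise_loop {P : FacilityParams ι} (hP : P.Valid) {G : (ι → ℝ) → ℝ}
    {C : (ι → ℝ) → ι → ℝ} {dd : (ι → ℝ) → ℝ}
    (hC0 : ∀ z F, 0 ≤ z → 0 ≤ C z F) (hCm : ∀ z z' F, 0 ≤ z → z ≤ z' → C z F ≤ C z' F)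
    (hG : ∀ z F δ, 0 ≤ z → 0 ≤ δ → δ ≤ 1 → G (Function.update z F (z F + δ)) - G z ≤ δ * C z F)
    (hdd : ∀ z z', 0 ≤ z → z ≤ z' → dd z ≤ dd z') (fac : Finset ι) {z : ι → ℝ} (hz : 0 ≤ z)
    {c : ℝ} (hc0 : 0 < c) (hc : ∀ F ∈ fac, c ≤ P.p / P.K F / P.B F / 2) (N : ℕ) :
    ∀ (zc τ : ι → ℝ) (R : Finset ι) (t : ℝ), RaiseInv P G C dd fac z zc τ R t →
      ∑ F ∈ fac, -Real.log (P.level F (zc F)) ≤ N * c →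
      ∃ z' t', RaiseOutcome P G C dd fac z z' t' ∧
        ((t' = dd z' ∧ G z' - G z ≤ t') ∨
          (G z' - G z ≤ 2 * t' ∧ ∃ R ⊆ fac, 1 ≤ ∑ F ∈ R, P.level F (z' F) ∧
            ∀ F ∈ R, P.p / (2 * P.K F) * P.level F (z' F) ≤ z' F - z F)) := by
  induction N with
  | zero => ?_
  | succ N ih => ?_
  all_goals
    intro zc τ R t inv hN
    have hzc : 0 ≤ zc := hz.trans inv.le
    have costR : G zc - G z ≤ t := by
      refine inv.cost.trans ?_
      calc ∑ F ∈ R, τ F * P.level F (zc F) ≤ ∑ F ∈ R, t * P.level F (zc F) :=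
            Finset.sum_le_sum fun F _ =>
              mul_le_mul_of_nonneg_right (inv.τ_le F) (hP.level_pos (hzc F)).le
        _ = t * ∑ F ∈ R, P.level F (zc F) := by rw [Finset.mul_sum]
        _ ≤ t * 1 := mul_le_mul_of_nonneg_left inv.small.le inv.t_nonneg
        _ = t := mul_one t
    have price : ∀ F ∈ fac, τ F + P.p / P.K F * C zc F ≤ C zc F * (P.p / P.K F
        + 2 * P.B F * (Real.log (P.level F (zc F)) - Real.log (P.level F (z F)))) := by
      intro F hF
      have := inv.τ_le_price F hF
      linarith
    by_cases hdirect : ∀ F ∈ fac, dd zc ≤ τ F + P.p / P.K F * C zc F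
    · exact ⟨zc, dd zc, ⟨inv.le, inv.off, inv.t_nonneg.trans inv.t_le_direct, le_rfl,
        fun F hF => (hdirect F hF).trans (price F hF)⟩,
        Or.inl ⟨rfl, costR.trans inv.t_le_direct⟩⟩
    push Not at hdirect
    obtain ⟨F₁, hF₁, hlt₁⟩ := hdirect
    obtain ⟨F₀, hF₀, hmin⟩ := Finset.exists_min_image fac
      (fun F => τ F + P.p / P.K F * C zc F) ⟨F₁, hF₁⟩
    set t' := τ F₀ + P.p / P.K F₀ * C zc F₀ with ht'
    have htt' : t ≤ t' := inv.next F₀ hF₀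
    have ht'd : t' ≤ dd zc := (hmin F₁ hF₁).trans hlt₁.le
    set δ := P.increment F₀ (zc F₀) with hδ
    have hδ0 : 0 ≤ δ := hP.increment_nonneg (hzc F₀)
    set zn := Function.update zc F₀ (zc F₀ + δ) with hzn
    have hzn0 : zn F₀ = zc F₀ + δ := by simp [hzn]
    have hzne : ∀ F, F ≠ F₀ → zn F = zc F := fun F hF => by simp [hzn, hF]
    have hzcn : zc ≤ zn := by
      intro F
      by_cases hF : F = F₀
      · subst hF; rw [hzn0]; linarith
      · rw [hzne F hF]
    have hCn : ∀ F, C zc F ≤ C zn F := fun F => hCm _ _ _ hzc hzcn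
    have hstep : G zn - G zc ≤ (t' - τ F₀) * P.level F₀ (zc F₀) := by
      have := hG zc F₀ δ hzc hδ0 (hP.increment_le_one (hzc F₀))
      refine this.trans (le_of_eq ?_)
      rw [ht', hδ, FacilityParams.increment]; ring
    have hlev : ∀ F, 0 < P.level F (zc F) := fun F => hP.level_pos (hzc F)
    have hlogmono : ∀ F, Real.log (P.level F (zc F)) ≤ Real.log (P.level F (zn F)) :=
      fun F => hP.log_level_mono F (hzc F) (hzcn F)
    have out : RaiseOutcome P G C dd fac z zn t' := by
      refine ⟨inv.le.trans hzcn, fun F hF => ?_, inv.t_nonneg.trans htt',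
        ht'd.trans (hdd _ _ hzc hzcn), fun F hF => ?_⟩
      · rw [hzne F (fun h => hF (h ▸ hF₀)), inv.off F hF]
      · refine (hmin F hF).trans ((price F hF).trans ?_)
        have h1 : 0 ≤ P.p / P.K F := div_nonneg hP.p_pos.le (hP.K_pos F).le
        have h2 : Real.log (P.level F (z F)) ≤ Real.log (P.level F (zc F)) :=
          hP.log_level_mono F (hz F) (inv.le F)
        have h3 := (hP.B_pos F).le
        have h4 := hlogmono F
        refine mul_le_mul (hCn F) ?_ ?_ (hC0 _ _ (hzc.trans hzcn))
        · gcongr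
        · exact add_nonneg h1 (mul_nonneg (by linarith) (by linarith))
    have hgain : ∀ F ∈ insert F₀ R, P.p / (2 * P.K F) * P.level F (zn F) ≤ zn F - z F := by
      intro F hF
      by_cases hFF : F = F₀
      · subst hFF
        have h1 := hP.level_increment_le (F := F) (hzc F)
        have h2 := inv.le F
        have h3 := hP.K_pos F
        have h4 := hP.p_pos
        rw [hzn0]
        have : P.p / (2 * P.K F) * P.level F (zc F + δ) ≤ δ := by
          calc P.p / (2 * P.K F) * P.level F (zc F + δ)
              ≤ P.p / (2 * P.K F) * (2 * P.level F (zc F)) := by gcongr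
            _ = δ := by rw [hδ, FacilityParams.increment]; field_simp
        linarith
      · rw [hzne F hFF]
        exact inv.gain F (Finset.mem_of_mem_insert_of_ne hF hFF)
    have hins : insert F₀ R ⊆ fac := Finset.insert_subset hF₀ inv.subset
    by_cases hfull : 1 ≤ ∑ F ∈ insert F₀ R, P.level F (zn F)
    · refine ⟨zn, t', out, Or.inr ⟨?_, insert F₀ R, hins, hfull, hgain⟩⟩
      -- The last raise may overshoot the level sum one, so its cost is bounded separately; hence
      -- the factor two in this outcome.
      have h1 : (t' - τ F₀) * P.level F₀ (zc F₀) ≤ t' := by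
        have h2 := inv.τ_nonneg F₀
        have h3 := inv.τ_le F₀
        have h4 := FacilityParams.level_le_one (P := P) F₀ (zc F₀)
        have h5 := (hlev F₀).le
        nlinarith
      linarith
    push Not at hfull
    have hlt : P.level F₀ (zn F₀) < 1 := by
      refine lt_of_le_of_lt ?_ hfull
      exact Finset.single_le_sum (f := fun F => P.level F (zn F))
        (fun F _ => (hP.level_pos ((hzc.trans hzcn) F)).le) (Finset.mem_insert_self _ _)
    have hlog := hP.log_level_increment (hzc F₀) (by rw [← hδ, ← hzn0]; exact hlt)
    rw [← hδ, ← hzn0] at hlog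
    have hmeas : ∑ F ∈ fac, -Real.log (P.level F (zn F))
        ≤ (∑ F ∈ fac, -Real.log (P.level F (zc F))) - c := by
      rw [← Finset.add_sum_erase _ _ hF₀, ← Finset.add_sum_erase _
        (fun F => -Real.log (P.level F (zc F))) hF₀]
      have h1 : ∑ F ∈ fac.erase F₀, -Real.log (P.level F (zn F))
          ≤ ∑ F ∈ fac.erase F₀, -Real.log (P.level F (zc F)) :=
        Finset.sum_le_sum fun F _ => neg_le_neg (hlogmono F)
      have h2 := hc F₀ hF₀
      linarith
    have hmeas0 : 0 ≤ ∑ F ∈ fac, -Real.log (P.level F (zn F)) :=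
      Finset.sum_nonneg fun F _ => neg_nonneg.2 (hP.log_level_nonpos ((hzc.trans hzcn) F))
  -- Without raises left, one more would make the potential negative.
  · simp only [Nat.cast_zero, zero_mul] at hN
    linarith
  · refine ih zn (Function.update τ F₀ t') (insert F₀ R) t' ?_ (by push_cast at hN; linarith)
    refine ⟨out.le, out.off, hins, fun F => ?_, fun F => ?_, out.t_nonneg, fun F hF => ?_, ?_,
      fun F hF => ?_, fun F hF => ?_, out.t_le_direct, hgain, hfull⟩
    · by_cases hF : F = F₀
      · subst hF; simpa using out.t_nonneg
      · simpa [hF] using inv.τ_nonneg F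
    · by_cases hF : F = F₀
      · subst hF; simp
      · simpa [hF] using (inv.τ_le F).trans htt'
    · have h1 : F ≠ F₀ := fun h => hF (h ▸ Finset.mem_insert_self _ _)
      simpa [h1] using inv.τ_off F (fun h => hF (Finset.mem_insert_of_mem h))
    · have e1 : ∑ F ∈ insert F₀ R, Function.update τ F₀ t' F * P.level F (zn F)
          = t' * P.level F₀ (zn F₀) + ∑ F ∈ R.erase F₀, τ F * P.level F (zc F) := by
        rw [← Finset.add_sum_erase _ _ (Finset.mem_insert_self F₀ R), Finset.erase_insert_eq_erase]
        simp only [Function.update_self]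
        congr 1
        refine Finset.sum_congr rfl fun F hF => ?_
        have := Finset.ne_of_mem_erase hF
        rw [Function.update_of_ne this, hzne F this]
      have e2 : ∑ F ∈ R, τ F * P.level F (zc F)
          = τ F₀ * P.level F₀ (zc F₀) + ∑ F ∈ R.erase F₀, τ F * P.level F (zc F) := by
        by_cases hR : F₀ ∈ R
        · rw [← Finset.add_sum_erase _ _ hR]
        · rw [Finset.erase_eq_of_notMem hR, inv.τ_off _ hR]; ring
      have h1 := inv.cost
      have h2 : t' * P.level F₀ (zc F₀) ≤ t' * P.level F₀ (zn F₀) :=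
        mul_le_mul_of_nonneg_left (hP.level_mono F₀ (hzcn F₀)) out.t_nonneg
      rw [e1]
      rw [e2] at h1
      linarith
    · by_cases hFF : F = F₀
      · subst hFF
        have : 0 ≤ P.p / P.K F * C zn F :=
          mul_nonneg (div_nonneg hP.p_pos.le (hP.K_pos F).le) (hC0 _ _ (hzc.trans hzcn))
        simpa using this
      · rw [Function.update_of_ne hFF]
        refine (hmin F hF).trans ?_
        have h1 : 0 ≤ P.p / P.K F := div_nonneg hP.p_pos.le (hP.K_pos F).le
        have := mul_le_mul_of_nonneg_left (hCn F) h1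
        linarith
    · have hB := (hP.B_pos F).le
      have h2 : Real.log (P.level F (z F)) ≤ Real.log (P.level F (zc F)) :=
        hP.log_level_mono F (hz F) (inv.le F)
      by_cases hFF : F = F₀
      · subst hFF
        rw [Function.update_self]
        refine (price F hF).trans ?_
        refine mul_le_mul (hCn F) ?_ ?_ (hC0 _ _ (hzc.trans hzcn))
        -- The price rises by `p / K` times `C` and the logarithm of the level by at least `p / (2 K
        -- B)`; the factor `2 B` converts one into the other.
        · have : P.p / P.K F = 2 * P.B F * (P.p / P.K F / P.B F / 2) := by
            have := (hP.B_pos F).ne'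
            field_simp
          have h5 := mul_le_mul_of_nonneg_left hlog (by linarith : 0 ≤ 2 * P.B F)
          linarith
        · exact add_nonneg (div_nonneg hP.p_pos.le (hP.K_pos F).le)
            (mul_nonneg (by linarith) (by linarith))
      · rw [Function.update_of_ne hFF, hzne F hFF]
        refine (inv.τ_le_price F hF).trans ?_
        exact mul_le_mul_of_nonneg_right (hCn F) (mul_nonneg (by linarith) (by linarith))

theorem exists_raise {P : FacilityParams ι} (hP : P.Valid) {G : (ι → ℝ) → ℝ}
    {C : (ι → ℝ) → ι → ℝ} {dd : (ι → ℝ) → ℝ}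
    (hC0 : ∀ z F, 0 ≤ z → 0 ≤ C z F) (hCm : ∀ z z' F, 0 ≤ z → z ≤ z' → C z F ≤ C z' F)
    (hG : ∀ z F δ, 0 ≤ z → 0 ≤ δ → δ ≤ 1 → G (Function.update z F (z F + δ)) - G z ≤ δ * C z F)
    (hdd0 : ∀ z, 0 ≤ z → 0 ≤ dd z) (hdd : ∀ z z', 0 ≤ z → z ≤ z' → dd z ≤ dd z')
    (fac : Finset ι) {z : ι → ℝ} (hz : 0 ≤ z) :
    ∃ z' t', RaiseOutcome P G C dd fac z z' t' ∧
      ((t' = dd z' ∧ G z' - G z ≤ t') ∨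
        (G z' - G z ≤ 2 * t' ∧ ∃ R ⊆ fac, 1 ≤ ∑ F ∈ R, P.level F (z' F) ∧
          ∀ F ∈ R, P.p / (2 * P.K F) * P.level F (z' F) ≤ z' F - z F)) := by
  obtain ⟨c, hc0, hc⟩ : ∃ c : ℝ, 0 < c ∧ ∀ F ∈ fac, c ≤ P.p / P.K F / P.B F / 2 := by
    have hpos : ∀ F, 0 < P.p / P.K F / P.B F / 2 := fun F =>
      half_pos (div_pos (div_pos hP.p_pos (hP.K_pos F)) (hP.B_pos F))
    rcases fac.eq_empty_or_nonempty with h | h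
    · exact ⟨1, one_pos, by simp [h]⟩
    · obtain ⟨F, hF, hmin⟩ := Finset.exists_min_image fac (fun F => P.p / P.K F / P.B F / 2) h
      exact ⟨_, hpos F, hmin⟩
  obtain ⟨N, hN⟩ := exists_nat_ge ((∑ F ∈ fac, -Real.log (P.level F (z F))) / c)
  rw [div_le_iff₀ hc0] at hN
  refine raise_loop hP hC0 hCm hG hdd fac hz hc0 hc N z 0 ∅ 0 ?_ hN
  refine ⟨le_rfl, fun _ _ => rfl, by simp, by simp, by simp, le_rfl, by simp, by simp,
    fun F _ => ?_, fun F _ => by simp, hdd0 z hz, by simp, by simp⟩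
  simpa using mul_nonneg (div_nonneg hP.p_pos.le (hP.K_pos F).le) (hC0 z F hz)

end Raise

/-! ### The fractional algorithm and its charging to an offline solution -/

section Sequence

variable {ι : Type} [Fintype ι] [DecidableEq ι] {m : ℕ}

/-- A job as seen by the fractional algorithm: the facilities that can serve it, and the machines
that can process it directly together with the loads incurred there. -/
structure Request (m : ℕ) (ι : Type) where
  fac : Finset ι
  avail : Finset (Fin m)
  u : Fin m → ℝ

/-- The deterministic part of the state: direct loads and expected numbers of open copies. -/
structure LoadState (m : ℕ) (ι : Type) where
  D : Fin m → ℝ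
  z : ι → ℝ

/-- What the fractional algorithm decides about a job. -/
inductive Decision (m : ℕ) (ι : Type) where
  | skip : Decision m ι
  | direct (i : Fin m) : Decision m ι
  | serve (R : Finset ι) : Decision m ι

variable (P : FacilityParams ι) (f : (Fin m → ℝ) → ℝ) (w : ι → Fin m → ℝ)

/-- The specification of one step of the fractional algorithm with price `t`. -/
structure IsStep (q : Request m ι) (s s' : LoadState m ι) (d : Decision m ι) (t : ℝ) : Prop where
  z_le : s.z ≤ s'.z
  D_le : s.D ≤ s'.D
  t_nonneg : 0 ≤ t
  t_le_direct : ∀ i ∈ q.avail, t ≤ meanMarginal f w s.D s'.z (Pi.single i (q.u i))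
  t_le_price : ∀ F ∈ q.fac, t ≤ meanMarginal f w s.D s'.z (w F) * (P.p / P.K F
    + 2 * P.B F * (Real.log (P.level F (s'.z F)) - Real.log (P.level F (s.z F))))
  cost : meanCost f w s'.D s'.z - meanCost f w s.D s.z ≤ 2 * t
  decision : (∃ i ∈ q.avail, d = .direct i ∧ s'.D = s.D + Pi.single i (q.u i)) ∨
    ∃ R ⊆ q.fac, d = .serve R ∧ s'.D = s.D ∧ 1 ≤ ∑ F ∈ R, P.level F (s'.z F) ∧
      ∀ F ∈ R, P.p / (2 * P.K F) * P.level F (s'.z F) ≤ s'.z F - s.z F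

variable {P f w}

/-- When direct processing wins, the raises have cost at most `t` and the cheapest machine adds
exactly `t`; otherwise the raises alone cost at most `2 * t`. -/
theorem exists_step {p : ℝ} (hf : IsSmoothCost p f) (hw : ∀ F, 0 ≤ w F) (hP : P.Valid)
    {q : Request m ι} (hq : q.avail.Nonempty) (hu : ∀ i, 0 ≤ q.u i) {s : LoadState m ι}
    (hD : 0 ≤ s.D) (hz : 0 ≤ s.z) : ∃ s' d t, IsStep P f w q s s' d t := by
  have hsing : ∀ i, 0 ≤ (Pi.single i (q.u i) : Fin m → ℝ) := fun i => Pi.single_nonneg.2 (hu i)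
  set dd : (ι → ℝ) → ℝ := fun z =>
    q.avail.inf' hq fun i => meanMarginal f w s.D z (Pi.single i (q.u i)) with hdd
  obtain ⟨z', t, out, h⟩ := exists_raise hP (G := meanCost f w s.D)
    (C := fun z F => meanMarginal f w s.D z (w F)) (dd := dd)
    (fun z F _ => meanMarginal_nonneg hf hw hD z (hw F))
    (fun z z' F h0 h1 => meanMarginal_mono hf hw hD le_rfl h0 h1 (hw F))
    (fun z F δ h0 h1 h2 => meanCost_raise_le hf hw hD h0 F h1 h2)
    (fun z _ => by
      rw [hdd, Finset.le_inf'_iff]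
      exact fun i _ => meanMarginal_nonneg hf hw hD z (hsing i))
    (fun z z' h0 h1 => by
      simp only [hdd]
      rw [Finset.le_inf'_iff]
      exact fun i hi => (Finset.inf'_le _ hi).trans
        (meanMarginal_mono hf hw hD le_rfl h0 h1 (hsing i)))
    q.fac hz
  have hdir : ∀ i ∈ q.avail, t ≤ meanMarginal f w s.D z' (Pi.single i (q.u i)) :=
    fun i hi => out.t_le_direct.trans (Finset.inf'_le _ hi)
  have hz' : 0 ≤ z' := hz.trans out.le
  rcases h with ⟨h1, h2⟩ | ⟨h1, R, hR, h2, h3⟩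
  · obtain ⟨i, hi, hmin⟩ := Finset.exists_mem_eq_inf' hq
      fun i => meanMarginal f w s.D z' (Pi.single i (q.u i))
    refine ⟨⟨s.D + Pi.single i (q.u i), z'⟩, .direct i, t, out.le,
      le_add_of_nonneg_right (hsing i), out.t_nonneg, hdir, out.t_le_price, ?_,
      Or.inl ⟨i, hi, rfl, rfl⟩⟩
    have h4 : meanCost f w (s.D + Pi.single i (q.u i)) z' - meanCost f w s.D z' = t := by
      rw [meanCost_add hz', h1, ← hmin]
    simp only
    linarith
  · exact ⟨⟨s.D, z'⟩, .serve R, t, out.le, le_rfl, out.t_nonneg, hdir, out.t_le_price, h1,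
      Or.inr ⟨R, hR, rfl, rfl, h2, h3⟩⟩

variable (P f w)

open Classical in
/-- One step of the fractional algorithm. -/
noncomputable def fracStep (q : Request m ι) (s : LoadState m ι) :
    LoadState m ι × Decision m ι × ℝ :=
  -- The choice depends only on the request and the current state, so the run is online. A request
  -- without available machines leaves the state unchanged.
  if h : q.avail.Nonempty ∧ ∃ o : LoadState m ι × Decision m ι × ℝ, IsStep P f w q s o.1 o.2.1 o.2.2
  then h.2.choose else (s, .skip, 0)

/-- The states of the fractional algorithm on a sequence of requests. -/
noncomputable def fracRun (q : ℕ → Request m ι) : ℕ → LoadState m ι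
  | 0 => ⟨0, 0⟩
  | j + 1 => (fracStep P f w (q j) (fracRun q j)).1

/-- The decision of the fractional algorithm about request `j`. -/
noncomputable def fracDecision (q : ℕ → Request m ι) (j : ℕ) : Decision m ι :=
  (fracStep P f w (q j) (fracRun P f w q j)).2.1

/-- The price that request `j` pays. -/
noncomputable def fracPrice (q : ℕ → Request m ι) (j : ℕ) : ℝ :=
  (fracStep P f w (q j) (fracRun P f w q j)).2.2

variable {P f w}

lemma fracRun_congr {q q' : ℕ → Request m ι} {j : ℕ} (h : ∀ k < j, q k = q' k) :
    fracRun P f w q j = fracRun P f w q' j := by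
  induction j with
  | zero => rfl
  | succ j ih => rw [fracRun, fracRun, ih fun k hk => h k (hk.trans (Nat.lt_succ_self j)),
      h j (Nat.lt_succ_self j)]

lemma fracDecision_congr {q q' : ℕ → Request m ι} {j : ℕ} (h : ∀ k ≤ j, q k = q' k) :
    fracDecision P f w q j = fracDecision P f w q' j := by
  rw [fracDecision, fracDecision, fracRun_congr fun k hk => h k hk.le, h j le_rfl]

lemma fracRun_inactive {q : ℕ → Request m ι} {j : ℕ} (h : ¬ (q j).avail.Nonempty) :
    fracRun P f w q (j + 1) = fracRun P f w q j ∧ fracDecision P f w q j = .skip := by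
  rw [fracRun, fracDecision, fracStep, dif_neg fun hc => h hc.1]
  exact ⟨rfl, rfl⟩

variable {p : ℝ} {q : ℕ → Request m ι}

lemma fracRun_nonneg_and_step (hf : IsSmoothCost p f) (hw : ∀ F, 0 ≤ w F) (hP : P.Valid)
    (hu : ∀ j i, 0 ≤ (q j).u i) (j : ℕ) :
    (0 ≤ (fracRun P f w q j).D ∧ 0 ≤ (fracRun P f w q j).z) ∧
      ((q j).avail.Nonempty → IsStep P f w (q j) (fracRun P f w q j) (fracRun P f w q (j + 1))
        (fracDecision P f w q j) (fracPrice P f w q j)) := by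
  have step : ∀ j, 0 ≤ (fracRun P f w q j).D → 0 ≤ (fracRun P f w q j).z →
      (q j).avail.Nonempty → IsStep P f w (q j) (fracRun P f w q j) (fracRun P f w q (j + 1))
        (fracDecision P f w q j) (fracPrice P f w q j) := by
    intro j hD hz ha
    have hex : ∃ o : LoadState m ι × Decision m ι × ℝ,
        IsStep P f w (q j) (fracRun P f w q j) o.1 o.2.1 o.2.2 := by
      obtain ⟨s', d, t, h⟩ := exists_step hf hw hP ha (hu j) hD hz
      exact ⟨(s', d, t), h⟩
    rw [fracRun, fracDecision, fracPrice, fracStep, dif_pos ⟨ha, hex⟩]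
    exact hex.choose_spec
  have nonneg : ∀ j, 0 ≤ (fracRun P f w q j).D ∧ 0 ≤ (fracRun P f w q j).z := by
    intro j
    induction j with
    | zero => exact ⟨le_rfl, le_rfl⟩
    | succ j ih =>
      by_cases ha : (q j).avail.Nonempty
      · have := step j ih.1 ih.2 ha
        exact ⟨ih.1.trans this.D_le, ih.2.trans this.z_le⟩
      · rw [(fracRun_inactive ha).1]; exact ih
  exact ⟨nonneg j, step j (nonneg j).1 (nonneg j).2⟩

lemma fracRun_D_nonneg (hf : IsSmoothCost p f) (hw : ∀ F, 0 ≤ w F) (hP : P.Valid)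
    (hu : ∀ j i, 0 ≤ (q j).u i) (j : ℕ) : 0 ≤ (fracRun P f w q j).D :=
  (fracRun_nonneg_and_step hf hw hP hu j).1.1

lemma fracRun_z_nonneg (hf : IsSmoothCost p f) (hw : ∀ F, 0 ≤ w F) (hP : P.Valid)
    (hu : ∀ j i, 0 ≤ (q j).u i) (j : ℕ) : 0 ≤ (fracRun P f w q j).z :=
  (fracRun_nonneg_and_step hf hw hP hu j).1.2

lemma fracRun_step (hf : IsSmoothCost p f) (hw : ∀ F, 0 ≤ w F) (hP : P.Valid)
    (hu : ∀ j i, 0 ≤ (q j).u i) {j : ℕ} (ha : (q j).avail.Nonempty) :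
    IsStep P f w (q j) (fracRun P f w q j) (fracRun P f w q (j + 1))
        (fracDecision P f w q j) (fracPrice P f w q j) :=
  (fracRun_nonneg_and_step hf hw hP hu j).2 ha

lemma fracRun_mono (hf : IsSmoothCost p f) (hw : ∀ F, 0 ≤ w F) (hP : P.Valid)
    (hu : ∀ j i, 0 ≤ (q j).u i) {j k : ℕ} (hjk : j ≤ k) :
    (fracRun P f w q j).D ≤ (fracRun P f w q k).D ∧
      (fracRun P f w q j).z ≤ (fracRun P f w q k).z := by
  induction k, hjk using Nat.le_induction with
  | base => exact ⟨le_rfl, le_rfl⟩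
  | succ k _ ih =>
    by_cases ha : (q k).avail.Nonempty
    · have := fracRun_step hf hw hP hu ha
      exact ⟨ih.1.trans this.D_le, ih.2.trans this.z_le⟩
    · rw [(fracRun_inactive ha).1]; exact ih

/-- At `z = 0` a copy can be open only if some seed equals one, which has probability zero. -/
lemma meanCost_zero : meanCost f w 0 0 = f 0 := by
  have hae : ∀ᵐ U : ι → I, ∀ F, U F ≠ 1 := by
    rw [ae_all_iff]
    exact fun F => Measure.ae_eval_ne (μ := fun _ : ι => (volume : Measure I)) F 1
  have : (fun U : ι → I => f (openLoad w 0 (copies 0 U))) =ᵐ[volume] fun _ => f 0 := by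
    filter_upwards [hae] with U hU
    congr 1
    simp only [openLoad, copies, roundUp, Pi.zero_apply, zero_add]
    refine Finset.sum_eq_zero fun F _ => ?_
    have : ⌊((U F : I) : ℝ)⌋₊ = 0 := Nat.floor_eq_zero.2
      (lt_of_le_of_ne (U F).2.2 fun h => hU F (Subtype.ext h))
    rw [this]; simp
  rw [meanCost, integral_congr_ae this]
  simp

lemma meanCost_fracRun_le (hf : IsSmoothCost p f) (hw : ∀ F, 0 ≤ w F) (hP : P.Valid)
    (hu : ∀ j i, 0 ≤ (q j).u i) (N : ℕ) [DecidablePred fun j => (q j).avail.Nonempty] :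
    meanCost f w (fracRun P f w q N).D (fracRun P f w q N).z
      ≤ f 0 + 2 * ∑ j ∈ (Finset.range N).filter fun j => (q j).avail.Nonempty,
        fracPrice P f w q j := by
  induction N with
  | zero => simp [fracRun, meanCost_zero]
  | succ N ih =>
    by_cases ha : (q N).avail.Nonempty
    · rw [Finset.range_add_one, Finset.filter_insert, if_pos ha, Finset.sum_insert (by simp)]
      have := (fracRun_step hf hw hP hu ha).cost
      linarith
    · rw [Finset.range_add_one, Finset.filter_insert, if_neg ha, (fracRun_inactive ha).1]
      exact ih

/-- How an offline solution serves the requests: large jobs by facilities in `used`, within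
capacity, small ones directly. -/
structure Offline (P : FacilityParams ι) (w : ι → Fin m → ℝ) (q : ℕ → Request m ι) (N : ℕ)
    (A₁ A₂ : ℝ) (T : Fin m → ℝ) where
  large : Finset ℕ
  small : Finset ℕ
  cover : ∀ j < N, (q j).avail.Nonempty → j ∈ large ∪ small
  subset : ∀ j ∈ large ∪ small, j < N ∧ (q j).avail.Nonempty
  disjoint : Disjoint large small
  fac : ℕ → ι
  mach : ℕ → Fin m
  coord : ι → Fin m
  used : Finset ι
  T_pos : ∀ i, 0 < T i
  w_eq : ∀ F ∈ used, w F = Pi.single (coord F) (T (coord F))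
  fac_used : ∀ j ∈ large, fac j ∈ used
  fac_mem : ∀ j ∈ large, fac j ∈ (q j).fac
  capacity : ∀ F ∈ used, ((large.filter fun j => fac j = F).card : ℝ) ≤ P.K F
  mach_mem : ∀ j ∈ small, mach j ∈ (q j).avail
  u_le : ∀ j ∈ small, (q j).u (mach j) ≤ T (mach j)
  -- A used facility is charged `p` for at most `K` base prices `p / K`, and `2 B log (1 / y₀)` for
  -- the growth of its level from `y₀` to at most one.
  boost_le : ∀ i, ∑ F ∈ used.filter fun F => coord F = i,
    (P.p + 2 * P.B F * Real.log (1 / P.y₀)) ≤ A₁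
  small_le : ∀ i, ∑ j ∈ small.filter fun j => mach j = i, (q j).u i / T i ≤ A₂

/-- Each job is charged to the option that the offline solution takes, at the marginals of the final
state. At a facility the terms `p / K` add up to at most `p` by capacity and the logarithms
telescope. A small job pays at most the fraction `u / T` of the marginal of a full load, by
convexity. Superadditivity merges the machines into one marginal of `T`. -/
theorem sum_fracPrice_le (hf : IsSmoothCost p f) (hw : ∀ F, 0 ≤ w F) (hP : P.Valid)
    (hy : P.y₀ ≤ 1) (hu : ∀ j i, 0 ≤ (q j).u i) {N : ℕ} {A₁ A₂ : ℝ} {T : Fin m → ℝ}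
    (off : Offline P w q N A₁ A₂ T) [DecidablePred fun j => (q j).avail.Nonempty] :
    ∑ j ∈ (Finset.range N).filter (fun j => (q j).avail.Nonempty), fracPrice P f w q j
      ≤ (A₁ + A₂) * meanMarginal f w (fracRun P f w q N).D (fracRun P f w q N).z T := by
  set M : (Fin m → ℝ) → ℝ :=
    meanMarginal f w (fracRun P f w q N).D (fracRun P f w q N).z with hM
  have hD := fracRun_D_nonneg hf hw hP hu (P := P) (f := f) (w := w) (q := q)
  have hz := fracRun_z_nonneg hf hw hP hu (P := P) (f := f) (w := w) (q := q)
  have hmono := fun {j k : ℕ} (h : j ≤ k) =>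
    fracRun_mono hf hw hP hu (P := P) (f := f) (w := w) (q := q) h
  have hMle : ∀ j < N, ∀ v : Fin m → ℝ, 0 ≤ v →
      meanMarginal f w (fracRun P f w q j).D (fracRun P f w q (j + 1)).z v ≤ M v :=
    fun j hj v hv => meanMarginal_mono hf hw (hD j) (hmono hj.le).1 (hz _) (hmono hj).2 hv
  have hM0 : ∀ v : Fin m → ℝ, 0 ≤ v → 0 ≤ M v := fun v hv =>
    meanMarginal_nonneg hf hw (hD N) _ hv
  have hTs : ∀ i, 0 ≤ (Pi.single i (T i) : Fin m → ℝ) := fun i =>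
    Pi.single_nonneg.2 (off.T_pos i).le
  have hlog0 : ∀ F, Real.log (P.level F ((fracRun P f w q 0).z F)) = -Real.log (1 / P.y₀) := by
    intro F
    simp [fracRun, FacilityParams.level, min_eq_left hy]
  have hlogN : ∀ F, Real.log (P.level F ((fracRun P f w q N).z F)) ≤ 0 := fun F =>
    hP.log_level_nonpos (hz N F)
  set Δ : ι → ℕ → ℝ := fun F j => Real.log (P.level F ((fracRun P f w q (j + 1)).z F))
    - Real.log (P.level F ((fracRun P f w q j).z F)) with hΔ
  have hΔ0 : ∀ F j, 0 ≤ Δ F j := fun F j => sub_nonneg.2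
    (hP.log_level_mono F (hz j F) ((hmono (Nat.le_succ j)).2 F))
  have hΔsum : ∀ F, ∑ j ∈ Finset.range N, Δ F j ≤ Real.log (1 / P.y₀) := by
    intro F
    rw [hΔ, Finset.sum_range_sub (fun j => Real.log (P.level F ((fracRun P f w q j).z F))),
      hlog0]
    linarith [hlogN F]
  have hset : (Finset.range N).filter (fun j => (q j).avail.Nonempty) = off.large ∪ off.small := by
    ext j
    simp only [Finset.mem_filter, Finset.mem_range]
    exact ⟨fun h => off.cover j h.1 h.2, fun h => off.subset j h⟩
  rw [hset, Finset.sum_union off.disjoint]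
  have hlarge : ∑ j ∈ off.large, fracPrice P f w q j
      ≤ ∑ F ∈ off.used, M (w F) * (P.p + 2 * P.B F * Real.log (1 / P.y₀)) := by
    rw [← Finset.sum_fiberwise_of_maps_to off.fac_used]
    refine Finset.sum_le_sum fun F hF => ?_
    have hB := (hP.B_pos F).le
    have hK := hP.K_pos F
    calc ∑ j ∈ off.large.filter fun j => off.fac j = F, fracPrice P f w q j
        ≤ ∑ j ∈ off.large.filter fun j => off.fac j = F,
          M (w F) * (P.p / P.K F + 2 * P.B F * Δ F j) := by
          refine Finset.sum_le_sum fun j hj => ?_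
          obtain ⟨hj1, rfl⟩ := Finset.mem_filter.1 hj
          have hjN := off.subset j (Finset.mem_union_left _ hj1)
          refine ((fracRun_step hf hw hP hu hjN.2).t_le_price _ (off.fac_mem j hj1)).trans ?_
          refine mul_le_mul_of_nonneg_right (hMle j hjN.1 _ (hw _)) ?_
          exact add_nonneg (div_nonneg hP.p_pos.le hK.le)
            (mul_nonneg (by linarith) (hΔ0 _ j))
      _ = M (w F) * (((off.large.filter fun j => off.fac j = F).card : ℝ) * (P.p / P.K F)
          + 2 * P.B F * ∑ j ∈ off.large.filter fun j => off.fac j = F, Δ F j) := by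
          rw [← Finset.mul_sum, Finset.sum_add_distrib, Finset.sum_const, nsmul_eq_mul,
            ← Finset.mul_sum]
      _ ≤ M (w F) * (P.p + 2 * P.B F * Real.log (1 / P.y₀)) := by
          refine mul_le_mul_of_nonneg_left ?_ (hM0 _ (hw F))
          refine add_le_add ?_ ?_
          · calc ((off.large.filter fun j => off.fac j = F).card : ℝ) * (P.p / P.K F)
                ≤ P.K F * (P.p / P.K F) := mul_le_mul_of_nonneg_right (off.capacity F hF)
                  (div_nonneg hP.p_pos.le hK.le)
              _ = P.p := by field_simp
          · refine mul_le_mul_of_nonneg_left (le_trans ?_ (hΔsum F)) (by linarith)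
            refine Finset.sum_le_sum_of_subset_of_nonneg (fun j hj => ?_) fun j _ _ => hΔ0 F j
            exact Finset.mem_range.2
              (off.subset j (Finset.mem_union_left _ (Finset.mem_filter.1 hj).1)).1
  have hlarge' : ∑ F ∈ off.used, M (w F) * (P.p + 2 * P.B F * Real.log (1 / P.y₀))
      ≤ ∑ i, M (Pi.single i (T i)) * A₁ := by
    rw [← Finset.sum_fiberwise (s := off.used) (g := off.coord)]
    refine Finset.sum_le_sum fun i _ => ?_
    calc ∑ F ∈ off.used.filter fun F => off.coord F = i,
          M (w F) * (P.p + 2 * P.B F * Real.log (1 / P.y₀))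
        = M (Pi.single i (T i)) * ∑ F ∈ off.used.filter fun F => off.coord F = i,
          (P.p + 2 * P.B F * Real.log (1 / P.y₀)) := by
          rw [Finset.mul_sum]
          refine Finset.sum_congr rfl fun F hF => ?_
          obtain ⟨h1, rfl⟩ := Finset.mem_filter.1 hF
          rw [off.w_eq F h1]
      _ ≤ _ := mul_le_mul_of_nonneg_left (off.boost_le i) (hM0 _ (hTs i))
  have hsmall : ∑ j ∈ off.small, fracPrice P f w q j ≤ ∑ i, M (Pi.single i (T i)) * A₂ := by
    rw [← Finset.sum_fiberwise (s := off.small) (g := off.mach)]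
    refine Finset.sum_le_sum fun i _ => ?_
    calc ∑ j ∈ off.small.filter fun j => off.mach j = i, fracPrice P f w q j
        ≤ ∑ j ∈ off.small.filter fun j => off.mach j = i,
          M (Pi.single i (T i)) * ((q j).u i / T i) := by
          refine Finset.sum_le_sum fun j hj => ?_
          obtain ⟨hj1, rfl⟩ := Finset.mem_filter.1 hj
          have hjN := off.subset j (Finset.mem_union_right _ hj1)
          have hT := off.T_pos (off.mach j)
          refine ((fracRun_step hf hw hP hu hjN.2).t_le_direct _ (off.mach_mem j hj1)).trans ?_
          refine (hMle j hjN.1 _ (Pi.single_nonneg.2 (hu j _))).trans ?_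
          have e : (Pi.single (off.mach j) ((q j).u (off.mach j)) : Fin m → ℝ)
              = ((q j).u (off.mach j) / T (off.mach j)) •
                (Pi.single (off.mach j) (T (off.mach j)) : Fin m → ℝ) := by
            rw [← Pi.single_smul, smul_eq_mul, div_mul_cancel₀ _ hT.ne']
          rw [e, mul_comm]
          exact meanMarginal_chord hf hw (hD N) (hz N) (hTs _) (div_nonneg (hu j _) hT.le)
            ((div_le_one hT).2 (off.u_le j hj1))
      _ ≤ _ := by
          rw [← Finset.mul_sum]
          exact mul_le_mul_of_nonneg_left (off.small_le i) (hM0 _ (hTs i))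
  have hsum : ∑ i, M (Pi.single i (T i)) ≤ M T := by
    have := meanMarginal_sum hf hw (hD N) (hz N) Finset.univ
      (fun i => (Pi.single i (T i) : Fin m → ℝ)) fun i _ => hTs i
    rwa [Finset.univ_sum_single] at this
  rw [← Finset.sum_mul] at hlarge' hsmall
  -- `A₁` and `A₂` are known to be nonnegative only if there is a machine.
  by_cases hm : Nonempty (Fin m)
  · obtain ⟨i₀⟩ := hm
    have hA1 : 0 ≤ A₁ := le_trans (Finset.sum_nonneg fun F _ => add_nonneg hP.p_pos.le
      (mul_nonneg (mul_nonneg zero_le_two (hP.B_pos F).le)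
        (Real.log_nonneg ((one_le_div hP.y₀_pos).2 hy)))) (off.boost_le i₀)
    have hA2 : 0 ≤ A₂ := le_trans (Finset.sum_nonneg fun j _ =>
      div_nonneg (hu j _) (off.T_pos i₀).le) (off.small_le i₀)
    nlinarith
  · have hempty : IsEmpty (Fin m) := not_nonempty_iff.1 hm
    have : M T = 0 := by
      have hT0 : T = 0 := Subsingleton.elim _ _
      rw [hT0, hM]; simp [meanMarginal]
    simp only [Finset.univ_eq_empty, Finset.sum_empty, zero_mul] at hlarge' hsmall
    rw [this]; linarith

/-- The expected cost of the open facilities and the direct loads. -/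
theorem meanCost_fracRun_le_offline (hf : IsSmoothCost p f) (hw : ∀ F, 0 ≤ w F) (hP : P.Valid)
    (hy : P.y₀ ≤ 1) (hu : ∀ j i, 0 ≤ (q j).u i) {N : ℕ} {A₁ A₂ : ℝ} {T : Fin m → ℝ}
    (off : Offline P w q N A₁ A₂ T) {γ : ℝ} (hγ : 1 ≤ γ) (hA : 2 * (A₁ + A₂) ≤ γ) :
    meanCost f w (fracRun P f w q N).D (fracRun P f w q N).z
      ≤ 2 * f 0 + f ((4 * γ * p) • T) := by
  classical
  have hD := fracRun_D_nonneg hf hw hP hu (P := P) (f := f) (w := w) (q := q) N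
  have hz := fracRun_z_nonneg hf hw hP hu (P := P) (f := f) (w := w) (q := q) N
  have hT : 0 ≤ T := fun i => (off.T_pos i).le
  have h1 := meanCost_fracRun_le hf hw hP hu (P := P) (f := f) (w := w) (q := q) N
  have h2 := sum_fracPrice_le hf hw hP hy hu off
  have h3 := meanMarginal_nonneg hf hw hD (fracRun P f w q N).z hT
  -- Absorption applied for every seed: half of the mean cost returns and moves to the left-hand
  -- side.
  have h4 : γ * meanMarginal f w (fracRun P f w q N).D (fracRun P f w q N).z T
      ≤ meanCost f w (fracRun P f w q N).D (fracRun P f w q N).z / 2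
        + 1 / 2 * f ((4 * γ * p) • T) := by
    unfold meanMarginal meanCost
    rw [← integral_const_mul, ← integral_div]
    have hi := integrable_meanCost (f := f) (w := w) hz (fracRun P f w q N).D
    rw [show (1 / 2 * f ((4 * γ * p) • T))
      = ∫ _ : ι → I, 1 / 2 * f ((4 * γ * p) • T) by simp, ← integral_add (hi.div_const 2)
      (integrable_const _)]
    exact integral_mono ((integrable_meanMarginal hz _ _).const_mul _)
      ((hi.div_const 2).add (integrable_const _))
      fun U => hf.add_le_weighted (openLoad_nonneg hw hD _) hT hγ
  have h5 := mul_le_mul_of_nonneg_right hA h3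
  linarith

end Sequence

/-! ### Random objects determined by finitely many events -/

section Finitary

variable {Ω : Type} [MeasurableSpace Ω]

/-- A random object that depends on finitely many events. -/
def IsFinitary {β : Type*} (X : Ω → β) : Prop :=
  ∃ (α : Type) (_ : Fintype α) (s : Ω → α), (∀ a, MeasurableSet (s ⁻¹' {a})) ∧
    ∃ g : α → β, X = fun ω => g (s ω)

lemma IsFinitary.comp {β γ : Type*} {X : Ω → β} (h : IsFinitary X) (g : β → γ) :
    IsFinitary fun ω => g (X ω) := by
  obtain ⟨α, i, s, hs, k, rfl⟩ := h
  exact ⟨α, i, s, hs, fun a => g (k a), rfl⟩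

lemma IsFinitary.const {β : Type*} (b : β) : IsFinitary fun _ : Ω => b :=
  ⟨Unit, inferInstance, fun _ => (), fun a => by simp, fun _ => b, rfl⟩

lemma IsFinitary.prodMk {β γ : Type*} {X : Ω → β} {Y : Ω → γ} (hX : IsFinitary X)
    (hY : IsFinitary Y) : IsFinitary fun ω => (X ω, Y ω) := by
  obtain ⟨α, i, s, hs, k, rfl⟩ := hX
  obtain ⟨α', i', s', hs', k', rfl⟩ := hY
  refine ⟨α × α', inferInstance, fun ω => (s ω, s' ω), fun a => ?_,
    fun a => (k a.1, k' a.2), rfl⟩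
  have : (fun ω => (s ω, s' ω)) ⁻¹' {a} = s ⁻¹' {a.1} ∩ s' ⁻¹' {a.2} := by
    ext ω; simp [Prod.ext_iff]
  rw [this]
  exact (hs _).inter (hs' _)

lemma IsFinitary.pi {κ : Type} [Fintype κ] {β : κ → Type*} {X : ∀ k, Ω → β k}
    (h : ∀ k, IsFinitary (X k)) : IsFinitary fun ω k => X k ω := by
  classical
  choose α i s hs g hg using h
  refine ⟨∀ k, α k, inferInstance, fun ω k => s k ω, fun a => ?_, fun a k => g k (a k), ?_⟩
  · have : (fun ω k => s k ω) ⁻¹' {a} = ⋂ k, s k ⁻¹' {a k} := by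
      ext ω; simp [funext_iff]
    rw [this]
    exact MeasurableSet.iInter fun k => hs k _
  · funext ω k
    rw [hg k]

lemma IsFinitary.of_set {s : Set Ω} (hs : MeasurableSet s) : IsFinitary fun ω => ω ∈ s := by
  classical
  refine ⟨Bool, inferInstance, fun ω => decide (ω ∈ s), fun a => ?_, fun b => b = true, ?_⟩
  · cases a
    · have : (fun ω => decide (ω ∈ s)) ⁻¹' {false} = sᶜ := by ext; simp
      rw [this]; exact hs.compl
    · have : (fun ω => decide (ω ∈ s)) ⁻¹' {true} = s := by ext; simp
      rw [this]; exact hs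
  · funext ω; simp

/-- Every preimage is a finite union of basic events, whatever the σ-algebra on `β`. Neither `f` nor
the choice of minimizers then has to be measurable. -/
lemma IsFinitary.measurable {β : Type*} [MeasurableSpace β] {X : Ω → β} (h : IsFinitary X) :
    Measurable X := by
  obtain ⟨α, i, s, hs, g, rfl⟩ := h
  intro t _
  have : (fun ω => g (s ω)) ⁻¹' t = ⋃ a ∈ {a | g a ∈ t}, s ⁻¹' {a} := by
    ext ω; simp
  rw [this]
  exact MeasurableSet.biUnion (Set.to_countable _) fun a _ => hs a

lemma IsFinitary.integrable {μ : Measure Ω} [IsFiniteMeasure μ] {X : Ω → ℝ} (h : IsFinitary X) :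
    Integrable X μ := by
  have hm := h.measurable
  obtain ⟨α, i, s, hs, g, rfl⟩ := h
  refine Integrable.of_bound (C := ∑ a, |g a|) hm.aestronglyMeasurable
    (Filter.Eventually.of_forall fun ω => ?_)
  rw [Real.norm_eq_abs]
  exact Finset.single_le_sum (f := fun a => |g a|) (fun _ _ => abs_nonneg _) (Finset.mem_univ _)

end Finitary

/-! ### Fresh facilities: failure probability and pathwise use -/

section Fresh

/-- A facility with expected number of copies `z` is fresh if `z ≥ 1` or its first copy was opened
after its expected number exceeded `z / 2`. -/
def Fresh (z : ℝ) (u : I) : Prop := 1 ≤ z ∨ (z / 2 < 1 - (u : ℝ) ∧ 1 - (u : ℝ) ≤ z)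

open Classical in
/-- The probability that a facility is fresh. -/
noncomputable def freshProb (z : ℝ) : ℝ := if 1 ≤ z then 1 else z / 2

lemma freshProb_pos {z : ℝ} (hz : 0 < z) : 0 < freshProb z := by
  unfold freshProb; split_ifs <;> linarith

lemma measurableSet_fresh (z : ℝ) : MeasurableSet {u : I | Fresh z u} := by
  unfold Fresh
  refine (MeasurableSet.const _).union (MeasurableSet.inter ?_ ?_)
  · exact measurableSet_lt measurable_const (measurable_const.sub measurable_subtype_coe)
  · exact measurableSet_le (measurable_const.sub measurable_subtype_coe) measurable_const

/-- `1 - u` is the value of `z` at which the first copy opens, so a fresh facility is open and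
remains so. -/
lemma Fresh.one_le_roundUp {z z' : ℝ} {u : I} (h : Fresh z u) (hzz : z ≤ z') :
    1 ≤ roundUp z' u := by
  rw [roundUp, Nat.one_le_floor_iff]
  have := u.2.1
  rcases h with h | h <;> linarith [h]

lemma volume_fresh {z : ℝ} (hz : 0 < z) (h1 : z < 1) :
    (volume : Measure I).real {u : I | Fresh z u} = z / 2 := by
  have : {u : I | Fresh z u} = Set.Ico ⟨1 - z, by linarith, by linarith⟩
      ⟨1 - z / 2, by linarith, by linarith⟩ := by
    ext u
    simp only [Fresh, Set.mem_ofPred_eq, Set.mem_Ico, ← Subtype.coe_le_coe, ← Subtype.coe_lt_coe]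
    constructor
    · rintro (h | ⟨h, h'⟩)
      · linarith
      · constructor <;> linarith
    · rintro ⟨h, h'⟩
      right; constructor <;> linarith
  rw [this, Measure.real, unitInterval.volume_Ico]
  simp only
  rw [ENNReal.toReal_ofReal (by linarith)]
  ring

open Classical in
/-- The indicator of freshness, normalized to have mean one. -/
noncomputable def freshWeight (z : ℝ) (u : I) : ℝ := if Fresh z u then (freshProb z)⁻¹ else 0

lemma freshWeight_nonneg {z : ℝ} (hz : 0 < z) (u : I) : 0 ≤ freshWeight z u := by
  unfold freshWeight; split_ifs
  · exact inv_nonneg.2 (freshProb_pos hz).le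
  · exact le_rfl

lemma measurable_freshWeight (z : ℝ) : Measurable (freshWeight z) :=
  Measurable.ite (measurableSet_fresh z) measurable_const measurable_const

/-- For `z < 1` the weight is `2 / z` with probability `z / 2`, so the mean is `1 - z / 2 * (1 - exp
(-x))` with `x = 2 * c / z`. The condition `c ≤ z` gives `x ≤ 2`, where `1 - exp (-x) ≥ x / 3`. -/
lemma integral_exp_freshWeight_le {z c : ℝ} (hz : 0 < z) (hc : 0 ≤ c) (hcz : z < 1 → c ≤ z) :
    ∫ u : I, Real.exp (-(c * freshWeight z u)) ≤ Real.exp (-(c / 3)) := by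
  by_cases h1 : 1 ≤ z
  · have : ∀ u : I, freshWeight z u = 1 := fun u => by
      simp [freshWeight, Fresh, h1, freshProb]
    simp only [this, mul_one, integral_const, probReal_univ, one_smul]
    exact Real.exp_le_exp.2 (by linarith)
  · push Not at h1
    have e : (fun u : I => Real.exp (-(c * freshWeight z u)))
        = fun u => 1 - {u : I | Fresh z u}.indicator (fun _ => 1 - Real.exp (-(2 * c / z))) u := by
      funext u
      by_cases h : Fresh z u
      · rw [Set.indicator_of_mem (Set.mem_ofPred_eq ▸ h), freshWeight, if_pos h, freshProb,
          if_neg (not_le.2 h1), inv_div, show c * (2 / z) = 2 * c / z by ring]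
        ring
      · have hn : u ∉ {u : I | Fresh z u} := fun hc => h hc
        rw [Set.indicator_of_notMem hn, freshWeight, if_neg h]
        simp
    rw [e, integral_sub (integrable_const _)
      ((integrable_const _).indicator (measurableSet_fresh z)),
      integral_indicator (measurableSet_fresh z)]
    simp only [integral_const, probReal_univ, smul_eq_mul, measureReal_restrict_apply,
      MeasurableSet.univ, Set.univ_inter, volume_fresh hz h1]
    set x : ℝ := 2 * c / z with hx
    have hx0 : 0 ≤ x := by positivity
    have hx2 : x ≤ 2 := by
      rw [hx, div_le_iff₀ hz]; linarith [hcz h1]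
    have h2 : x / 3 ≤ 1 - Real.exp (-x) := by
      have h3 := Real.add_one_le_exp x
      have h4 : Real.exp (-x) ≤ (1 + x)⁻¹ := by
        rw [Real.exp_neg]
        exact inv_anti₀ (by linarith) (by linarith)
      have h5 : (1 + x)⁻¹ ≤ 1 - x / 3 := by
        rw [inv_le_iff_one_le_mul₀ (by linarith)]; nlinarith
      linarith
    have h3 : z / 2 * (x / 3) = c / 3 := by rw [hx]; field_simp
    have h4 := mul_le_mul_of_nonneg_left h2 (by linarith : 0 ≤ z / 2)
    have h5 := Real.add_one_le_exp (-(c / 3))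
    linarith

variable {ι : Type} [Fintype ι] [DecidableEq ι]

/-- The fresh facilities rarely have a small total weight. -/
lemma measure_freshWeight_small {L : Finset ι} {x z : ι → ℝ} {l : ℝ} (hl : 0 ≤ l)
    (hz : ∀ F ∈ L, 0 < z F) (hx : ∀ F ∈ L, 0 ≤ x F) (hxz : ∀ F ∈ L, z F < 1 → l * x F ≤ z F)
    (hsum : 1 / 4 ≤ ∑ F ∈ L, x F) :
    (volume : Measure (ι → I)).real {U | ∑ F ∈ L, x F * freshWeight (z F) (U F) < 1 / 24}
      ≤ Real.exp (-(l / 24)) := by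
  set S : (ι → I) → ℝ := fun U => ∑ F ∈ L, x F * freshWeight (z F) (U F) with hS
  have hSm : Measurable S := Finset.measurable_sum _ fun F _ =>
    ((measurable_freshWeight _).comp (measurable_pi_apply F)).const_mul _
  have hS0 : ∀ U, 0 ≤ S U := fun U => Finset.sum_nonneg fun F hF =>
    mul_nonneg (hx F hF) (freshWeight_nonneg (hz F hF) _)
  have hset : MeasurableSet {U | S U < 1 / 24} := measurableSet_lt hSm measurable_const
  -- Chernoff bound: independence factorizes the exponential moment, and total extent at least `1 /
  -- 4` gives the rate `l / 12`. Markov's inequality at level `1 / 24` leaves half of it.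
  have hint : ∫ U, Real.exp (-(l * S U)) ≤ Real.exp (-(l / 12)) := by
    have e : ∀ U, Real.exp (-(l * S U))
        = ∏ F, if F ∈ L then Real.exp (-(l * x F * freshWeight (z F) (U F))) else 1 := by
      intro U
      rw [Finset.prod_ite_mem, Finset.univ_inter, ← Real.exp_sum, Finset.sum_neg_distrib, hS,
        Finset.mul_sum]
      simp only [mul_assoc]
    simp only [e]
    rw [integral_fintype_prod_volume_eq_prod
      (fun F u => if F ∈ L then Real.exp (-(l * x F * freshWeight (z F) u)) else (1 : ℝ))]
    calc ∏ F, ∫ u : I, (if F ∈ L then Real.exp (-(l * x F * freshWeight (z F) u)) else (1 : ℝ))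
        ≤ ∏ F, if F ∈ L then Real.exp (-(l * x F / 3)) else 1 := by
          refine Finset.prod_le_prod (fun F _ => integral_nonneg fun u => ?_) fun F _ => ?_
          · simp only; split_ifs <;> positivity
          · by_cases hF : F ∈ L
            · simp only [if_pos hF]
              exact integral_exp_freshWeight_le (hz F hF) (mul_nonneg hl (hx F hF)) (hxz F hF)
            · simp [if_neg hF]
      _ = Real.exp (-(l / 3 * ∑ F ∈ L, x F)) := by
          rw [Finset.prod_ite_mem, Finset.univ_inter, ← Real.exp_sum, Finset.mul_sum,
            Finset.sum_neg_distrib]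
          congr 2
          exact Finset.sum_congr rfl fun F _ => by ring
      _ ≤ Real.exp (-(l / 12)) := Real.exp_le_exp.2 (by nlinarith)
  have hexp : Integrable fun U => Real.exp (-(l * S U)) := by
    refine Integrable.of_bound (C := 1) (Real.measurable_exp.comp
      (hSm.const_mul l).neg).aestronglyMeasurable (Filter.Eventually.of_forall fun U => ?_)
    rw [Real.norm_eq_abs, abs_of_pos (Real.exp_pos _)]
    exact Real.exp_le_one_iff.2 (neg_nonpos.2 (mul_nonneg hl (hS0 U)))
  have h1 : (volume : Measure (ι → I)).real {U | S U < 1 / 24}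
      ≤ ∫ U, Real.exp (l / 24) * Real.exp (-(l * S U)) := by
    rw [← integral_indicator_one hset]
    refine integral_mono ((integrable_const (1 : ℝ)).indicator hset) (hexp.const_mul _) fun U => ?_
    simp only [Set.indicator, Set.mem_ofPred_eq, Pi.one_apply]
    split_ifs with h
    · rw [← Real.exp_add]
      refine Real.one_le_exp ?_
      nlinarith
    · positivity
  rw [integral_const_mul] at h1
  refine h1.trans ?_
  calc Real.exp (l / 24) * ∫ U, Real.exp (-(l * S U))
      ≤ Real.exp (l / 24) * Real.exp (-(l / 12)) := by gcongr
    _ = Real.exp (-(l / 24)) := by rw [← Real.exp_add]; congr 1; ring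

/-- The increments over `J` are part of a telescoping sum that ends at the last index of `J`, where
`y` is still at most `Y`. -/
lemma sum_increments_le {y : ℕ → ℝ} (hy : Monotone y) (h0 : y 0 = 0) (J : Finset ℕ) {Y : ℝ}
    (hY : 0 ≤ Y) (hJ : ∀ k ∈ J, y (k + 1) ≤ Y) : ∑ k ∈ J, (y (k + 1) - y k) ≤ Y := by
  rcases J.eq_empty_or_nonempty with rfl | hne
  · simpa using hY
  · have hmax := J.max'_mem hne
    calc ∑ k ∈ J, (y (k + 1) - y k) ≤ ∑ k ∈ Finset.range (J.max' hne + 1), (y (k + 1) - y k) := by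
          refine Finset.sum_le_sum_of_subset_of_nonneg (fun k hk => ?_) fun k _ _ =>
            sub_nonneg.2 (hy (Nat.le_succ k))
          exact Finset.mem_range.2 (Nat.lt_succ_of_le (J.le_max' k hk))
      _ = y (J.max' hne + 1) := by rw [Finset.sum_range_sub, h0, sub_zero]
      _ ≤ Y := hJ _ hmax

/-- The total normalized extent of the jobs for which a facility is fresh is proportional to its
final number of copies. -/
lemma sum_freshWeight_le {y : ℕ → ℝ} (hy : Monotone y) (h0 : y 0 = 0) {N : ℕ} (J : Finset ℕ)
    (hJN : ∀ k ∈ J, k < N) {x : ℕ → ℝ} {c : ℝ} (hc : 0 ≤ c)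
    (hx : ∀ k ∈ J, x k ≤ c * (y (k + 1) - y k)) (hx0 : ∀ k ∈ J, 0 ≤ x k) (u : I) :
    ∑ k ∈ J, x k * freshWeight (y (k + 1)) u ≤ 6 * c * roundUp (y N) u := by
  classical
  have hyN : ∀ k ∈ J, y (k + 1) ≤ y N := fun k hk => hy (hJN k hk)
  have hyN0 : 0 ≤ y N := h0 ▸ hy (Nat.zero_le N)
  have hle : ∀ J' ⊆ J, ∀ Y : ℝ, 0 ≤ Y → (∀ k ∈ J', y (k + 1) ≤ Y) → ∑ k ∈ J', x k ≤ c * Y := by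
    intro J' hJ' Y hY hb
    calc ∑ k ∈ J', x k ≤ ∑ k ∈ J', c * (y (k + 1) - y k) :=
          Finset.sum_le_sum fun k hk => hx k (hJ' hk)
      _ = c * ∑ k ∈ J', (y (k + 1) - y k) := by rw [Finset.mul_sum]
      _ ≤ c * Y := mul_le_mul_of_nonneg_left (sum_increments_le hy h0 J' hY hb) hc
  set a : ℝ := (roundUp (y N) u : ℝ) with ha
  have ha0 : 0 ≤ a := Nat.cast_nonneg _
  rw [← Finset.sum_filter_add_sum_filter_not J (fun k => 1 ≤ y (k + 1))]
  have hbig : ∑ k ∈ J.filter (fun k => 1 ≤ y (k + 1)), x k * freshWeight (y (k + 1)) u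
      ≤ 2 * c * a := by
    -- Once `y ≥ 1`, freshness is certain with weight one, and `y N < 2 * a` because `⌊y N⌋₊ ≥ 1`.
    rcases (J.filter fun k => 1 ≤ y (k + 1)).eq_empty_or_nonempty with he | ⟨k₀, hk₀⟩
    · rw [he]; simpa using mul_nonneg (by linarith) ha0
    · have hk₀' := Finset.mem_filter.1 hk₀
      have hN1 : 1 ≤ y N := hk₀'.2.trans (hyN _ hk₀'.1)
      calc ∑ k ∈ J.filter (fun k => 1 ≤ y (k + 1)), x k * freshWeight (y (k + 1)) u
          = ∑ k ∈ J.filter (fun k => 1 ≤ y (k + 1)), x k := by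
            refine Finset.sum_congr rfl fun k hk => ?_
            have := (Finset.mem_filter.1 hk).2
            simp [freshWeight, Fresh, freshProb, this]
        _ ≤ c * y N := hle _ (Finset.filter_subset _ _) _ hyN0
            fun k hk => hyN k (Finset.mem_filter.1 hk).1
        _ ≤ 2 * c * a := by
            have h1 : y N < 2 * a := by
              have h2 := Nat.lt_floor_add_one (y N)
              have h3 : (⌊y N⌋₊ : ℝ) ≤ a := by
                rw [ha]; exact_mod_cast Nat.floor_mono (by have := u.2.1; linarith)
              have h4 : (1 : ℝ) ≤ ⌊y N⌋₊ := by exact_mod_cast (Nat.one_le_floor_iff _).2 hN1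
              linarith
            nlinarith
  have hsmall : ∑ k ∈ J.filter (fun k => ¬ 1 ≤ y (k + 1)), x k * freshWeight (y (k + 1)) u
      ≤ 4 * c * a := by
    -- Below one, freshness confines `y (k + 1)` to `[v, 2 v)` with `v = 1 - u`. The extents in this
    -- window sum to at most `c * 2 v` and each weight is at most `2 / v`, so no logarithm is lost.
    set J₂ := (J.filter fun k => ¬ 1 ≤ y (k + 1)).filter fun k => Fresh (y (k + 1)) u with hJ₂
    have hsub : J₂ ⊆ J := (Finset.filter_subset _ _).trans (Finset.filter_subset _ _)
    have hmem : ∀ k ∈ J₂,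
        y (k + 1) / 2 < 1 - (u : ℝ) ∧ 1 - (u : ℝ) ≤ y (k + 1) ∧ y (k + 1) < 1 := by
      intro k hk
      have h1 := Finset.mem_filter.1 hk
      have h2 := (Finset.mem_filter.1 h1.1).2
      rcases h1.2 with h | h
      · exact absurd h h2
      · exact ⟨h.1, h.2, not_le.1 h2⟩
    have e : ∑ k ∈ J.filter (fun k => ¬ 1 ≤ y (k + 1)), x k * freshWeight (y (k + 1)) u
        = ∑ k ∈ J₂, x k * freshWeight (y (k + 1)) u := by
      rw [hJ₂, Finset.sum_filter (p := fun k => Fresh (y (k + 1)) u)]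
      refine Finset.sum_congr rfl fun k _ => ?_
      split_ifs with h
      · rfl
      · simp [freshWeight, h]
    rw [e]
    rcases J₂.eq_empty_or_nonempty with he | ⟨k₀, hk₀⟩
    · rw [he]; simpa using mul_nonneg (by linarith) ha0
    · have h1 := hmem k₀ hk₀
      have hv : 0 < 1 - (u : ℝ) := by linarith
      set v : ℝ := 1 - (u : ℝ) with hv'
      have ha1 : 1 ≤ a := by
        have hfr : Fresh (y (k₀ + 1)) u := (Finset.mem_filter.1 hk₀).2
        rw [ha]; exact_mod_cast hfr.one_le_roundUp (hyN k₀ (hsub hk₀))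
      calc ∑ k ∈ J₂, x k * freshWeight (y (k + 1)) u ≤ ∑ k ∈ J₂, x k * (2 / v) := by
            refine Finset.sum_le_sum fun k hk => ?_
            refine mul_le_mul_of_nonneg_left ?_ (hx0 k (hsub hk))
            have h2 := hmem k hk
            rw [freshWeight, if_pos (Finset.mem_filter.1 hk).2, freshProb, if_neg (by linarith),
              inv_div]
            exact div_le_div_of_nonneg_left zero_le_two hv h2.2.1
        _ = (∑ k ∈ J₂, x k) * (2 / v) := by rw [Finset.sum_mul]
        _ ≤ (c * (2 * v)) * (2 / v) := by
            refine mul_le_mul_of_nonneg_right ?_ (by positivity)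
            refine hle J₂ hsub _ (by linarith) fun k hk => ?_
            have := (hmem k hk).1
            linarith
        _ = 4 * c := by field_simp; ring
        _ ≤ 4 * c * a := by nlinarith
  linarith

end Fresh

/-! ### Greedy assignment to fresh facilities and fallbacks -/

section RoundedAlgorithm

variable {ι : Type} [Fintype ι] [DecidableEq ι] {m : ℕ}

/-- A minimizer of `g` on a nonempty finite set. -/
noncomputable def argMin {α : Type*} (s : Finset α) (g : α → ℝ) (h : s.Nonempty) : α :=
  (s.exists_min_image g h).choose

lemma argMin_mem {α : Type*} (s : Finset α) (g : α → ℝ) (h : s.Nonempty) : argMin s g h ∈ s :=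
  (s.exists_min_image g h).choose_spec.1

lemma argMin_le {α : Type*} (s : Finset α) (g : α → ℝ) (h : s.Nonempty) {a : α} (ha : a ∈ s) :
    g (argMin s g h) ≤ g a :=
  (s.exists_min_image g h).choose_spec.2 a ha

/-- What the rounded algorithm does with a job. -/
inductive Outcome (m : ℕ) (ι : Type) where
  | skip : Outcome m ι
  | direct (i : Fin m) : Outcome m ι
  | good (F : ι) : Outcome m ι
  | bad (F : ι) : Outcome m ι

variable (P : FacilityParams ι) (f : (Fin m → ℝ) → ℝ) (w : ι → Fin m → ℝ)

/-- The extent to which a job uses the facility `F`. -/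
noncomputable def share (F : ι) (z : ℝ) : ℝ := min (z / P.B F) 1

open Classical in
/-- The facilities that a served job uses to a substantial extent. -/
noncomputable def heavy (d : Decision m ι) (z : ι → ℝ) : Finset ι :=
  match d with
  -- Discarding small shares bounds the number of jobs that can ever use a given facility.
  | .serve R => R.filter fun F => P.y₀ / 2 ≤ share P F (z F)
  | _ => ∅

open Classical in
/-- The total weight of the fresh facilities among those a job uses substantially. -/
noncomputable def score (H : Finset ι) (z : ι → ℝ) (φ : ι → Prop) : ℝ :=
  ∑ F ∈ H, share P F (z F) * (if φ F then (freshProb (z F))⁻¹ else 0)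

open Classical in
/-- The rounding of one decision, given the greedy loads `Z` and the fresh facilities `φ`. -/
noncomputable def roundDecision (Z : Fin m → ℝ) (d : Decision m ι) (z : ι → ℝ) (φ : ι → Prop) :
    Outcome m ι :=
  match d with
  | .skip => .skip
  | .direct i => .direct i
  | .serve R =>
    if h : ((heavy P (.serve R : Decision m ι) z).filter φ).Nonempty ∧
        1 / 24 ≤ score P (heavy P (.serve R : Decision m ι) z) z φ then
      .good (argMin _ (fun F => f (Z + (1 / P.K F) • w F)) h.1)
    -- The least boost is chosen because the Chernoff bound with rate `B F` needs `B F * share ≤ z`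
    -- for every candidate.
    else if h' : (heavy P (.serve R : Decision m ι) z).Nonempty then .bad (argMin _ P.B h')
    else .skip

/-- The greedy loads after an outcome. -/
noncomputable def addOutcome (Z : Fin m → ℝ) (o : Outcome m ι) : Fin m → ℝ :=
  match o with
  | .good F => Z + (1 / P.K F) • w F
  | _ => Z

/-- The greedy loads over time. -/
noncomputable def greedyRun (q : ℕ → Request m ι) (U : ι → I) : ℕ → Fin m → ℝ
  | 0 => 0
  | j + 1 => addOutcome P w (greedyRun q U j)
      (roundDecision P f w (greedyRun q U j) (fracDecision P f w q j) (fracRun P f w q (j + 1)).z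
        fun F => Fresh ((fracRun P f w q (j + 1)).z F) (U F))

/-- The outcome for job `j`. -/
noncomputable def roundOutcome (q : ℕ → Request m ι) (j : ℕ) (U : ι → I) : Outcome m ι :=
  roundDecision P f w (greedyRun P f w q U j) (fracDecision P f w q j) (fracRun P f w q (j + 1)).z
    fun F => Fresh ((fracRun P f w q (j + 1)).z F) (U F)

/-- The facilities that job `k` uses substantially. -/
noncomputable def heavyAt (q : ℕ → Request m ι) (k : ℕ) : Finset ι :=
  heavy P (fracDecision P f w q k) (fracRun P f w q (k + 1)).z

variable {P f w}

lemma greedyRun_succ (q : ℕ → Request m ι) (U : ι → I) (j : ℕ) :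
    greedyRun P f w q U (j + 1)
      = addOutcome P w (greedyRun P f w q U j) (roundOutcome P f w q j U) := rfl

lemma greedyRun_congr {q q' : ℕ → Request m ι} {j : ℕ} (h : ∀ k < j, q k = q' k) (U : ι → I) :
    greedyRun P f w q U j = greedyRun P f w q' U j := by
  induction j with
  | zero => rfl
  | succ j ih =>
    rw [greedyRun, greedyRun, ih fun k hk => h k (hk.trans (Nat.lt_succ_self j)),
      fracDecision_congr (q := q) (q' := q') fun k hk => h k (Nat.lt_succ_of_le hk),
      fracRun_congr (q := q) (q' := q') h]

lemma roundOutcome_congr {q q' : ℕ → Request m ι} {j : ℕ} (h : ∀ k ≤ j, q k = q' k) :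
    roundOutcome P f w q j = roundOutcome P f w q' j := by
  funext U
  rw [roundOutcome, roundOutcome, greedyRun_congr fun k hk => h k hk.le, fracDecision_congr h,
    fracRun_congr fun k hk => h k (Nat.le_of_lt_succ hk)]

lemma isFinitary_fresh (z : ι → ℝ) : IsFinitary fun (U : ι → I) (F : ι) => Fresh (z F) (U F) :=
  IsFinitary.pi fun F => IsFinitary.of_set (s := (fun U : ι → I => U F) ⁻¹' {u | Fresh (z F) u})
    ((measurable_pi_apply F) (measurableSet_fresh (z F)))

lemma isFinitary_greedyRun (q : ℕ → Request m ι) (j : ℕ) :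
    IsFinitary fun U : ι → I => greedyRun P f w q U j := by
  induction j with
  | zero => exact IsFinitary.const 0
  | succ j ih =>
    exact (ih.prodMk (isFinitary_fresh (fracRun P f w q (j + 1)).z)).comp fun c =>
      addOutcome P w c.1 (roundDecision P f w c.1 (fracDecision P f w q j)
        (fracRun P f w q (j + 1)).z c.2)

lemma isFinitary_roundOutcome (q : ℕ → Request m ι) (j : ℕ) :
    IsFinitary (roundOutcome P f w q j) :=
  ((isFinitary_greedyRun q j).prodMk (isFinitary_fresh (fracRun P f w q (j + 1)).z)).comp fun c =>
    roundDecision P f w c.1 (fracDecision P f w q j) (fracRun P f w q (j + 1)).z c.2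

lemma share_nonneg (hP : P.Valid) {F : ι} {z : ℝ} (hz : 0 ≤ z) : 0 ≤ share P F z :=
  le_min (div_nonneg hz (hP.B_pos F).le) zero_le_one

lemma share_le_level (hP : P.Valid) (F : ι) (z : ℝ) : share P F z ≤ P.level F z :=
  min_le_min_right _ (le_add_of_nonneg_right hP.y₀_pos.le)

lemma level_le_share_add (hP : P.Valid) (F : ι) (z : ℝ) : P.level F z ≤ share P F z + P.y₀ := by
  have := hP.y₀_pos
  rcases le_total (z / P.B F) 1 with h | h
  · rw [share, min_eq_left h]; exact min_le_left _ _
  · rw [share, min_eq_right h]; exact (min_le_right _ _).trans (by linarith)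

variable {q : ℕ → Request m ι}

/-- The standing assumptions on the facilities and the requests. -/
structure Setting (P : FacilityParams ι) (f : (Fin m → ℝ) → ℝ) (w : ι → Fin m → ℝ)
    (q : ℕ → Request m ι) : Prop where
  smooth : IsSmoothCost P.p f
  w_nonneg : ∀ F, 0 ≤ w F
  valid : P.Valid
  u_nonneg : ∀ j i, 0 ≤ (q j).u i
  card_le : ∀ j, ((q j).fac.card : ℝ) * P.y₀ ≤ 1 / 2

namespace Setting

lemma z_nonneg (h : Setting P f w q) (j : ℕ) : 0 ≤ (fracRun P f w q j).z :=
  fracRun_z_nonneg h.smooth h.w_nonneg h.valid h.u_nonneg j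

lemma z_mono (h : Setting P f w q) (F : ι) : Monotone fun j => (fracRun P f w q j).z F :=
  fun _ _ hjk => (fracRun_mono h.smooth h.w_nonneg h.valid h.u_nonneg hjk).2 F

/-- The upper bound is the gain of a raise: the share is paid for by the growth of `z` during this
very job. Summed over the jobs it bounds the use of `F` by its final `z`. -/
lemma heavyAt_spec (h : Setting P f w q) {k : ℕ} {F : ι} (hF : F ∈ heavyAt P f w q k) :
    F ∈ (q k).fac ∧ P.y₀ / 2 ≤ share P F ((fracRun P f w q (k + 1)).z F) ∧
      share P F ((fracRun P f w q (k + 1)).z F) ≤ 2 * P.K F / P.p *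
        ((fracRun P f w q (k + 1)).z F - (fracRun P f w q k).z F) := by
  by_cases ha : (q k).avail.Nonempty
  · have hs := fracRun_step h.smooth h.w_nonneg h.valid h.u_nonneg ha
    rcases hs.decision with ⟨i, _, hd, _⟩ | ⟨R, hR, hd, _, _, hgain⟩
    · rw [heavyAt, hd] at hF; simp [heavy] at hF
    · rw [heavyAt, hd] at hF
      obtain ⟨hFR, hsh⟩ := Finset.mem_filter.1 hF
      refine ⟨hR hFR, hsh, (share_le_level h.valid F _).trans ?_⟩
      have hK := h.valid.K_pos F
      have hp := h.valid.p_pos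
      have := mul_le_mul_of_nonneg_left (hgain F hFR) (by positivity : 0 ≤ 2 * P.K F / P.p)
      refine le_trans (le_of_eq ?_) this
      field_simp
  · rw [heavyAt, (fracRun_inactive ha).2] at hF; simp [heavy] at hF

lemma z_pos_of_heavyAt (h : Setting P f w q) {k : ℕ} {F : ι} (hF : F ∈ heavyAt P f w q k) :
    0 < (fracRun P f w q (k + 1)).z F := by
  have h1 := (h.heavyAt_spec hF).2.1
  have h2 := h.valid.y₀_pos
  have h3 : share P F ((fracRun P f w q (k + 1)).z F)
    ≤ (fracRun P f w q (k + 1)).z F / P.B F := min_le_left _ _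
  by_contra hc
  have := div_nonpos_of_nonpos_of_nonneg (not_lt.1 hc) (h.valid.B_pos F).le
  linarith

/-- A served job uses facilities substantially to a total extent of at least `1 / 4`. -/
lemma heavyAt_sum (h : Setting P f w q) {k : ℕ} {R : Finset ι}
    (hd : fracDecision P f w q k = .serve R) :
    1 / 4 ≤ ∑ F ∈ heavyAt P f w q k, share P F ((fracRun P f w q (k + 1)).z F) := by
  classical
  have ha : (q k).avail.Nonempty := by
    by_contra ha
    rw [(fracRun_inactive ha).2] at hd
    cases hd
  have hs := fracRun_step h.smooth h.w_nonneg h.valid h.u_nonneg ha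
  rcases hs.decision with ⟨i, _, hd', _⟩ | ⟨R', hR, hd', _, hone, _⟩
  · rw [hd] at hd'; cases hd'
  · rw [hd] at hd'
    cases hd'
    set z := (fracRun P f w q (k + 1)).z with hz
    have hy := h.valid.y₀_pos
    -- Of a level sum of at least one, the offsets `y₀` take at most `1 / 2` and the discarded
    -- shares at most `1 / 4`.
    have hcard : (R.card : ℝ) * P.y₀ ≤ 1 / 2 :=
      (mul_le_mul_of_nonneg_right (by exact_mod_cast Finset.card_le_card hR) hy.le).trans
        (h.card_le k)
    have e : heavyAt P f w q k = R.filter fun F => P.y₀ / 2 ≤ share P F (z F) := by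
      rw [heavyAt, hd, heavy]
    have h1 : ∑ F ∈ R, P.level F (z F) ≤ ∑ F ∈ R, share P F (z F) + R.card * P.y₀ := by
      rw [← nsmul_eq_mul, ← Finset.sum_const, ← Finset.sum_add_distrib]
      exact Finset.sum_le_sum fun F _ => level_le_share_add h.valid F _
    have h2 : ∑ F ∈ R.filter (fun F => ¬ P.y₀ / 2 ≤ share P F (z F)), share P F (z F)
        ≤ R.card * (P.y₀ / 2) := by
      calc ∑ F ∈ R.filter (fun F => ¬ P.y₀ / 2 ≤ share P F (z F)), share P F (z F)
          ≤ ∑ F ∈ R.filter (fun F => ¬ P.y₀ / 2 ≤ share P F (z F)), P.y₀ / 2 :=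
            Finset.sum_le_sum fun F hF => (not_le.1 (Finset.mem_filter.1 hF).2).le
        _ = ((R.filter (fun F => ¬ P.y₀ / 2 ≤ share P F (z F))).card : ℝ) * (P.y₀ / 2) := by
            rw [Finset.sum_const, nsmul_eq_mul]
        _ ≤ _ := mul_le_mul_of_nonneg_right
            (by exact_mod_cast Finset.card_le_card (Finset.filter_subset _ _)) (by linarith)
    have h3 := Finset.sum_filter_add_sum_filter_not R
      (fun F => P.y₀ / 2 ≤ share P F (z F)) fun F => share P F (z F)
    rw [e]
    linarith

/-- The possible outcomes of an active job. -/
lemma roundOutcome_cases (h : Setting P f w q) {k : ℕ} (ha : (q k).avail.Nonempty) (U : ι → I) :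
    (∃ i ∈ (q k).avail, roundOutcome P f w q k U = .direct i ∧
        (fracRun P f w q (k + 1)).D = (fracRun P f w q k).D + Pi.single i ((q k).u i)) ∨
      (∃ F ∈ heavyAt P f w q k, roundOutcome P f w q k U = .good F ∧
        Fresh ((fracRun P f w q (k + 1)).z F) (U F)) ∨
      ∃ F ∈ heavyAt P f w q k, roundOutcome P f w q k U = .bad F := by
  classical
  have hs := fracRun_step h.smooth h.w_nonneg h.valid h.u_nonneg ha
  rcases hs.decision with ⟨i, hi, hd, hD⟩ | ⟨R, _, hd, _⟩
  · exact Or.inl ⟨i, hi, by rw [roundOutcome, hd]; rfl, hD⟩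
  · have hsum := h.heavyAt_sum hd
    have e : heavyAt P f w q k
        = heavy P (.serve R : Decision m ι) (fracRun P f w q (k + 1)).z := by rw [heavyAt, hd]
    rw [e] at hsum ⊢
    have hne : (heavy P (.serve R : Decision m ι) (fracRun P f w q (k + 1)).z).Nonempty := by
      rw [Finset.nonempty_iff_ne_empty]
      intro hc
      rw [hc] at hsum
      norm_num at hsum
    rw [roundOutcome, hd, roundDecision]
    split_ifs with h1
    · have := Finset.mem_filter.1 (argMin_mem _
        (fun F => f (greedyRun P f w q U k + (1 / P.K F) • w F)) h1.1)
      exact Or.inr (Or.inl ⟨_, this.1, rfl, this.2⟩)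
    · exact Or.inr (Or.inr ⟨_, argMin_mem _ _ hne, rfl⟩)

lemma addOutcome_ge (h : Setting P f w q) (Z : Fin m → ℝ) (o : Outcome m ι) :
    Z ≤ addOutcome P w Z o := by
  cases o with
  | good F =>
    exact le_add_of_nonneg_right
      (smul_nonneg (one_div_nonneg.2 (h.valid.K_pos F).le) (h.w_nonneg F))
  | _ => exact le_rfl

lemma greedyRun_mono (h : Setting P f w q) (U : ι → I) : Monotone (greedyRun P f w q U) :=
  monotone_nat_of_le_succ fun _ => h.addOutcome_ge _ _

lemma greedyRun_nonneg (h : Setting P f w q) (U : ι → I) (j : ℕ) : 0 ≤ greedyRun P f w q U j :=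
  h.greedyRun_mono U (Nat.zero_le j)

/-- Each greedy step is at most as expensive as the average fresh facility. -/
lemma greedy_step_le (h : Setting P f w q) (U : ι → I) {k N : ℕ} (hk : k < N) :
    f (greedyRun P f w q U (k + 1)) - f (greedyRun P f w q U k)
      ≤ ∑ F ∈ heavyAt P f w q k, 24 * (P.p / P.K F *
        (f (greedyRun P f w q U N + (1 / P.p) • w F) - f (greedyRun P f w q U N))) *
        (share P F ((fracRun P f w q (k + 1)).z F) *
          freshWeight ((fracRun P f w q (k + 1)).z F) (U F)) := by
  classical
  set Z := greedyRun P f w q U with hZ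
  set z := (fracRun P f w q (k + 1)).z with hz
  set H := heavyAt P f w q k with hH
  set v : ι → ℝ := fun F => share P F (z F) * freshWeight (z F) (U F) with hv
  have hv0 : ∀ F ∈ H, 0 ≤ v F := fun F hF => mul_nonneg
    (share_nonneg h.valid (h.z_nonneg _ F)) (freshWeight_nonneg (h.z_pos_of_heavyAt hF) _)
  have hp := h.valid.p_pos
  have hwp : ∀ F, 0 ≤ (1 / P.p) • w F := fun F =>
    smul_nonneg (one_div_nonneg.2 hp.le) (h.w_nonneg F)
  have hμ : ∀ F, 0 ≤ f (Z N + (1 / P.p) • w F) - f (Z N) := fun F =>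
    h.smooth.marginal_nonneg (h.greedyRun_nonneg U N) (hwp F)
  have hpK : ∀ F, 0 ≤ P.p / P.K F := fun F => div_nonneg hp.le (h.valid.K_pos F).le
  have rhs0 : 0 ≤ ∑ F ∈ H, 24 * (P.p / P.K F * (f (Z N + (1 / P.p) • w F) - f (Z N))) * v F :=
    Finset.sum_nonneg fun F hF => mul_nonneg (mul_nonneg (by norm_num)
      (mul_nonneg (hpK F) (hμ F))) (hv0 F hF)
  have hmarg : ∀ F, f (Z k + (1 / P.K F) • w F) - f (Z k)
      ≤ P.p / P.K F * (f (Z N + (1 / P.p) • w F) - f (Z N)) := by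
    intro F
    have e : (1 / P.K F) • w F = (P.p / P.K F) • ((1 / P.p) • w F) := by
      rw [smul_smul]; congr 1; field_simp
    rw [e]
    refine (h.smooth.chord_le (h.greedyRun_nonneg U k) (hwp F) (hpK F)
      (h.valid.div_K_le_one F)).trans ?_
    exact mul_le_mul_of_nonneg_left (h.smooth.marginal_mono (h.greedyRun_nonneg U k)
      (h.greedyRun_mono U hk.le) (hwp F)) (hpK F)
  rw [hZ, greedyRun_succ, ← hZ]
  cases hd : fracDecision P f w q k with
  | skip => rw [roundOutcome, hd]; simpa [roundDecision, addOutcome] using rhs0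
  | direct i => rw [roundOutcome, hd]; simpa [roundDecision, addOutcome] using rhs0
  | serve R =>
    have eH : heavy P (.serve R : Decision m ι) z = H := by rw [hH, heavyAt, hd]
    rw [roundOutcome, hd, roundDecision]
    simp only [← hz, eH]
    split_ifs with h1 h2
    · set F₀ := argMin (H.filter fun F => Fresh (z F) (U F))
        (fun F => f (Z k + (1 / P.K F) • w F)) h1.1 with hF₀
      have hmin : ∀ F ∈ H, Fresh (z F) (U F) →
          f (Z k + (1 / P.K F₀) • w F₀) ≤ f (Z k + (1 / P.K F) • w F) := fun F hF hfr =>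
        argMin_le _ (fun F => f (Z k + (1 / P.K F) • w F)) h1.1 (Finset.mem_filter.2 ⟨hF, hfr⟩)
      set μ := f (Z k + (1 / P.K F₀) • w F₀) - f (Z k) with hμ₀
      have hμ0 : 0 ≤ μ := h.smooth.marginal_nonneg (h.greedyRun_nonneg U k)
        (smul_nonneg (one_div_nonneg.2 (h.valid.K_pos _).le) (h.w_nonneg _))
      have hscore : 1 / 24 ≤ ∑ F ∈ H, v F := h1.2
      change μ ≤ _
      -- The minimum over fresh facilities is compared with their average with weights `v F`, whose
      -- sum is at least `1 / 24`; facilities that are not fresh have weight zero.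
      calc μ ≤ 24 * (∑ F ∈ H, v F) * μ := by nlinarith
        _ = ∑ F ∈ H, 24 * μ * v F := by rw [Finset.mul_sum, Finset.sum_mul]
                                        exact Finset.sum_congr rfl fun F _ => by ring
        _ ≤ _ := by
          refine Finset.sum_le_sum fun F hF => ?_
          by_cases hfr : Fresh (z F) (U F)
          · refine mul_le_mul_of_nonneg_right ?_ (hv0 F hF)
            have := hmin F hF hfr
            have := hmarg F
            linarith
          · have : v F = 0 := by simp [hv, freshWeight, hfr]
            change _ ≤ _ * v F
            rw [this, mul_zero, mul_zero]
    · simpa [addOutcome] using rhs0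
    · simpa [addOutcome] using rhs0

/-- The greedy loads cost at most as much as a multiple of the open copies. -/
theorem greedyRun_cost_le (h : Setting P f w q) (U : ι → I) (N : ℕ) :
    f (greedyRun P f w q U N)
      ≤ 2 * f 0 + f ((1152 : ℝ) • openLoad w 0 (copies (fracRun P f w q N).z U)) := by
  classical
  set Z := greedyRun P f w q U with hZ
  have hp := h.valid.p_pos
  have hwp : ∀ F, 0 ≤ (1 / P.p) • w F := fun F =>
    smul_nonneg (one_div_nonneg.2 hp.le) (h.w_nonneg F)
  set μ : ι → ℝ := fun F => f (Z N + (1 / P.p) • w F) - f (Z N) with hμdef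
  have hμ : ∀ F, 0 ≤ μ F := fun F =>
    h.smooth.marginal_nonneg (h.greedyRun_nonneg U N) (hwp F)
  set a := copies (fracRun P f w q N).z U with ha
  set v : ℕ → ι → ℝ := fun k F => share P F ((fracRun P f w q (k + 1)).z F) *
    freshWeight ((fracRun P f w q (k + 1)).z F) (U F) with hv
  have hsteps : f (Z N) - f 0 ≤ ∑ k ∈ Finset.range N, ∑ F ∈ heavyAt P f w q k,
      24 * (P.p / P.K F * μ F) * v k F := by
    have e : f (Z N) - f 0 = ∑ k ∈ Finset.range N, (f (Z (k + 1)) - f (Z k)) := by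
      rw [Finset.sum_range_sub (fun k => f (Z k))]; rfl
    rw [e]
    exact Finset.sum_le_sum fun k hk => h.greedy_step_le U (Finset.mem_range.1 hk)
  have hswap : ∑ k ∈ Finset.range N, ∑ F ∈ heavyAt P f w q k, 24 * (P.p / P.K F * μ F) * v k F
      = ∑ F, 24 * (P.p / P.K F * μ F) *
        ∑ k ∈ (Finset.range N).filter fun k => F ∈ heavyAt P f w q k, v k F := by
    simp only [Finset.mul_sum]
    refine Finset.sum_comm' fun k F => ?_
    simp
  -- `sum_freshWeight_le` with `c = 2 K / p` cancels `p / K`, and `24 * 6 * 2 = 288`.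
  have hF : ∀ F, 24 * (P.p / P.K F * μ F) *
      ∑ k ∈ (Finset.range N).filter (fun k => F ∈ heavyAt P f w q k), v k F
      ≤ 288 * ((a F : ℝ) * μ F) := by
    intro F
    have hK := h.valid.K_pos F
    have h1 := sum_freshWeight_le (y := fun j => (fracRun P f w q j).z F) (h.z_mono F) rfl (N := N)
      ((Finset.range N).filter fun k => F ∈ heavyAt P f w q k)
      (fun k hk => Finset.mem_range.1 (Finset.mem_filter.1 hk).1)
      (x := fun k => share P F ((fracRun P f w q (k + 1)).z F)) (c := 2 * P.K F / P.p)
      (by positivity)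
      (fun k hk => (h.heavyAt_spec (Finset.mem_filter.1 hk).2).2.2)
      (fun k _ => share_nonneg h.valid (h.z_nonneg _ F)) (U F)
    have h2 : 0 ≤ 24 * (P.p / P.K F * μ F) := by have := hμ F; positivity
    refine (mul_le_mul_of_nonneg_left h1 h2).trans (le_of_eq ?_)
    simp only [ha, copies]
    field_simp
    ring
  have hsum : ∑ F, (a F : ℝ) * μ F ≤ f (Z N + (1 / P.p) • openLoad w 0 a) - f (Z N) := by
    have e : (1 / P.p) • openLoad w 0 a = ∑ F, (a F : ℝ) • ((1 / P.p) • w F) := by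
      rw [openLoad, zero_add, Finset.smul_sum]
      exact Finset.sum_congr rfl fun F _ => smul_comm _ _ _
    rw [e]
    refine le_trans (Finset.sum_le_sum fun F _ => ?_)
      (h.smooth.sum_marginal_le Finset.univ (h.greedyRun_nonneg U N)
        (fun F => (a F : ℝ) • ((1 / P.p) • w F)) fun F _ => smul_nonneg (Nat.cast_nonneg _) (hwp F))
    exact h.smooth.natCast_mul_marginal_le (h.greedyRun_nonneg U N) (hwp F) (a F)
  have hA0 : 0 ≤ openLoad w 0 a := openLoad_nonneg h.w_nonneg le_rfl _
  have hfin : f (Z N) ≤ f 0 + 288 * (f (Z N + (1 / P.p) • openLoad w 0 a) - f (Z N)) := by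
    have h1 : ∑ F, 24 * (P.p / P.K F * μ F) *
        ∑ k ∈ (Finset.range N).filter (fun k => F ∈ heavyAt P f w q k), v k F
        ≤ 288 * ∑ F, (a F : ℝ) * μ F := by
      rw [Finset.mul_sum]
      exact Finset.sum_le_sum fun F _ => hF F
    linarith
  -- The factor `p` of the absorption cancels the `1 / p` in `μ`, so the blow-up is an absolute
  -- constant.
  have := h.smooth.le_of_le_add_marginal (h.greedyRun_nonneg U N)
    (smul_nonneg (one_div_nonneg.2 hp.le) hA0) (by norm_num) hfin
  rw [smul_smul, show 4 * 288 * P.p * (1 / P.p) = 1152 by field_simp; norm_num] at this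
  exact this

open Classical in
/-- The number of jobs among the first `N` that fall back on the facility `F`. -/
noncomputable def badCount (P : FacilityParams ι) (f : (Fin m → ℝ) → ℝ) (w : ι → Fin m → ℝ)
    (q : ℕ → Request m ι) (N : ℕ) (F : ι) (U : ι → I) : ℕ :=
  ((Finset.range N).filter fun k => roundOutcome P f w q k U = .bad F).card

lemma isFinitary_badCount (N : ℕ) (F : ι) : IsFinitary (badCount P f w q N F) := by
  classical
  have h : IsFinitary fun (U : ι → I) (k : Fin N) => roundOutcome P f w q (k : ℕ) U :=
    IsFinitary.pi fun k => isFinitary_roundOutcome q k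
  have e : badCount P f w q N F = fun U => (Finset.univ.filter
      fun k : Fin N => roundOutcome P f w q (k : ℕ) U = .bad F).card := by
    funext U
    rw [badCount, Finset.card_filter, Finset.card_filter, Finset.sum_range]
  rw [e]
  exact h.comp fun o : Fin N → Outcome m ι => (Finset.univ.filter fun k => o k = .bad F).card

/-- The greedy loads do not enter: a fallback requires a deterministic condition on the job and an
event in the independent seeds. -/
lemma roundOutcome_bad {k : ℕ} {U : ι → I} {F : ι}
    (hb : roundOutcome P f w q k U = .bad F) :
    F ∈ heavyAt P f w q k ∧ (∀ G ∈ heavyAt P f w q k, P.B F ≤ P.B G) ∧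
      (∃ R, fracDecision P f w q k = .serve R) ∧
      ∑ G ∈ heavyAt P f w q k, share P G ((fracRun P f w q (k + 1)).z G) *
        freshWeight ((fracRun P f w q (k + 1)).z G) (U G) < 1 / 24 := by
  classical
  set z := (fracRun P f w q (k + 1)).z with hz
  rw [roundOutcome] at hb
  cases hd : fracDecision P f w q k with
  | skip => rw [hd] at hb; simp [roundDecision] at hb
  | direct i => rw [hd] at hb; simp [roundDecision] at hb
  | serve R =>
    have eH : heavyAt P f w q k = heavy P (.serve R : Decision m ι) z := by rw [heavyAt, hd]
    rw [eH]
    set H := heavy P (.serve R : Decision m ι) z with hH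
    rw [hd, roundDecision] at hb
    split_ifs at hb with h1 h2
    · cases hb
      refine ⟨argMin_mem _ _ _, fun G hG => argMin_le _ _ _ hG, ⟨R, rfl⟩, ?_⟩
      by_cases hne : (H.filter fun G => Fresh (z G) (U G)).Nonempty
      · exact not_le.1 fun hc => h1 ⟨hne, hc⟩
      · rw [Finset.not_nonempty_iff_eq_empty, Finset.filter_eq_empty_iff] at hne
        rw [Finset.sum_eq_zero]
        · norm_num
        · intro G hG
          simp [freshWeight, hne hG]

/-- The moments of the numbers of jobs that fall back on a facility. -/
theorem integral_badCount_le (h : Setting P f w q) (N : ℕ) (F : ι) {κ : ℝ} (hκ : 0 < κ)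
    (hB : 24 * P.p * Real.log (4 * P.K F / (P.y₀ * κ)) ≤ P.B F) :
    ∫ U, ((badCount P f w q N F U : ℝ) / κ) ^ P.p ≤ ((fracRun P f w q N).z F) ^ P.p := by
  classical
  set zN := (fracRun P f w q N).z F with hzN
  have hzN0 : 0 ≤ zN := h.z_nonneg N F
  have hp := h.valid.p_pos
  have hp1 := h.valid.one_le_p
  have hK := h.valid.K_pos F
  have hy := h.valid.y₀_pos
  -- `A` is the deterministic set of jobs that could fall back on `F`. Each has share at least `y₀ /
  -- 2`, paid for by growth of `z F`, which gives `hcard`.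
  set A := (Finset.range N).filter fun k => F ∈ heavyAt P f w q k ∧
    (∀ G ∈ heavyAt P f w q k, P.B F ≤ P.B G) ∧ ∃ R, fracDecision P f w q k = .serve R with hA
  set E : ℕ → Set (ι → I) := fun k => {U | ∑ G ∈ heavyAt P f w q k,
    share P G ((fracRun P f w q (k + 1)).z G) *
        freshWeight ((fracRun P f w q (k + 1)).z G) (U G) < 1 / 24} with hE
  have hEm : ∀ k, MeasurableSet (E k) := fun k => measurableSet_lt
    (Finset.measurable_sum _ fun G _ =>
      ((measurable_freshWeight _).comp (measurable_pi_apply G)).const_mul _) measurable_const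
  set δ := Real.exp (-(P.B F / 24)) with hδ
  have hEle : ∀ k ∈ A, (volume : Measure (ι → I)).real (E k) ≤ δ := by
    intro k hk
    obtain ⟨_, hF, hmin, R, hR⟩ := Finset.mem_filter.1 hk
    refine measure_freshWeight_small (h.valid.B_pos F).le (fun G hG => h.z_pos_of_heavyAt hG)
      (fun G _ => share_nonneg h.valid (h.z_nonneg _ G)) (fun G hG _ => ?_) (h.heavyAt_sum hR)
    have hBG := h.valid.B_pos G
    calc P.B F * share P G ((fracRun P f w q (k + 1)).z G)
        ≤ P.B G * ((fracRun P f w q (k + 1)).z G / P.B G) :=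
          mul_le_mul (hmin G hG) (min_le_left _ _) (share_nonneg h.valid (h.z_nonneg _ G)) hBG.le
      _ = _ := by field_simp
  have hcard : (A.card : ℝ) ≤ 4 * P.K F / P.y₀ * zN := by
    have h1 : (A.card : ℝ) * (P.y₀ / 2)
        ≤ ∑ k ∈ A, 2 * P.K F / P.p * ((fracRun P f w q (k + 1)).z F - (fracRun P f w q k).z F) := by
      rw [← nsmul_eq_mul, ← Finset.sum_const]
      refine Finset.sum_le_sum fun k hk => ?_
      have := h.heavyAt_spec (Finset.mem_filter.1 hk).2.1
      exact this.2.1.trans this.2.2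
    rw [← Finset.mul_sum] at h1
    have h2 := sum_increments_le (h.z_mono F) rfl A hzN0 fun k hk =>
      h.z_mono F (Finset.mem_range.1 (Finset.mem_filter.1 hk).1)
    have h3 : 2 * P.K F / P.p ≤ 2 * P.K F := div_le_self (by positivity) hp1
    have h4 : (A.card : ℝ) * (P.y₀ / 2) ≤ 2 * P.K F * zN := by
      refine h1.trans ((mul_le_mul_of_nonneg_left h2 (by positivity)).trans ?_)
      exact mul_le_mul_of_nonneg_right h3 hzN0
    rw [div_mul_eq_mul_div, le_div_iff₀ hy]
    linarith
  have hbad : ∀ U, (badCount P f w q N F U : ℝ) ≤ ∑ k ∈ A, (E k).indicator 1 U := by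
    intro U
    have hsub : (Finset.range N).filter (fun k => roundOutcome P f w q k U = .bad F)
        ⊆ A.filter fun k => U ∈ E k := by
      intro k hk
      obtain ⟨hk1, hk2⟩ := Finset.mem_filter.1 hk
      obtain ⟨b1, b2, b3, b4⟩ := roundOutcome_bad hk2
      exact Finset.mem_filter.2 ⟨Finset.mem_filter.2 ⟨hk1, b1, b2, b3⟩, b4⟩
    calc (badCount P f w q N F U : ℝ) ≤ ((A.filter fun k => U ∈ E k).card : ℝ) := by
          exact_mod_cast Finset.card_le_card hsub
      _ = ∑ k ∈ A, (E k).indicator 1 U := by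
          rw [Finset.card_filter]
          push_cast
          exact Finset.sum_congr rfl fun k _ => by simp [Set.indicator]
  have hbadA : ∀ U, (badCount P f w q N F U : ℝ) ≤ A.card := by
    intro U
    refine (hbad U).trans ?_
    rw [← nsmul_one, ← Finset.sum_const]
    exact Finset.sum_le_sum fun k _ => Set.indicator_le_self' (fun _ _ => zero_le_one) U
  have hint : Integrable fun U => ((badCount P f w q N F U : ℝ) / κ) ^ P.p :=
    ((isFinitary_badCount N F).comp fun b : ℕ => ((b : ℝ) / κ) ^ P.p).integrable
  rcases Nat.eq_zero_or_pos A.card with hA0 | hApos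
  · have : ∀ U, ((badCount P f w q N F U : ℝ) / κ) ^ P.p = 0 := by
      intro U
      have h1 := hbadA U
      rw [hA0, Nat.cast_zero] at h1
      have h2 : (badCount P f w q N F U : ℝ) = 0 := le_antisymm h1 (Nat.cast_nonneg _)
      rw [h2, zero_div, Real.zero_rpow hp.ne']
    simp only [this, integral_zero]
    exact Real.rpow_nonneg hzN0 _
  have hAr : (0 : ℝ) < A.card := by exact_mod_cast hApos
  -- The count is at most `A.card` and `p ≥ 1`, so `(b / A.card) ^ p ≤ b / A.card` and a first
  -- moment suffices.
  have hpt : ∀ U, ((badCount P f w q N F U : ℝ) / κ) ^ P.p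
      ≤ ((A.card : ℝ) / κ) ^ P.p * ((A.card : ℝ)⁻¹ * ∑ k ∈ A, (E k).indicator 1 U) := by
    intro U
    set b := (badCount P f w q N F U : ℝ) with hb
    have hb0 : 0 ≤ b := Nat.cast_nonneg _
    have e : b / κ = (A.card : ℝ) / κ * (b / A.card) := by field_simp
    rw [e, Real.mul_rpow (by positivity) (by positivity)]
    refine mul_le_mul_of_nonneg_left ?_ (Real.rpow_nonneg (by positivity) _)
    have h1 : b / A.card ≤ 1 := (div_le_one hAr).2 (hbadA U)
    calc (b / A.card) ^ P.p ≤ (b / A.card) ^ (1 : ℝ) :=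
          Real.rpow_le_rpow_of_exponent_ge_of_imp (by positivity) h1 hp1 (fun _ => by simp [hp.ne'])
      _ = (A.card : ℝ)⁻¹ * b := by rw [Real.rpow_one]; ring
      _ ≤ _ := mul_le_mul_of_nonneg_left (hbad U) (inv_nonneg.2 hAr.le)
  have hind : ∀ k ∈ A, Integrable ((E k).indicator (1 : (ι → I) → ℝ)) := fun k _ =>
    (integrable_const (1 : ℝ)).indicator (hEm k)
  have hone : ∫ U, ((badCount P f w q N F U : ℝ) / κ) ^ P.p ≤ ((A.card : ℝ) / κ) ^ P.p * δ := by
    refine (integral_mono hint (((integrable_finsetSum _ hind).const_mul _).const_mul _)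
      hpt).trans ?_
    rw [integral_const_mul, integral_const_mul, integral_finsetSum _ hind]
    refine mul_le_mul_of_nonneg_left ?_ (Real.rpow_nonneg (by positivity) _)
    rw [inv_mul_le_iff₀ hAr, ← nsmul_eq_mul, ← Finset.sum_const]
    refine Finset.sum_le_sum fun k hk => ?_
    rw [integral_indicator_one (hEm k)]
    exact hEle k hk
  refine hone.trans ?_
  set r := 4 * P.K F / (P.y₀ * κ) with hr
  have hr0 : 0 < r := by positivity
  -- `hB` makes the failure probability small enough to cancel the factor `r ^ p` of the crude
  -- bound.
  have hδr : δ ≤ r⁻¹ ^ P.p := by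
    rw [hδ, Real.inv_rpow hr0.le, ← Real.rpow_neg hr0.le, Real.rpow_def_of_pos hr0]
    exact Real.exp_le_exp.2 (by linarith)
  calc ((A.card : ℝ) / κ) ^ P.p * δ ≤ (r * zN) ^ P.p * r⁻¹ ^ P.p := by
        refine mul_le_mul (Real.rpow_le_rpow (by positivity) ?_ hp.le) hδr (Real.exp_pos _).le
          (Real.rpow_nonneg (by positivity) _)
        rw [div_le_iff₀ hκ]
        refine hcard.trans (le_of_eq ?_)
        rw [hr]; field_simp
    _ = zN ^ P.p := by
        rw [← Real.mul_rpow (by positivity) (by positivity)]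
        congr 1; field_simp

end Setting

end RoundedAlgorithm

/-! ### Symmetric norms of indicator vectors and capacities -/

section SymmetricNorms

variable {α : Type} [Fintype α] [DecidableEq α]

/-- The indicator vector of a finite set of coordinates. -/
def indic (Q : Finset α) : α → ℝ := fun a => if a ∈ Q then 1 else 0

lemma indic_nonneg (Q : Finset α) : 0 ≤ indic Q := fun a => by
  unfold indic; split_ifs <;> simp

lemma indic_mono {Q Q' : Finset α} (h : Q ⊆ Q') : indic Q ≤ indic Q' := fun a => by
  unfold indic
  by_cases ha : a ∈ Q
  · simp [ha, h ha]
  · rw [if_neg ha]; split_ifs <;> simp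

lemma indic_union_le (Q Q' : Finset α) : indic (Q ∪ Q') ≤ indic Q + indic Q' := fun a => by
  simp only [indic, Finset.mem_union, Pi.add_apply]
  by_cases h1 : a ∈ Q <;> by_cases h2 : a ∈ Q' <;> simp [h1, h2]

/-- The first `k` coordinates, in some order. -/
noncomputable def firstCoords (α : Type) [Fintype α] (k : ℕ) : Finset α :=
  Finset.univ.filter fun a => (Fintype.equivFin α a : ℕ) < k

lemma card_firstCoords {k : ℕ} (hk : k ≤ Fintype.card α) : (firstCoords α k).card = k := by
  have : (firstCoords α k).map (Fintype.equivFin α).toEmbedding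
      = Finset.univ.filter fun i : Fin (Fintype.card α) => (i : ℕ) < k := by
    ext i
    simp only [firstCoords, Finset.mem_map, Finset.mem_filter, Finset.mem_univ, true_and,
      Equiv.coe_toEmbedding]
    exact ⟨by rintro ⟨a, ha, rfl⟩; exact ha,
      fun hi => ⟨(Fintype.equivFin α).symm i, by simpa using hi, by simp⟩⟩
  rw [← Finset.card_map, this, Fin.card_filter_val_lt, min_eq_right hk]

lemma firstCoords_mono {k l : ℕ} (h : k ≤ l) : firstCoords α k ⊆ firstCoords α l := fun a ha => by
  simp only [firstCoords, Finset.mem_filter, Finset.mem_univ, true_and] at ha ⊢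
  omega

lemma firstCoords_of_card_le {k : ℕ} (h : Fintype.card α ≤ k) :
    firstCoords α k = Finset.univ := by
  ext a
  simp only [firstCoords, Finset.mem_filter, Finset.mem_univ, true_and, iff_true]
  exact (Fintype.equivFin α a).2.trans_le h

/-- The norm of the indicator vector of `k` coordinates. -/
noncomputable def sizeNorm (N : Seminorm ℝ (α → ℝ)) (k : ℕ) : ℝ := N (indic (firstCoords α k))

namespace IsMonotoneSymmetricNorm

variable {N : Seminorm ℝ (α → ℝ)}

/-- A bijection between finite sets of equal size extends to a permutation, so the norm sees only
the cardinality. -/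
lemma indic_eq_of_card_eq (hN : IsMonotoneSymmetricNorm N) {Q Q' : Finset α}
    (h : Q.card = Q'.card) : N (indic Q) = N (indic Q') := by
  have e : {a // a ∈ Q} ≃ {a // a ∈ Q'} := Fintype.equivOfCardEq (by simpa using h)
  let e' : Equiv.Perm α := e.extendSubtype
  rw [← hN.symmetric e' (indic Q')]
  congr 1
  funext a
  simp only [indic, Function.comp_apply]
  by_cases ha : a ∈ Q
  · rw [if_pos ha, if_pos (e.extendSubtype_mem a ha)]
  · rw [if_neg ha, if_neg (e.extendSubtype_not_mem a ha)]

lemma indic_eq (hN : IsMonotoneSymmetricNorm N) (Q : Finset α) :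
    N (indic Q) = sizeNorm N Q.card :=
  hN.indic_eq_of_card_eq (card_firstCoords (Finset.card_le_univ Q)).symm

lemma sizeNorm_mono (hN : IsMonotoneSymmetricNorm N) : Monotone (sizeNorm N) := fun _ _ h =>
  hN.monotone _ _ (indic_nonneg _) (indic_mono (firstCoords_mono h))

lemma sizeNorm_nonneg (_ : IsMonotoneSymmetricNorm N) (k : ℕ) : 0 ≤ sizeNorm N k :=
  apply_nonneg N _

lemma sizeNorm_zero (N : Seminorm ℝ (α → ℝ)) : sizeNorm N 0 = 0 := by
  have : indic (firstCoords α 0) = (0 : α → ℝ) := by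
    funext a; simp [indic, firstCoords]
  rw [sizeNorm, this, map_zero]

lemma sizeNorm_one_pos (hN : IsMonotoneSymmetricNorm N) (a : α) : 0 < sizeNorm N 1 := by
  rw [← Finset.card_singleton a, ← hN.indic_eq]
  refine lt_of_le_of_ne (apply_nonneg N _) fun h => ?_
  have := congrFun (hN.definite _ h.symm) a
  simp [indic] at this

lemma sizeNorm_add_le (hN : IsMonotoneSymmetricNorm N) (k l : ℕ) :
    sizeNorm N (k + l) ≤ sizeNorm N k + sizeNorm N l := by
  rcases le_total (k + l) (Fintype.card α) with h | h
  · have hcard : (firstCoords α (k + l) \ firstCoords α k).card = l := by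
      rw [Finset.card_sdiff_of_subset (firstCoords_mono (Nat.le_add_right _ _)),
        card_firstCoords h, card_firstCoords (le_trans (Nat.le_add_right _ _) h)]
      omega
    calc sizeNorm N (k + l)
        ≤ N (indic (firstCoords α k) + indic (firstCoords α (k + l) \ firstCoords α k)) := by
          refine hN.monotone _ _ (indic_nonneg _) ?_
          refine le_trans (indic_mono ?_) (indic_union_le _ _)
          rw [Finset.union_sdiff_of_subset (firstCoords_mono (Nat.le_add_right _ _))]
      _ ≤ _ := map_add_le_add N _ _
      _ = _ := by rw [hN.indic_eq (_ \ _), hcard]; rfl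
  · rcases le_total k (Fintype.card α) with hk | hk
    · have hcard : (Finset.univ \ firstCoords α k).card = Fintype.card α - k := by
        rw [Finset.card_sdiff_of_subset (Finset.subset_univ _), card_firstCoords hk,
          Finset.card_univ]
      calc sizeNorm N (k + l)
          ≤ N (indic (firstCoords α k) + indic (Finset.univ \ firstCoords α k)) := by
            refine hN.monotone _ _ (indic_nonneg _) ?_
            refine le_trans (indic_mono ?_) (indic_union_le _ _)
            rw [Finset.union_sdiff_of_subset (Finset.subset_univ _)]
            exact Finset.subset_univ _
        _ ≤ _ := map_add_le_add N _ _
        _ = sizeNorm N k + sizeNorm N (Fintype.card α - k) := by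
          rw [hN.indic_eq (_ \ _), hcard]; rfl
        _ ≤ _ := add_le_add_right (hN.sizeNorm_mono (by omega)) _
    · have : sizeNorm N (k + l) = sizeNorm N k := by
        rw [sizeNorm, sizeNorm, firstCoords_of_card_le h, firstCoords_of_card_le hk]
      rw [this]
      exact le_add_of_nonneg_right (hN.sizeNorm_nonneg l)

lemma sizeNorm_le_mul (hN : IsMonotoneSymmetricNorm N) (k : ℕ) :
    sizeNorm N k ≤ k * sizeNorm N 1 := by
  induction k with
  | zero => simp [sizeNorm_zero]
  | succ k ih =>
    have := hN.sizeNorm_add_le k 1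
    push_cast
    linarith

/-- Cut the `l` coordinates into blocks of size `k` and use the triangle inequality. Exceeding a
capacity thus costs no more than proportionally many copies. -/
lemma sizeNorm_le_ratio (hN : IsMonotoneSymmetricNorm N) {k : ℕ} (hk : 1 ≤ k) (l : ℕ) :
    sizeNorm N l ≤ (1 + (l : ℝ) / k) * sizeNorm N k := by
  have hk0 : (0 : ℝ) < k := by exact_mod_cast hk
  induction l using Nat.strong_induction_on with
  | _ l ih =>
    rcases le_total l k with h | h
    · have h1 := hN.sizeNorm_mono h
      have h2 := hN.sizeNorm_nonneg k
      have h3 : (0 : ℝ) ≤ (l : ℝ) / k := by positivity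
      nlinarith
    · have h1 := ih (l - k) (by omega)
      have h2 := hN.sizeNorm_add_le k (l - k)
      rw [Nat.add_sub_cancel' h] at h2
      have e : ((l - k : ℕ) : ℝ) / k = (l : ℝ) / k - 1 := by
        rw [Nat.cast_sub h]; field_simp
      rw [e] at h1
      linarith

/-- The norm of a vector with entries at most `c`, all of them supported on `Q`. -/
lemma le_mul_sizeNorm (hN : IsMonotoneSymmetricNorm N) {v : α → ℝ} {Q : Finset α} {c : ℝ}
    (hv : 0 ≤ v) (hc : 0 ≤ c) (hle : ∀ a ∈ Q, v a ≤ c) (hsupp : ∀ a ∉ Q, v a = 0) :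
    N v ≤ c * sizeNorm N Q.card := by
  have h1 : v ≤ c • indic Q := fun a => by
    by_cases ha : a ∈ Q
    · simpa [indic, ha] using hle a ha
    · simp [indic, ha, hsupp a ha]
  refine (hN.monotone _ _ hv h1).trans (le_of_eq ?_)
  rw [map_smul_eq_mul, Real.norm_of_nonneg hc, hN.indic_eq]

/-- The norm of a vector with entries at least `c` on `Q`. -/
lemma mul_sizeNorm_le (hN : IsMonotoneSymmetricNorm N) {v : α → ℝ} {Q : Finset α} {c : ℝ}
    (hv : 0 ≤ v) (hc : 0 ≤ c) (hle : ∀ a ∈ Q, c ≤ v a) : c * sizeNorm N Q.card ≤ N v := by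
  have h1 : c • indic Q ≤ v := fun a => by
    by_cases ha : a ∈ Q
    · simpa [indic, ha] using hle a ha
    · simpa [indic, ha] using hv a
  refine le_trans (le_of_eq ?_) (hN.monotone _ _ (smul_nonneg hc (indic_nonneg _)) h1)
  rw [map_smul_eq_mul, Real.norm_of_nonneg hc, hN.indic_eq]

lemma single_eq (hN : IsMonotoneSymmetricNorm N) (a : α) {c : ℝ} (hc : 0 ≤ c) :
    N (Pi.single a c) = c * sizeNorm N 1 := by
  have : (Pi.single a c : α → ℝ) = c • indic {a} := by
    funext b
    by_cases h : b = a
    · subst h; simp [indic]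
    · simp [indic, h]
  rw [this, map_smul_eq_mul, Real.norm_of_nonneg hc, hN.indic_eq, Finset.card_singleton]

end IsMonotoneSymmetricNorm

/-- The largest number `k ≤ n` of unit loads whose norm is at most `2 ^ t` times that of one. -/
noncomputable def sizeCap (N : Seminorm ℝ (α → ℝ)) (n t : ℕ) : ℕ :=
  Nat.findGreatest (fun k => sizeNorm N k ≤ 2 ^ t * sizeNorm N 1) n

section SizeCap

variable {N : Seminorm ℝ (α → ℝ)} {n : ℕ}

lemma sizeCap_le (t : ℕ) : sizeCap N n t ≤ n := Nat.findGreatest_le n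

lemma sizeCap_spec (hN : IsMonotoneSymmetricNorm N) (t : ℕ) :
    sizeNorm N (sizeCap N n t) ≤ 2 ^ t * sizeNorm N 1 := by
  refine Nat.findGreatest_spec (P := fun k => sizeNorm N k ≤ 2 ^ t * sizeNorm N 1)
    (Nat.zero_le n) ?_
  rw [IsMonotoneSymmetricNorm.sizeNorm_zero]
  exact mul_nonneg (by positivity) (hN.sizeNorm_nonneg 1)

lemma le_sizeCap {t k : ℕ} (hk : k ≤ n) (h : sizeNorm N k ≤ 2 ^ t * sizeNorm N 1) :
    k ≤ sizeCap N n t := Nat.le_findGreatest hk h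

lemma one_le_sizeCap (hN : IsMonotoneSymmetricNorm N) (hn : 1 ≤ n) (t : ℕ) :
    1 ≤ sizeCap N n t :=
  le_sizeCap hn (le_mul_of_one_le_left (hN.sizeNorm_nonneg 1) (one_le_pow₀ one_le_two))

lemma sizeCap_mono (hN : IsMonotoneSymmetricNorm N) : Monotone (sizeCap N n) := fun s _ h =>
  le_sizeCap (sizeCap_le s) ((sizeCap_spec hN s).trans
    (mul_le_mul_of_nonneg_right (pow_le_pow_right₀ one_le_two h) (hN.sizeNorm_nonneg 1)))

/-- After `log n` doublings the triangle inequality removes the restriction, so `O(log n)` size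
classes suffice. -/
lemma sizeCap_eq (hN : IsMonotoneSymmetricNorm N) {t : ℕ} (h : n ≤ 2 ^ t) :
    sizeCap N n t = n :=
  le_antisymm (sizeCap_le t) (le_sizeCap le_rfl ((hN.sizeNorm_le_mul n).trans
    (mul_le_mul_of_nonneg_right (by exact_mod_cast h) (hN.sizeNorm_nonneg 1))))

end SizeCap

end SymmetricNorms

/-! ### Free machines and load thresholds -/

section Machines

variable {m : ℕ} {p : ℝ} {f : (Fin m → ℝ) → ℝ}

/-- The load of machine `i` never matters. -/
def IsFree (f : (Fin m → ℝ) → ℝ) (i : Fin m) : Prop := ∀ t : ℝ, 0 ≤ t → f (Pi.single i t) = f 0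

lemma single_eq_smul (i : Fin m) (t : ℝ) :
    (Pi.single i t : Fin m → ℝ) = t • (Pi.single i 1 : Fin m → ℝ) := by
  rw [← Pi.single_smul', smul_eq_mul, mul_one]

namespace IsSmoothCost

lemma add_single_free (hf : IsSmoothCost p f) {i : Fin m} (hi : IsFree f i) {y : Fin m → ℝ}
    (hy : 0 ≤ y) {t : ℝ} (ht : 0 ≤ t) : f (y + Pi.single i t) = f y := by
  rw [single_eq_smul]
  refine hf.add_free (Pi.single_nonneg.2 zero_le_one) (fun s hs => ?_) hy ht
  rw [← single_eq_smul]
  exact hi s hs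

/-- The loads of free machines do not matter. -/
lemma le_of_le_on_nonfree (hf : IsSmoothCost p f) {x y : Fin m → ℝ} (hx : 0 ≤ x) (hy : 0 ≤ y)
    (h : ∀ i, ¬ IsFree f i → x i ≤ y i) : f x ≤ f y := by
  classical
  have key : ∀ s : Finset (Fin m), (∀ i ∈ s, IsFree f i) →
      f (y + ∑ i ∈ s, Pi.single i (x i)) = f y := by
    intro s
    induction s using Finset.induction_on with
    | empty => simp
    | insert i s his ih =>
      intro hs
      rw [Finset.sum_insert his, add_comm (Pi.single i (x i) : Fin m → ℝ), ← add_assoc,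
        hf.add_single_free (hs i (Finset.mem_insert_self _ _)) _ (hx i)]
      · exact ih fun j hj => hs j (Finset.mem_insert_of_mem hj)
      · exact add_nonneg hy (Finset.sum_nonneg fun j _ => Pi.single_nonneg.2 (hx j))
  rw [← key (Finset.univ.filter fun i => IsFree f i) fun i hi => (Finset.mem_filter.1 hi).2]
  refine hf.mono _ _ hx fun i => ?_
  rw [Pi.add_apply, Finset.sum_apply]
  by_cases hi : IsFree f i
  · have : x i ≤ ∑ j ∈ Finset.univ.filter (fun i => IsFree f i),
        (Pi.single j (x j) : Fin m → ℝ) i := by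
      refine le_trans (le_of_eq ?_) (Finset.single_le_sum
        (f := fun j => (Pi.single j (x j) : Fin m → ℝ) i) (fun j _ => ?_)
        (Finset.mem_filter.2 ⟨Finset.mem_univ i, hi⟩))
      · simp
      · exact (Pi.single_nonneg.2 (hx j) : (0 : Fin m → ℝ) ≤ _) i
    have := hy i
    simp only [Pi.zero_apply] at this
    linarith
  · refine (h i hi).trans (le_add_of_nonneg_right (Finset.sum_nonneg fun j _ => ?_))
    exact (Pi.single_nonneg.2 (hx j) : (0 : Fin m → ℝ) ≤ _) i

/-- The cost is unbounded in the load of a machine that is not free. -/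
lemma exists_single_eq (hf : IsSmoothCost p f) {i : Fin m} (hi : ¬ IsFree f i) {c : ℝ}
    (hc : f 0 < c) : ∃ t : ℝ, 0 < t ∧ f (Pi.single i t) = c := by
  unfold IsFree at hi
  push Not at hi
  obtain ⟨s, hs, hne⟩ := hi
  have h1 : ∀ t : ℝ, 0 ≤ t → (0 : Fin m → ℝ) ≤ Pi.single i t := fun t ht => Pi.single_nonneg.2 ht
  have hlt : f 0 < f (Pi.single i s) :=
    lt_of_le_of_ne (hf.mono _ _ le_rfl (h1 s hs)) (Ne.symm hne)
  set d := f (Pi.single i s) - f 0 with hd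
  have hd0 : 0 < d := sub_pos.2 hlt
  obtain ⟨k, hk⟩ := exists_nat_gt ((c - f 0) / d)
  rw [div_lt_iff₀ hd0] at hk
  -- Superadditive marginals make the cost grow at least linearly along the multiples of `s`; the
  -- intermediate value theorem then attains `c`.
  have h2 := hf.natCast_mul_marginal_le le_rfl (h1 s hs) k
  rw [zero_add, zero_add] at h2
  have e : (k : ℝ) • (Pi.single i s : Fin m → ℝ) = Pi.single i (k * s) := by
    rw [← Pi.single_smul', smul_eq_mul]
  rw [e] at h2
  have h3 : c ≤ f (Pi.single i (k * s)) := by linarith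
  have hsingle : Continuous fun t : ℝ => (Pi.single i t : Fin m → ℝ) := by
    rw [show (fun t : ℝ => (Pi.single i t : Fin m → ℝ)) = fun t => t • Pi.single i 1 from
      funext (single_eq_smul i)]
    fun_prop
  have hcont : ContinuousOn (fun t : ℝ => f (Pi.single i t)) (Set.Icc 0 (k * s)) :=
    hf.cont.comp hsingle.continuousOn fun t ht => h1 t ht.1
  have hmem : c ∈ Set.Icc (f (Pi.single i (0 : ℝ))) (f (Pi.single i ((k : ℝ) * s))) := by
    rw [Pi.single_zero]; exact ⟨hc.le, h3⟩
  obtain ⟨t, ht, hft⟩ := intermediate_value_Icc (by positivity) hcont hmem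
  refine ⟨t, lt_of_le_of_ne ht.1 ?_, hft⟩
  rintro rfl
  simp only [Pi.single_zero] at hft
  linarith

end IsSmoothCost

open Classical in
/-- The load of machine `i` that costs `2 * O`. -/
noncomputable def threshold (f : (Fin m → ℝ) → ℝ) (O : ℝ) (i : Fin m) : ℝ :=
  -- A free machine may have no such load; one is merely a positive default.
  if h : ∃ t : ℝ, 0 < t ∧ f (Pi.single i t) = 2 * O then h.choose else 1

lemma threshold_pos (f : (Fin m → ℝ) → ℝ) (O : ℝ) (i : Fin m) : 0 < threshold f O i := by
  unfold threshold
  split_ifs with h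
  · exact h.choose_spec.1
  · exact one_pos

section Threshold

variable {O : ℝ}

lemma cost_threshold_of_not_free (hf : IsSmoothCost p f) (hO : 0 < O) (h0 : f 0 ≤ O)
    {i : Fin m} (hi : ¬ IsFree f i) :
    f (Pi.single i (threshold f O i)) = 2 * O := by
  have h := hf.exists_single_eq hi (c := 2 * O) (by linarith)
  rw [threshold, dif_pos h]
  exact h.choose_spec.2

lemma cost_threshold_le (hf : IsSmoothCost p f) (hO : 0 < O) (h0 : f 0 ≤ O)
    (i : Fin m) : f (Pi.single i (threshold f O i)) ≤ 2 * O := by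
  by_cases hi : IsFree f i
  · rw [hi _ (threshold_pos f O i).le]; linarith
  · exact (cost_threshold_of_not_free hf hO h0 hi).le

/-- A load above the threshold would by itself cost at least `2 * O > O`. -/
lemma le_threshold (hf : IsSmoothCost p f) (hO : 0 < O) (h0 : f 0 ≤ O) {i : Fin m}
    (hi : ¬ IsFree f i) {y : Fin m → ℝ} (hy : 0 ≤ y) (h : f y ≤ O) :
    y i ≤ threshold f O i := by
  by_contra hc
  have h1 : (Pi.single i (threshold f O i) : Fin m → ℝ) ≤ y := fun j => by
    by_cases hj : j = i
    · subst hj; simpa using (not_le.1 hc).le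
    · simpa [hj] using hy j
  have h2 := hf.mono _ _ (Pi.single_nonneg.2 (threshold_pos f O i).le) h1
  rw [cost_threshold_of_not_free hf hO h0 hi] at h2
  linarith

/-- Load a fraction `1 / m` of the threshold on every machine. -/
lemma cost_average_threshold_le (hf : IsSmoothCost p f) (hO : 0 < O) (h0 : f 0 ≤ O)
    (hm : 1 ≤ m) :
    f (fun i => threshold f O i / m) ≤ 2 * O := by
  have : Nonempty (Fin m) := ⟨⟨0, hm⟩⟩
  have hs := hf.sum_le_average (Finset.univ : Finset (Fin m)) Finset.univ_nonempty
    (fun i => Pi.single i (threshold f O i)) fun i _ => Pi.single_nonneg.2 (threshold_pos f O i).le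
  rw [Finset.card_univ, Fintype.card_fin] at hs
  have e : ∑ i, (1 / (m : ℝ)) • (Pi.single i (threshold f O i) : Fin m → ℝ)
      = fun i => threshold f O i / m := by
    rw [← Finset.smul_sum, Finset.univ_sum_single]
    funext i
    simp [div_eq_inv_mul]
  rw [e] at hs
  refine hs.trans ((Finset.sum_le_sum fun i _ => mul_le_mul_of_nonneg_left
    (cost_threshold_le hf hO h0 i) (by positivity)).trans (le_of_eq ?_))
  have : (m : ℝ) ≠ 0 := by positivity
  simp
  field_simp

end Threshold

end Machines

/-! ### Best ways and trivial options of a job -/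

section Options

variable {n m r : ℕ} [NeZero m] [NeZero r]

/-- The best way of processing a job on machine `i`. -/
noncomputable def bestWay (J : Job m r) (i : Fin m) : Fin r := (Finite.exists_min (J i)).choose

lemma bestWay_le (J : Job m r) (i : Fin m) (k : Fin r) : J i (bestWay J i) ≤ J i k :=
  (Finite.exists_min (J i)).choose_spec k

/-- The machine that processes a job best. -/
noncomputable def bestMachine (J : Job m r) : Fin m :=
  (Finite.exists_min fun i => J i (bestWay J i)).choose

lemma bestMachine_le (J : Job m r) (i : Fin m) (k : Fin r) :
    J (bestMachine J) (bestWay J (bestMachine J)) ≤ J i k :=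
  ((Finite.exists_min fun i => J i (bestWay J i)).choose_spec i).trans (bestWay_le J i k)

/-- Machine `i` can process the job without any effect on the cost. -/
def IsTrivialOption (f : (Fin m → ℝ) → ℝ) (J : Job m r) (i : Fin m) : Prop :=
  J i (bestWay J i) ≠ ⊤ ∧ (IsFree f i ∨ J i (bestWay J i) = 0)

open Classical in
/-- The machine that processes a job when `i` is suggested. -/
noncomputable def assignedMachine (f : (Fin m → ℝ) → ℝ) (J : Job m r) (i : Fin m) : Fin m :=
  if h : ∃ i, IsTrivialOption f J i then h.choose
  -- The last alternative only secures feasibility: for active jobs the suggested machine is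
  -- available.
  else if J i (bestWay J i) ≠ ⊤ then i else bestMachine J

lemma assignedMachine_of_trivial {f : (Fin m → ℝ) → ℝ} {J : Job m r}
    (h : ∃ i, IsTrivialOption f J i) (i : Fin m) :
    IsTrivialOption f J (assignedMachine f J i) := by
  rw [assignedMachine, dif_pos h]
  exact h.choose_spec

lemma assignedMachine_eq {f : (Fin m → ℝ) → ℝ} {J : Job m r}
    (h : ¬ ∃ i, IsTrivialOption f J i) {i : Fin m} (hi : J i (bestWay J i) ≠ ⊤) :
    assignedMachine f J i = i := by
  rw [assignedMachine, dif_neg h, if_pos hi]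

lemma assignedMachine_ne_top (f : (Fin m → ℝ) → ℝ) {J : Job m r} {i₀ : Fin m} {k₀ : Fin r}
    (hJ : J i₀ k₀ ≠ ⊤) (i : Fin m) :
    J (assignedMachine f J i) (bestWay J (assignedMachine f J i)) ≠ ⊤ := by
  unfold assignedMachine
  split_ifs with h1 h2
  · exact h1.choose_spec.1
  · exact h2
  · exact ne_top_of_le_ne_top hJ (bestMachine_le J i₀ k₀)

variable (N : Fin m → Seminorm ℝ (Fin n × Fin r → ℝ))

/-- The load of machine `i` if it processes only the job `J`, in the best way. -/
noncomputable def soloLoad (J : Job m r) (i : Fin m) : ℝ :=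
  (J i (bestWay J i)).toReal * sizeNorm (N i) 1

lemma soloLoad_nonneg (J : Job m r) (i : Fin m) : 0 ≤ soloLoad N J i :=
  mul_nonneg ENNReal.toReal_nonneg (apply_nonneg _ _)

end Options

/-! ### The algorithm for a known bound of the optimum -/

section Core

/-- The number of doublings that reach `m`. -/
def scaleBound (m : ℕ) : ℕ := Nat.clog 2 m

/-- The number of pairs of a machine and a scale. -/
def scaleCount (m : ℕ) : ℕ := m * (scaleBound m + 1)

/-- The number of halvings by which the fallback capacities are reduced. -/
def gapBound (n m : ℕ) : ℕ := Nat.clog 2 (2 * (scaleCount m * (Nat.clog 2 n + 1)))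

/-- A facility: a machine, a scale and a size class. -/
abbrev Facility (n m : ℕ) : Type := Fin m × Fin (scaleBound m + 1) × Fin (Nat.clog 2 n + 1)

variable {n m r : ℕ} (p : ℝ) (f : (Fin m → ℝ) → ℝ) (N : Fin m → Seminorm ℝ (Fin n × Fin r → ℝ))

/-- The number of jobs that a copy of a facility can process. -/
noncomputable def facCap (F : Facility n m) : ℕ := sizeCap (N F.1) n (F.2.2 + 1)

/-- The number of jobs that may use a facility without a copy. -/
noncomputable def fallbackCap (F : Facility n m) : ℝ :=
  if gapBound n m ≤ F.2.2 then (sizeCap (N F.1) n (F.2.2 - gapBound n m) : ℝ)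
  -- No size class lies that far below. With this value `(1 / 2) ^ gapBound * (b / κ) = b`, and each
  -- job weighs at most one full load.
  else (1 / 2) ^ gapBound n m

/-- The parameters of the facilities. -/
noncomputable def facParams : FacilityParams (Facility n m) where
  p := p
  -- Requests contain only facilities with `p ≤ facCap`, where this is `facCap`; the maximum keeps
  -- all parameters valid.
  K F := max (facCap N F) p
  -- Meets the hypothesis `hB` of `Setting.integral_badCount_le` with equality.
  B F := 24 * p * Real.log (4 * max (facCap N F : ℝ) p
    / (1 / (2 * scaleCount m) * fallbackCap N F))
  -- A job sees at most `scaleCount m` facilities, so its initial levels sum to at most `1 / 2`.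
  y₀ := 1 / (2 * scaleCount m)

/-- The load of a facility on its machine. -/
noncomputable def facSize (O : ℝ) (F : Facility n m) : ℝ := threshold f O F.1 / 2 ^ (F.2.1 : ℕ)

/-- The load vector of a facility. -/
noncomputable def facLoad (O : ℝ) (F : Facility n m) : Fin m → ℝ := Pi.single F.1 (facSize f O F)

variable [NeZero m] [NeZero r]

/-- The size class of a job relative to a load `T`. -/
noncomputable def sizeClass (n : ℕ) (u T : ℝ) : ℕ :=
  Nat.findGreatest (fun s => u * 2 ^ s ≤ T) (Nat.clog 2 n)

open Classical in
/-- The machines that can process a job nontrivially; none if there is a trivial option. -/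
noncomputable def activeMachines (J : Job m r) : Finset (Fin m) :=
  if ∃ i, IsTrivialOption f J i then ∅ else Finset.univ.filter fun i => J i (bestWay J i) ≠ ⊤

open Classical in
/-- The request that a job poses. -/
noncomputable def jobRequest (O : ℝ) (J : Job m r) : Request m (Facility n m) where
  fac := Finset.univ.filter fun F => F.1 ∈ activeMachines f J ∧
    soloLoad N J F.1 ≤ facSize f O F ∧
    (F.2.2 : ℕ) = sizeClass n (soloLoad N J F.1) (facSize f O F) ∧ p ≤ facCap N F
  avail := activeMachines f J
  u := soloLoad N J

/-- The requests that a sequence of jobs poses. -/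
noncomputable def jobRequests (O : ℝ) (jobs : Fin n → Job m r) (j : ℕ) :
    Request m (Facility n m) :=
  if h : j < n then jobRequest p f N O (jobs ⟨j, h⟩) else ⟨∅, ∅, 0⟩

/-- The outcome of the rounded algorithm for job `j`. -/
noncomputable def coreOutcome (O : ℝ) (jobs : Fin n → Job m r) (j : ℕ) :
    (Facility n m → I) → Outcome m (Facility n m) :=
  roundOutcome (facParams p N) f (facLoad f O) (jobRequests p f N O jobs) j

/-- The machine that an outcome suggests. -/
def Outcome.machine : Outcome m (Facility n m) → Fin m
  | .skip => 0
  | .direct i => i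
  | .good F => F.1
  | .bad F => F.1

/-- The online algorithm that knows an upper bound `O` of the optimal cost. -/
noncomputable def coreAlloc (O : ℝ) (jobs : Fin n → Job m r) (U : Facility n m → I) :
    Allocation n m r := fun j =>
  let i := assignedMachine f (jobs j) (coreOutcome p f N O jobs j U).machine
  (i, bestWay (jobs j) i)

variable {p f N} {O : ℝ} {jobs : Fin n → Job m r}

lemma jobRequests_coe (j : Fin n) :
    jobRequests p f N O jobs j = jobRequest p f N O (jobs j) := by
  rw [jobRequests, dif_pos j.2]

lemma isFinitary_coreAlloc : IsFinitary (coreAlloc p f N O jobs) :=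
  IsFinitary.pi fun j : Fin n => (isFinitary_roundOutcome (P := facParams p N) (f := f)
    (w := facLoad f O) (jobRequests p f N O jobs) j).comp fun o =>
      (assignedMachine f (jobs j) o.machine,
        bestWay (jobs j) (assignedMachine f (jobs j) o.machine))

lemma coreAlloc_congr {jobs' : Fin n → Job m r} {j : Fin n} (h : ∀ k ≤ j, jobs k = jobs' k)
    (U : Facility n m → I) : coreAlloc p f N O jobs U j = coreAlloc p f N O jobs' U j := by
  have e : coreOutcome p f N O jobs j = coreOutcome p f N O jobs' j := by
    refine roundOutcome_congr fun k hk => ?_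
    have hkn : k < n := hk.trans_lt j.2
    rw [jobRequests, jobRequests, dif_pos hkn, dif_pos hkn, h ⟨k, hkn⟩ hk]
  simp only [coreAlloc, h j le_rfl, e]

lemma feasible_coreAlloc (h : ∃ x, Feasible jobs x) (U : Facility n m → I) :
    Feasible jobs (coreAlloc p f N O jobs U) := fun j =>
  assignedMachine_ne_top f (h.choose_spec j) _

lemma scaleCount_pos : 0 < scaleCount m := Nat.mul_pos (NeZero.pos m) (Nat.succ_pos _)

lemma card_facility_le : scaleCount m * (Nat.clog 2 n + 1) * 2 ≤ 2 ^ gapBound n m := by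
  rw [mul_comm]
  exact Nat.le_pow_clog one_lt_two _

lemma fallbackCap_pos (hN : ∀ i, IsMonotoneSymmetricNorm (N i)) (hn : 1 ≤ n) (F : Facility n m) :
    0 < fallbackCap N F := by
  unfold fallbackCap
  split_ifs
  · exact_mod_cast one_le_sizeCap (hN _) hn _
  · positivity

lemma fallbackCap_le (hN : ∀ i, IsMonotoneSymmetricNorm (N i)) (hn : 1 ≤ n) (F : Facility n m) :
    fallbackCap N F ≤ facCap N F := by
  unfold fallbackCap
  split_ifs
  · exact_mod_cast sizeCap_mono (hN _) (by omega)
  · refine (pow_le_one₀ (by norm_num) (by norm_num)).trans ?_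
    exact_mod_cast one_le_sizeCap (hN _) hn _

lemma facParams_valid (hp : 1 ≤ p) (hN : ∀ i, IsMonotoneSymmetricNorm (N i)) (hn : 1 ≤ n) :
    (facParams p N).Valid where
  one_le_p := hp
  p_le_K F := le_max_right _ _
  p_le_B F := by
    have hκ := fallbackCap_pos hN hn F
    have hM : (1 : ℝ) ≤ scaleCount m := by exact_mod_cast (scaleCount_pos (m := m))
    have h1 : (8 : ℝ) ≤
        4 * max (facCap N F : ℝ) p / (1 / (2 * scaleCount m) * fallbackCap N F) := by
      rw [le_div_iff₀ (by positivity)]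
      have h2 : 1 / (2 * (scaleCount m : ℝ)) ≤ 1 / 2 :=
        one_div_le_one_div_of_le (by norm_num) (by linarith)
      have h3 := (fallbackCap_le hN hn F).trans (le_max_left (facCap N F : ℝ) p)
      nlinarith
    have h4 : (1 : ℝ) ≤ Real.log 8 := by
      rw [Real.le_log_iff_exp_le (by norm_num)]
      exact Real.exp_one_lt_d9.le.trans (by norm_num)
    have h5 := Real.log_le_log (by norm_num) h1
    change p ≤ 24 * p * _
    nlinarith
  y₀_pos := by
    have := scaleCount_pos (m := m)
    change (0 : ℝ) < 1 / (2 * scaleCount m)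
    positivity

lemma facSize_pos (F : Facility n m) : 0 < facSize f O F :=
  div_pos (threshold_pos _ _ _) (by positivity)

lemma facLoad_nonneg (F : Facility n m) : 0 ≤ facLoad f O F :=
  Pi.single_nonneg.2 (facSize_pos F).le

/-- Machine and scale determine the size class of a job, so `n` does not enter `y₀`. -/
lemma card_jobRequest_fac_le (J : Job m r) :
    (jobRequest p f N O J : Request m (Facility n m)).fac.card ≤ scaleCount m := by
  have : (jobRequest p f N O J : Request m (Facility n m)).fac.card
      ≤ (Finset.univ : Finset (Fin m × Fin (scaleBound m + 1))).card := by
    refine Finset.card_le_card_of_injOn (fun F => (F.1, F.2.1)) (fun _ _ => by simp) ?_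
    intro F hF G hG hFG
    have h1 := (Finset.mem_filter.1 hF).2.2.2.1
    have h2 := (Finset.mem_filter.1 hG).2.2.2.1
    obtain ⟨i, h, s⟩ := F
    obtain ⟨i', h', s'⟩ := G
    simp only [Prod.mk.injEq] at hFG
    obtain ⟨rfl, rfl⟩ := hFG
    simp only [Prod.mk.injEq, true_and]
    exact Fin.ext (h1.trans h2.symm)
  simpa [scaleCount] using this

lemma setting_core (hf : IsSmoothCost p f) (hN : ∀ i, IsMonotoneSymmetricNorm (N i)) (hn : 1 ≤ n)
    (O : ℝ) (jobs : Fin n → Job m r) :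
    Setting (facParams p N) f (facLoad f O) (jobRequests p f N O jobs) where
  smooth := hf
  w_nonneg := facLoad_nonneg
  valid := facParams_valid hf.one_le hN hn
  u_nonneg j i := by
    unfold jobRequests
    split_ifs
    · exact soloLoad_nonneg N _ i
    · exact le_rfl
  card_le j := by
    have hM : (0 : ℝ) < scaleCount m := by exact_mod_cast (scaleCount_pos (m := m))
    unfold jobRequests
    split_ifs
    · have := card_jobRequest_fac_le (p := p) (f := f) (N := N) (O := O) (jobs ⟨j, ‹_›⟩)
      change _ * (1 / (2 * (scaleCount m : ℝ))) ≤ _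
      rw [mul_one_div, div_le_div_iff₀ (by positivity) (by norm_num)]
      have : ((jobRequest p f N O (jobs ⟨j, ‹_›⟩) : Request m (Facility n m)).fac.card : ℝ)
        ≤ scaleCount m := by exact_mod_cast this
      linarith
    · simp

/-- Every job is either trivial or active. -/
lemma activeMachines_nonempty {J : Job m r} (hJ : ∃ i k, J i k ≠ ⊤)
    (h : ¬ ∃ i, IsTrivialOption f J i) : (activeMachines f J).Nonempty := by
  obtain ⟨i, k, hik⟩ := hJ
  rw [activeMachines, if_neg h]
  exact ⟨i, Finset.mem_filter.2 ⟨Finset.mem_univ _, ne_top_of_le_ne_top hik (bestWay_le J i k)⟩⟩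

lemma mem_activeMachines {J : Job m r} {i : Fin m} (hi : i ∈ activeMachines f J) :
    (¬ ∃ i, IsTrivialOption f J i) ∧ J i (bestWay J i) ≠ ⊤ := by
  unfold activeMachines at hi
  split_ifs at hi with h
  · simp at hi
  · exact ⟨h, (Finset.mem_filter.1 hi).2⟩

end Core

/-! ### Greedy and direct loads as counts of jobs -/

section Counting

variable {ι : Type} [Fintype ι] [DecidableEq ι] {m : ℕ} {P : FacilityParams ι}
  {f : (Fin m → ℝ) → ℝ} {w : ι → Fin m → ℝ} {q : ℕ → Request m ι}

open Classical in
/-- The number of jobs among the first `M` that are assigned greedily to the facility `F`. -/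
noncomputable def goodCount (P : FacilityParams ι) (f : (Fin m → ℝ) → ℝ) (w : ι → Fin m → ℝ)
    (q : ℕ → Request m ι) (M : ℕ) (F : ι) (U : ι → I) : ℕ :=
  ((Finset.range M).filter fun k => roundOutcome P f w q k U = .good F).card

/-- Each greedy assignment fills the fraction `1 / K` of a copy, so the greedy loads record the
number of jobs at each facility. -/
lemma greedyRun_eq_sum (M : ℕ) (U : ι → I) :
    greedyRun P f w q U M = ∑ F, ((goodCount P f w q M F U : ℝ) / P.K F) • w F := by
  classical
  induction M with
  | zero => simp [greedyRun, goodCount]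
  | succ M ih =>
    have hcount : ∀ F, (goodCount P f w q (M + 1) F U : ℝ)
        = goodCount P f w q M F U + if roundOutcome P f w q M U = .good F then 1 else 0 := by
      intro F
      rw [goodCount, goodCount, Finset.range_add_one, Finset.filter_insert]
      split_ifs with h
      · rw [Finset.card_insert_of_notMem (by simp)]; push_cast; rfl
      · simp
    rw [greedyRun_succ, ih]
    simp only [hcount, add_div, add_smul, Finset.sum_add_distrib]
    cases ho : roundOutcome P f w q M U with
    | good F =>
      rw [addOutcome, add_right_inj, Finset.sum_eq_single F]
      · simp
      · intro G _ hG
        rw [if_neg fun h => hG (Outcome.good.inj h).symm, zero_div, zero_smul]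
      · simp
    | _ => simp [addOutcome]

open Classical in
lemma Setting.sum_direct_le (h : Setting P f w q) (M : ℕ) (U : ι → I) (i : Fin m) :
    ∑ k ∈ Finset.range M, (if (q k).avail.Nonempty ∧ roundOutcome P f w q k U = .direct i
      then (q k).u i else 0) ≤ (fracRun P f w q M).D i := by
  induction M with
  | zero => simp [fracRun]
  | succ M ih =>
    rw [Finset.sum_range_succ]
    have hmono := (fracRun_mono h.smooth h.w_nonneg h.valid h.u_nonneg (Nat.le_succ M)
      (P := P) (f := f) (w := w) (q := q)).1 i
    split_ifs with hc
    · rcases h.roundOutcome_cases hc.1 U with ⟨i', _, ho, hD⟩ | ⟨F, _, ho, _⟩ | ⟨F, _, ho⟩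
      · rw [hc.2] at ho
        cases ho
        rw [hD, Pi.add_apply, Pi.single_eq_same]
        linarith
      · rw [hc.2] at ho; cases ho
      · rw [hc.2] at ho; cases ho
    · linarith

end Counting

/-! ### Actual machine loads of the rounded algorithm -/

section LoadBound

variable {n m r : ℕ} [NeZero m] [NeZero r] {p : ℝ} {f : (Fin m → ℝ) → ℝ}
  {N : Fin m → Seminorm ℝ (Fin n × Fin r → ℝ)} {O : ℝ} {jobs : Fin n → Job m r}

lemma loadVector_nonneg (x : Allocation n m r) (i : Fin m) : 0 ≤ loadVector jobs x i := fun a => by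
  unfold loadVector
  split_ifs
  · exact ENNReal.toReal_nonneg
  · exact le_rfl

open Classical in
/-- The loads on machine `i` that come from active jobs whose outcome satisfies `φ`. -/
noncomputable def partLoad (p : ℝ) (f : (Fin m → ℝ) → ℝ)
    (N : Fin m → Seminorm ℝ (Fin n × Fin r → ℝ)) (O : ℝ) (jobs : Fin n → Job m r)
    (U : Facility n m → I) (i : Fin m) (φ : Outcome m (Facility n m) → Prop) :
    Fin n × Fin r → ℝ := fun a =>
  if (activeMachines f (jobs a.1)).Nonempty ∧ φ (coreOutcome p f N O jobs a.1 U) then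
    loadVector jobs (coreAlloc p f N O jobs U) i a else 0

lemma partLoad_nonneg (U : Facility n m → I) (i : Fin m) (φ : Outcome m (Facility n m) → Prop) :
    0 ≤ partLoad p f N O jobs U i φ := fun a => by
  unfold partLoad
  split_ifs
  · exact loadVector_nonneg _ _ a
  · exact le_rfl

/-- The possible outcomes of an active job. -/
lemma coreOutcome_cases (hf : IsSmoothCost p f) (hN : ∀ i, IsMonotoneSymmetricNorm (N i))
    (hn : 1 ≤ n) {j : Fin n} (ha : (activeMachines f (jobs j)).Nonempty) (U : Facility n m → I) :
    (∃ i ∈ activeMachines f (jobs j), coreOutcome p f N O jobs j U = .direct i) ∨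
      (∃ F ∈ (jobRequest p f N O (jobs j)).fac, coreOutcome p f N O jobs j U = .good F ∧
        Fresh ((fracRun (facParams p N) f (facLoad f O) (jobRequests p f N O jobs) (j + 1)).z F)
          (U F)) ∨
      ∃ F ∈ (jobRequest p f N O (jobs j)).fac, coreOutcome p f N O jobs j U = .bad F := by
  have hs := setting_core hf hN hn O jobs
  have ha' : (jobRequests p f N O jobs j).avail.Nonempty := by rw [jobRequests_coe]; exact ha
  have hfac : ∀ F ∈ heavyAt (facParams p N) f (facLoad f O) (jobRequests p f N O jobs) j,
      F ∈ (jobRequest p f N O (jobs j)).fac := fun F hF => by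
    have := (hs.heavyAt_spec hF).1
    rwa [jobRequests_coe] at this
  rcases hs.roundOutcome_cases ha' U with ⟨i, hi, ho, _⟩ | ⟨F, hF, ho, hfr⟩ | ⟨F, hF, ho⟩
  · rw [jobRequests_coe] at hi
    exact Or.inl ⟨i, hi, ho⟩
  · exact Or.inr (Or.inl ⟨F, hfac F hF, ho, hfr⟩)
  · exact Or.inr (Or.inr ⟨F, hfac F hF, ho⟩)

lemma mem_jobRequest_fac {J : Job m r} {F : Facility n m}
    (hF : F ∈ (jobRequest p f N O J).fac) : F.1 ∈ activeMachines f J ∧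
      soloLoad N J F.1 ≤ facSize f O F ∧
      (F.2.2 : ℕ) = sizeClass n (soloLoad N J F.1) (facSize f O F) ∧ p ≤ facCap N F :=
  (Finset.mem_filter.1 hF).2

lemma assignedMachine_of_active {J : Job m r} {i : Fin m} (hi : i ∈ activeMachines f J) :
    assignedMachine f J i = i :=
  assignedMachine_eq (mem_activeMachines hi).1 (mem_activeMachines hi).2

/-- On a machine that is not free, only active jobs incur loads. -/
lemma loadVector_le_parts (hf : IsSmoothCost p f) (hN : ∀ i, IsMonotoneSymmetricNorm (N i))
    (hn : 1 ≤ n) (hx : ∃ x, Feasible jobs x) (U : Facility n m → I) {i : Fin m}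
    (hi : ¬ IsFree f i) :
    loadVector jobs (coreAlloc p f N O jobs U) i ≤
      partLoad p f N O jobs U i (· = .direct i)
        + ∑ F, (partLoad p f N O jobs U i (· = .good F)
          + partLoad p f N O jobs U i (· = .bad F)) := by
  intro a
  have hgb : ∀ F, 0 ≤ partLoad p f N O jobs U i (· = .good F)
      + partLoad p f N O jobs U i (· = .bad F) := fun F =>
    add_nonneg (partLoad_nonneg _ _ _) (partLoad_nonneg _ _ _)
  have hd := partLoad_nonneg (p := p) (f := f) (N := N) (O := O) (jobs := jobs) U i
    (· = .direct i) a
  have hsum0 : 0 ≤ (∑ F, (partLoad p f N O jobs U i (· = .good F)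
      + partLoad p f N O jobs U i (· = .bad F))) a :=
    (Finset.sum_nonneg fun F _ => hgb F : (0 : Fin n × Fin r → ℝ) ≤ _) a
  rw [Pi.add_apply]
  simp only [Pi.zero_apply] at hd
  by_cases hxa : coreAlloc p f N O jobs U a.1 = (i, a.2)
  swap
  · rw [loadVector, if_neg hxa]; linarith
  have hmach : assignedMachine f (jobs a.1) (coreOutcome p f N O jobs a.1 U).machine = i :=
    congrArg Prod.fst hxa
  by_cases ht : ∃ i, IsTrivialOption f (jobs a.1) i
  · have h1 := assignedMachine_of_trivial ht (coreOutcome p f N O jobs a.1 U).machine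
    rw [hmach] at h1
    have h2 : bestWay (jobs a.1) i = a.2 := by
      have := congrArg Prod.snd hxa
      simpa only [coreAlloc, hmach] using this
    have h3 := h1.2.resolve_left hi
    rw [h2] at h3
    rw [loadVector, if_pos hxa, h3, ENNReal.toReal_zero]
    linarith
  have ha := activeMachines_nonempty ⟨_, _, hx.choose_spec a.1⟩ ht
  have hpart : ∀ φ : Outcome m (Facility n m) → Prop, φ (coreOutcome p f N O jobs a.1 U) →
      loadVector jobs (coreAlloc p f N O jobs U) i a = partLoad p f N O jobs U i φ a := by
    intro φ hφ
    rw [partLoad, if_pos ⟨ha, hφ⟩]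
  have hterm : ∀ F, partLoad p f N O jobs U i (· = .good F) a
      + partLoad p f N O jobs U i (· = .bad F) a ≤
        (∑ F, (partLoad p f N O jobs U i (· = .good F)
          + partLoad p f N O jobs U i (· = .bad F))) a := by
    intro F
    rw [Finset.sum_apply]
    exact Finset.single_le_sum (f := fun F => (partLoad p f N O jobs U i (· = .good F)
          + partLoad p f N O jobs U i (· = .bad F)) a) (fun F _ => hgb F a) (Finset.mem_univ F)
  rcases coreOutcome_cases hf hN hn ha U with ⟨i', hi', ho⟩ | ⟨F, _, ho, _⟩ | ⟨F, _, ho⟩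
  · have : i' = i := by
      rw [ho] at hmach
      rw [← hmach]
      exact (assignedMachine_of_active hi').symm
    subst this
    rw [hpart (· = .direct i') ho]
    linarith
  · rw [hpart (· = .good F) ho]
    have h1 := hterm F
    have h2 := partLoad_nonneg (p := p) (f := f) (N := N) (O := O) (jobs := jobs) U i
      (· = .bad F) a
    simp only [Pi.zero_apply] at h2
    linarith
  · rw [hpart (· = .bad F) ho]
    have h1 := hterm F
    have h2 := partLoad_nonneg (p := p) (f := f) (N := N) (O := O) (jobs := jobs) U i
      (· = .good F) a
    simp only [Pi.zero_apply] at h2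
    linarith

/-- Triangle inequality over single jobs: each contributes its solo load, which is what `D` records.
-/
lemma norm_partLoad_direct_le (hf : IsSmoothCost p f) (hN : ∀ i, IsMonotoneSymmetricNorm (N i))
    (hn : 1 ≤ n) (U : Facility n m → I) (i : Fin m) :
    N i (partLoad p f N O jobs U i (· = .direct i))
      ≤ (fracRun (facParams p N) f (facLoad f O) (jobRequests p f N O jobs) n).D i := by
  classical
  have hs := setting_core hf hN hn O jobs
  refine le_trans ?_ (hs.sum_direct_le n U i)
  rw [Finset.sum_range]
  set c : Fin n → ℝ := fun j => if (jobRequests p f N O jobs j).avail.Nonempty ∧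
    roundOutcome (facParams p N) f (facLoad f O) (jobRequests p f N O jobs) j U = .direct i
      then (jobs j i (bestWay (jobs j) i)).toReal else 0 with hc
  have hc0 : ∀ j, 0 ≤ c j := fun j => by
    simp only [hc]; split_ifs
    · exact ENNReal.toReal_nonneg
    · exact le_rfl
  have hsingle : ∀ j, (0 : Fin n × Fin r → ℝ) ≤ Pi.single (j, bestWay (jobs j) i) (c j) :=
    fun j => Pi.single_nonneg.2 (hc0 j)
  have hle : partLoad p f N O jobs U i (· = .direct i)
      ≤ ∑ j : Fin n, Pi.single (j, bestWay (jobs j) i) (c j) := by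
    intro a
    have hR : 0 ≤ (∑ j : Fin n, (Pi.single (j, bestWay (jobs j) i) (c j) : Fin n × Fin r → ℝ)) a :=
      (Finset.sum_nonneg fun j _ => hsingle j : (0 : Fin n × Fin r → ℝ) ≤ _) a
    by_cases hcond : (activeMachines f (jobs a.1)).Nonempty ∧
        coreOutcome p f N O jobs a.1 U = .direct i
    swap
    · rw [partLoad, if_neg hcond]; exact hR
    by_cases hxa : coreAlloc p f N O jobs U a.1 = (i, a.2)
    swap
    · rw [partLoad, if_pos hcond, loadVector, if_neg hxa]; exact hR
    rw [partLoad, if_pos hcond, loadVector, if_pos hxa]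
    have hmach : assignedMachine f (jobs a.1) (coreOutcome p f N O jobs a.1 U).machine = i :=
      congrArg Prod.fst hxa
    have h2 : bestWay (jobs a.1) i = a.2 := by
      have := congrArg Prod.snd hxa
      simpa only [coreAlloc, hmach] using this
    rw [Finset.sum_apply]
    refine le_trans (le_of_eq ?_) (Finset.single_le_sum
      (f := fun j => (Pi.single (j, bestWay (jobs j) i) (c j) : Fin n × Fin r → ℝ) a)
      (fun j _ => hsingle j a) (Finset.mem_univ a.1))
    have : ((a.1, bestWay (jobs a.1) i) : Fin n × Fin r) = a := by rw [h2]
    simp only [this, Pi.single_eq_same]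
    rw [hc]
    simp only
    rw [if_pos, h2]
    rw [jobRequests_coe]
    exact hcond
  refine ((hN i).monotone _ _ (partLoad_nonneg _ _ _) hle).trans ?_
  refine (Finset.le_sum_of_subadditive (N i) (map_zero _).le (map_add_le_add _) _ _).trans ?_
  refine Finset.sum_le_sum fun j _ => ?_
  rw [(hN i).single_eq _ (hc0 j), hc]
  simp only
  split_ifs with h
  · rw [jobRequests_coe]; exact le_rfl
  · simp

open Classical in
/-- The jobs with a given outcome at a facility have bounded sizes. -/
lemma norm_partLoad_facility_le (hf : IsSmoothCost p f)
    (hN : ∀ i, IsMonotoneSymmetricNorm (N i)) (hn : 1 ≤ n) (U : Facility n m → I) (i : Fin m)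
    (F : Facility n m) {o : Outcome m (Facility n m)} (ho : o = .good F ∨ o = .bad F) :
    N i (partLoad p f N O jobs U i (· = o)) ≤ facLoad f O F i *
      (sizeNorm (N F.1) ((Finset.range n).filter fun j => coreOutcome p f N O jobs j U = o).card
        / (2 ^ (F.2.2 : ℕ) * sizeNorm (N F.1) 1)) := by
  have hfac : ∀ j : Fin n, (activeMachines f (jobs j)).Nonempty →
      coreOutcome p f N O jobs j U = o → F ∈ (jobRequest p f N O (jobs j)).fac := by
    intro j ha hj
    rcases coreOutcome_cases hf hN hn ha U with ⟨i', _, h⟩ | ⟨G, hG, h, _⟩ | ⟨G, hG, h⟩ <;>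
      rw [hj] at h <;> rcases ho with ho | ho <;> rw [ho] at h <;> cases h <;> assumption
  have hmach : ∀ j : Fin n, (activeMachines f (jobs j)).Nonempty →
      coreOutcome p f N O jobs j U = o →
      coreAlloc p f N O jobs U j = (F.1, bestWay (jobs j) F.1) := by
    intro j ha hj
    have h1 := assignedMachine_of_active (mem_jobRequest_fac (hfac j ha hj)).1
    have h2 : o.machine = F.1 := by rcases ho with ho | ho <;> rw [ho] <;> rfl
    simp only [coreAlloc, hj, h2, h1]
  by_cases hFi : F.1 = i
  swap
  · have h0 : partLoad p f N O jobs U i (· = o) = 0 := by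
      funext a
      rw [partLoad]
      split_ifs with hc
      · rw [loadVector, if_neg, Pi.zero_apply]
        rw [hmach a.1 hc.1 hc.2]
        exact fun h => hFi (congrArg Prod.fst h)
      · rfl
    rw [h0, map_zero, facLoad, Pi.single_eq_of_ne (Ne.symm hFi), zero_mul]
  subst hFi
  set A := Finset.univ.filter fun j : Fin n => coreOutcome p f N O jobs j U = o with hA
  set Q := A.image fun j => ((j, bestWay (jobs j) F.1) : Fin n × Fin r) with hQ
  have hr : (Nonempty (Fin n × Fin r)) := ⟨(⟨0, hn⟩, 0)⟩
  have hpos := (hN F.1).sizeNorm_one_pos hr.some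
  have hcard : Q.card ≤
      ((Finset.range n).filter fun j => coreOutcome p f N O jobs j U = o).card := by
    refine Finset.card_image_le.trans (le_of_eq ?_)
    rw [hA, Finset.card_filter, Finset.card_filter, Finset.sum_range]
  have hT := (facSize_pos (f := f) (O := O) F).le
  refine ((hN F.1).le_mul_sizeNorm (Q := Q)
    (c := facSize f O F / (2 ^ (F.2.2 : ℕ) * sizeNorm (N F.1) 1)) (partLoad_nonneg _ _ _)
    (by positivity) ?_ ?_).trans ?_
  · intro a _
    rw [partLoad]
    split_ifs with hc
    · have h1 := mem_jobRequest_fac (hfac a.1 hc.1 hc.2)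
      rw [loadVector]
      split_ifs with hxa
      · rw [hmach a.1 hc.1 hc.2] at hxa
        have h2 : bestWay (jobs a.1) F.1 = a.2 := congrArg Prod.snd hxa
        have h3 : soloLoad N (jobs a.1) F.1 * 2 ^ (F.2.2 : ℕ) ≤ facSize f O F := by
          rw [h1.2.2.1]
          exact Nat.findGreatest_spec (P := fun s => soloLoad N (jobs a.1) F.1 * 2 ^ s
            ≤ facSize f O F) (Nat.zero_le _) (by simpa using h1.2.1)
        rw [soloLoad, h2] at h3
        rw [le_div_iff₀ (by positivity)]
        linarith
      · positivity
    · positivity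
  · intro a ha
    rw [partLoad]
    split_ifs with hc
    · rw [loadVector, if_neg]
      intro hxa
      rw [hmach a.1 hc.1 hc.2] at hxa
      refine ha (Finset.mem_image.2 ⟨a.1, Finset.mem_filter.2 ⟨Finset.mem_univ _, hc.2⟩, ?_⟩)
      exact Prod.ext rfl (Prod.mk.inj hxa).2
    · rfl
  · rw [facLoad, Pi.single_eq_same, div_mul_eq_mul_div, mul_div_assoc]
    exact mul_le_mul_of_nonneg_left
      (div_le_div_of_nonneg_right ((hN F.1).sizeNorm_mono hcard) (by positivity)) hT

/-- A copy holds `K` jobs of the class within twice its load, so the jobs there need at most `1 +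
goodCount / K` such units. The `1` is covered by an open copy, because jobs go only to fresh
facilities. -/
lemma norm_partLoad_good_le (hf : IsSmoothCost p f) (hN : ∀ i, IsMonotoneSymmetricNorm (N i))
    (hn : 1 ≤ n) (U : Facility n m → I) (i : Fin m) (F : Facility n m) :
    N i (partLoad p f N O jobs U i (· = .good F)) ≤ 2 * ((copies (fracRun (facParams p N) f
        (facLoad f O) (jobRequests p f N O jobs) n).z U F : ℝ)
      + goodCount (facParams p N) f (facLoad f O) (jobRequests p f N O jobs) n F U
        / (facParams p N).K F) * facLoad f O F i := by
  classical
  have hs := setting_core hf hN hn O jobs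
  have hr : (Nonempty (Fin n × Fin r)) := ⟨(⟨0, hn⟩, 0)⟩
  have hpos := (hN F.1).sizeNorm_one_pos hr.some
  have hw0 := facLoad_nonneg (f := f) (O := O) F i
  have hKpos := hs.valid.K_pos F
  simp only [Pi.zero_apply] at hw0
  by_cases hex : ∃ j : Fin n, (activeMachines f (jobs j)).Nonempty ∧
      coreOutcome p f N O jobs j U = .good F
  swap
  · have h0 : partLoad p f N O jobs U i (· = .good F) = 0 := by
      funext a
      rw [partLoad, if_neg fun h => hex ⟨a.1, h⟩]; rfl
    rw [h0, map_zero]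
    positivity
  obtain ⟨j, ha, hj⟩ := hex
  have hcases : F ∈ (jobRequest p f N O (jobs j)).fac ∧
      Fresh ((fracRun (facParams p N) f (facLoad f O) (jobRequests p f N O jobs) (j + 1)).z F)
        (U F) := by
    rcases coreOutcome_cases hf hN hn ha U with ⟨i', _, h⟩ | ⟨G, hG, h, hfr⟩ | ⟨G, hG, h⟩ <;>
      rw [hj] at h <;> cases h
    exact ⟨hG, hfr⟩
  have hcopy : (1 : ℝ) ≤ (copies (fracRun (facParams p N) f
      (facLoad f O) (jobRequests p f N O jobs) n).z U F : ℝ) := by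
    exact_mod_cast hcases.2.one_le_roundUp (hs.z_mono F j.2)
  have hK : (facParams p N).K F = facCap N F :=
    max_eq_left (mem_jobRequest_fac hcases.1).2.2.2
  refine (norm_partLoad_facility_le hf hN hn U i F (Or.inl rfl)).trans ?_
  rw [mul_comm _ (facLoad f O F i)]
  refine mul_le_mul_of_nonneg_left ?_ hw0
  rw [div_le_iff₀ (by positivity)]
  have h1 := (hN F.1).sizeNorm_le_ratio (one_le_sizeCap (hN F.1) hn (F.2.2 + 1))
    ((Finset.range n).filter fun j => coreOutcome p f N O jobs j U = .good F).card
  have h2 := sizeCap_spec (n := n) (hN F.1) (F.2.2 + 1)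
  set G : ℝ :=
    ((goodCount (facParams p N) f (facLoad f O) (jobRequests p f N O jobs) n F U : ℕ) : ℝ)
    with hG
  have h3 : (0 : ℝ) ≤ G / (facParams p N).K F := div_nonneg (Nat.cast_nonneg _) hKpos.le
  calc _ ≤ (1 + G / (facParams p N).K F) * sizeNorm (N F.1) (sizeCap (N F.1) n (F.2.2 + 1)) := by
        rw [hK]; exact h1
    _ ≤ (1 + G / (facParams p N).K F) * (2 ^ ((F.2.2 : ℕ) + 1) * sizeNorm (N F.1) 1) :=
        mul_le_mul_of_nonneg_left h2 (by positivity)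
    _ = 2 * (1 + G / (facParams p N).K F) * (2 ^ (F.2.2 : ℕ) * sizeNorm (N F.1) 1) := by
        rw [pow_succ]; ring
    _ ≤ _ := by
        refine mul_le_mul_of_nonneg_right ?_ (by positivity)
        linarith

/-- The same argument with the capacity `gapBound` classes below: the first `fallbackCap` jobs weigh
only the fraction `(1 / 2) ^ gapBound` of a load. -/
lemma norm_partLoad_bad_le (hf : IsSmoothCost p f) (hN : ∀ i, IsMonotoneSymmetricNorm (N i))
    (hn : 1 ≤ n) (U : Facility n m → I) (i : Fin m) (F : Facility n m) :
    N i (partLoad p f N O jobs U i (· = .bad F)) ≤ (1 / 2) ^ gapBound n m * (1 +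
      Setting.badCount (facParams p N) f (facLoad f O) (jobRequests p f N O jobs) n F U
        / fallbackCap N F) * facLoad f O F i := by
  classical
  have hr : (Nonempty (Fin n × Fin r)) := ⟨(⟨0, hn⟩, 0)⟩
  have hpos := (hN F.1).sizeNorm_one_pos hr.some
  have hw0 := facLoad_nonneg (f := f) (O := O) F i
  simp only [Pi.zero_apply] at hw0
  refine (norm_partLoad_facility_le hf hN hn U i F (Or.inr rfl)).trans ?_
  rw [mul_comm _ (facLoad f O F i)]
  refine mul_le_mul_of_nonneg_left ?_ hw0
  rw [div_le_iff₀ (by positivity)]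
  set B : ℝ := ((Setting.badCount (facParams p N) f (facLoad f O) (jobRequests p f N O jobs)
    n F U : ℕ) : ℝ) with hB
  have hB0 : 0 ≤ B := Nat.cast_nonneg _
  rw [fallbackCap]
  split_ifs with hg
  · have h1 := (hN F.1).sizeNorm_le_ratio (one_le_sizeCap (hN F.1) hn (F.2.2 - gapBound n m))
      ((Finset.range n).filter fun j => coreOutcome p f N O jobs j U = .bad F).card
    have h2 := sizeCap_spec (n := n) (hN F.1) (F.2.2 - gapBound n m)
    have h3 : (2 : ℝ) ^ (F.2.2 : ℕ) = 2 ^ ((F.2.2 : ℕ) - gapBound n m) * 2 ^ gapBound n m := by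
      rw [← pow_add, Nat.sub_add_cancel hg]
    refine h1.trans ((mul_le_mul_of_nonneg_left h2 (by positivity)).trans (le_of_eq ?_))
    rw [h3, one_div, inv_pow]
    change (1 + B / _) * _ = _
    field_simp
  · have h1 := (hN F.1).sizeNorm_le_mul
      ((Finset.range n).filter fun j => coreOutcome p f N O jobs j U = .bad F).card
    have h3 : (1 : ℝ) ≤ 2 ^ (F.2.2 : ℕ) := one_le_pow₀ one_le_two
    have h4 : (1 / 2 : ℝ) ^ gapBound n m * (1 + B / (1 / 2) ^ gapBound n m)
        = (1 / 2) ^ gapBound n m + B := by field_simp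
    rw [h4]
    have h5 : (0 : ℝ) < (1 / 2) ^ gapBound n m := by positivity
    change _ ≤ B * _ at h1
    refine h1.trans ?_
    have h6 : sizeNorm (N F.1) 1 ≤ 2 ^ (F.2.2 : ℕ) * sizeNorm (N F.1) 1 :=
      le_mul_of_one_le_left hpos.le h3
    nlinarith

/-- The loads of the rounded algorithm in terms of direct loads, open copies, greedy loads and
fallbacks. -/
theorem norm_loadVector_le (hf : IsSmoothCost p f) (hN : ∀ i, IsMonotoneSymmetricNorm (N i))
    (hn : 1 ≤ n) (hx : ∃ x, Feasible jobs x) (U : Facility n m → I) {i : Fin m}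
    (hi : ¬ IsFree f i) {s : LoadState m (Facility n m)} {Z : Fin m → ℝ} {b : Facility n m → ℝ}
    (hs : s = fracRun (facParams p N) f (facLoad f O) (jobRequests p f N O jobs) n)
    (hZ : Z = greedyRun (facParams p N) f (facLoad f O) (jobRequests p f N O jobs) U n)
    (hb : b = fun F => (Setting.badCount (facParams p N) f (facLoad f O)
      (jobRequests p f N O jobs) n F U : ℝ) / fallbackCap N F) :
    N i (loadVector jobs (coreAlloc p f N O jobs U) i) ≤
      ((2 : ℝ) • openLoad (facLoad f O) s.D (copies s.z U) + (2 : ℝ) • Z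
        + ∑ F, ((1 / 2) ^ gapBound n m * (1 + b F)) • facLoad f O F) i := by
  have hset := setting_core hf hN hn O jobs
  have hD0 : 0 ≤ s.D i := by
    rw [hs]
    exact fracRun_D_nonneg hset.smooth hset.w_nonneg hset.valid hset.u_nonneg n i
  refine ((hN i).monotone _ _ (loadVector_nonneg _ _)
    (loadVector_le_parts hf hN hn hx U hi)).trans ?_
  refine (map_add_le_add _ _ _).trans ?_
  have h1 := norm_partLoad_direct_le (O := O) (jobs := jobs) hf hN hn U i
  have h2 : N i (∑ F, (partLoad p f N O jobs U i (· = .good F)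
      + partLoad p f N O jobs U i (· = .bad F))) ≤ ∑ F,
        (2 * ((copies s.z U F : ℝ)
          + goodCount (facParams p N) f (facLoad f O) (jobRequests p f N O jobs) n F U
            / (facParams p N).K F) * facLoad f O F i
          + (1 / 2) ^ gapBound n m * (1 + b F) * facLoad f O F i) := by
    refine (Finset.le_sum_of_subadditive (N i) (map_zero _).le (map_add_le_add _) _ _).trans ?_
    refine Finset.sum_le_sum fun F _ => (map_add_le_add _ _ _).trans (add_le_add ?_ ?_)
    · rw [hs]; exact norm_partLoad_good_le hf hN hn U i F
    · rw [hb]; exact norm_partLoad_bad_le hf hN hn U i F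
  rw [← hs] at h1
  refine (add_le_add h1 h2).trans ?_
  rw [hZ, greedyRun_eq_sum]
  simp only [openLoad, Pi.add_apply, Pi.smul_apply, Finset.sum_apply, smul_eq_mul,
    Finset.sum_add_distrib, mul_add, add_mul, Finset.mul_sum, mul_assoc]
  linarith

end LoadBound

/-! ### Rounding an offline allocation to scales and size classes -/

section OfflineSolution

/-- Telescoping with shift `g + 1`: only the last `g + 1` values survive. In the sum of the boosts
over the size classes this replaces a factor of order `log n` by `g + 1`. -/
lemma sum_shifted_sub_le {a : ℕ → ℝ} {L : ℝ} (h0 : ∀ t, 0 ≤ a t) (hL : ∀ t, a t ≤ L) (g k : ℕ) :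
    ∑ s ∈ Finset.range k, (a (s + 1) - if g ≤ s then a (s - g) else 0) ≤ (g + 1) * L := by
  have key : ∀ k, ∑ s ∈ Finset.range k, (a (s + 1) - if g ≤ s then a (s - g) else 0)
      ≤ ∑ j ∈ Finset.range (g + 1), if j ≤ k then a (k - j) else 0 := by
    intro k
    induction k with
    | zero =>
      simp only [Finset.range_zero, Finset.sum_empty]
      exact Finset.sum_nonneg fun j _ => by split_ifs <;> simp [h0]
    | succ k ih =>
      rw [Finset.sum_range_succ, Finset.sum_range_succ']
      rw [Finset.sum_range_succ] at ih
      simp only [Nat.add_le_add_iff_right, Nat.add_sub_add_right, Nat.zero_le, if_true,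
        Nat.sub_zero]
      linarith
  refine (key k).trans ?_
  have : ∀ j ∈ Finset.range (g + 1), (if j ≤ k then a (k - j) else 0) ≤ L := fun j _ => by
    split_ifs
    · exact hL _
    · exact (h0 0).trans (hL 0)
  refine (Finset.sum_le_sum this).trans (le_of_eq ?_)
  simp

variable {n m r : ℕ} [NeZero m] [NeZero r] {p : ℝ} {f : (Fin m → ℝ) → ℝ}
  {N : Fin m → Seminorm ℝ (Fin n × Fin r → ℝ)} {O : ℝ} {jobs : Fin n → Job m r}

/-- A bound for the sum of the logarithms of the ratios of capacities over all size classes. -/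
noncomputable def logBudget (n m : ℕ) : ℝ :=
  (gapBound n m + 1) * Real.log n
    + (Nat.clog 2 n + 1) * (Real.log (8 * scaleCount m) + gapBound n m * Real.log 2)

/-- Separates a part common to all size classes from a difference of logarithms of capacities, which
telescopes over the classes. -/
lemma log_ratio_le (hN : ∀ i, IsMonotoneSymmetricNorm (N i)) (hn : 1 ≤ n) (F : Facility n m) :
    Real.log (4 * facCap N F / (1 / (2 * scaleCount m) * fallbackCap N F))
      ≤ Real.log (8 * scaleCount m) + gapBound n m * Real.log 2
        + (Real.log (sizeCap (N F.1) n (F.2.2 + 1)) - if gapBound n m ≤ F.2.2 then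
          Real.log (sizeCap (N F.1) n (F.2.2 - gapBound n m)) else 0) := by
  have hM : (0 : ℝ) < scaleCount m := by exact_mod_cast (scaleCount_pos (m := m))
  have hκ := fallbackCap_pos hN hn F
  have hcap : (0 : ℝ) < facCap N F := by
    exact_mod_cast one_le_sizeCap (hN F.1) hn (F.2.2 + 1)
  have e : 4 * (facCap N F : ℝ) / (1 / (2 * scaleCount m) * fallbackCap N F)
      = 8 * scaleCount m * facCap N F / fallbackCap N F := by field_simp; norm_num
  rw [e, Real.log_div (by positivity) hκ.ne', Real.log_mul (by positivity) hcap.ne']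
  have hg : 0 ≤ gapBound n m * Real.log 2 :=
    mul_nonneg (Nat.cast_nonneg _) (Real.log_nonneg one_le_two)
  change _ + Real.log (sizeCap (N F.1) n (F.2.2 + 1) : ℕ) - _ ≤ _
  unfold fallbackCap
  split_ifs
  · linarith
  · rw [Real.log_pow, one_div, Real.log_inv]
    linarith

lemma sum_log_ratio_le (hN : ∀ i, IsMonotoneSymmetricNorm (N i)) (hn : 1 ≤ n) (i : Fin m)
    (h : Fin (scaleBound m + 1)) :
    ∑ s, Real.log (4 * facCap N ((i, h, s) : Facility n m)
      / (1 / (2 * scaleCount m) * fallbackCap N (i, h, s))) ≤ logBudget n m := by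
  refine (Finset.sum_le_sum fun s _ => log_ratio_le hN hn (i, h, s)).trans ?_
  rw [Finset.sum_add_distrib, logBudget, add_comm]
  refine add_le_add ?_ (by simp [mul_add])
  simp only
  have key := sum_shifted_sub_le (a := fun t => Real.log (sizeCap (N i) n t)) (L := Real.log n)
    (fun t => Real.log_nonneg (by exact_mod_cast one_le_sizeCap (hN i) hn t))
    (fun t => Real.log_le_log (by exact_mod_cast one_le_sizeCap (hN i) hn t)
      (by exact_mod_cast sizeCap_le t)) (gapBound n m) (Nat.clog 2 n + 1)
  rw [Finset.sum_range] at key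
  exact key

lemma log_ratio_nonneg (hN : ∀ i, IsMonotoneSymmetricNorm (N i)) (hn : 1 ≤ n)
    (F : Facility n m) :
    0 ≤ Real.log (4 * facCap N F / (1 / (2 * scaleCount m) * fallbackCap N F)) := by
  have hM : (1 : ℝ) ≤ scaleCount m := by exact_mod_cast (scaleCount_pos (m := m))
  have hκ := fallbackCap_pos hN hn F
  refine Real.log_nonneg ?_
  rw [one_le_div (by positivity)]
  have h2 : 1 / (2 * (scaleCount m : ℝ)) ≤ 1 / 2 :=
    one_div_le_one_div_of_le (by norm_num) (by linarith)
  have h3 := fallbackCap_le hN hn F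
  nlinarith

/-- The loads of an allocation. -/
noncomputable def allocLoad (N : Fin m → Seminorm ℝ (Fin n × Fin r → ℝ)) (jobs : Fin n → Job m r)
    (x : Allocation n m r) : Fin m → ℝ := fun i => N i (loadVector jobs x i)

lemma allocLoad_nonneg (x : Allocation n m r) : 0 ≤ allocLoad N jobs x := fun _ =>
  apply_nonneg _ _

lemma mul_sizeNorm_le_allocLoad (hN : ∀ i, IsMonotoneSymmetricNorm (N i)) (x : Allocation n m r)
    {i : Fin m} {A : Finset (Fin n)} (hA : ∀ j ∈ A, (x j).1 = i) {c : ℝ} (hc : 0 ≤ c)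
    (hle : ∀ j ∈ A, c ≤ (jobs j i (x j).2).toReal) :
    c * sizeNorm (N i) A.card ≤ allocLoad N jobs x i := by
  have hcard : (A.image fun j => (j, (x j).2)).card = A.card :=
    Finset.card_image_of_injective _ fun j j' h => (Prod.mk.inj h).1
  rw [← hcard]
  refine (hN i).mul_sizeNorm_le (loadVector_nonneg x i) hc fun a ha => ?_
  obtain ⟨j, hj, rfl⟩ := Finset.mem_image.1 ha
  rw [loadVector, if_pos]
  · exact hle j hj
  · exact Prod.ext (hA j hj) rfl

lemma soloLoad_le_allocLoad (hN : ∀ i, IsMonotoneSymmetricNorm (N i)) {x : Allocation n m r}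
    (hx : Feasible jobs x) (j : Fin n) :
    soloLoad N (jobs j) (x j).1 ≤ allocLoad N jobs x (x j).1 := by
  have h := mul_sizeNorm_le_allocLoad (N := N) (jobs := jobs) hN x (A := {j}) (i := (x j).1)
    (c := (jobs j (x j).1 (bestWay (jobs j) (x j).1)).toReal) (by simp) ENNReal.toReal_nonneg
    fun j' hj' => by
      rw [Finset.mem_singleton.1 hj']
      exact ENNReal.toReal_mono (hx j) (bestWay_le _ _ _)
  simpa [soloLoad] using h

/-- The smallest scale that covers the load of machine `i`. -/
noncomputable def loadScale (f : (Fin m → ℝ) → ℝ) (N : Fin m → Seminorm ℝ (Fin n × Fin r → ℝ))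
    (O : ℝ) (jobs : Fin n → Job m r) (x : Allocation n m r) (i : Fin m) :
    Fin (scaleBound m + 1) :=
  ⟨Nat.findGreatest (fun h => allocLoad N jobs x i ≤ threshold f O i / 2 ^ h) (scaleBound m),
    Nat.lt_succ_of_le (Nat.findGreatest_le _)⟩

/-- The loads of an allocation, rounded up to the next scale. -/
noncomputable def roundedLoad (f : (Fin m → ℝ) → ℝ)
    (N : Fin m → Seminorm ℝ (Fin n × Fin r → ℝ))
    (O : ℝ) (jobs : Fin n → Job m r) (x : Allocation n m r) (i : Fin m) : ℝ :=
  threshold f O i / 2 ^ (loadScale f N O jobs x i : ℕ)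

lemma roundedLoad_pos (x : Allocation n m r) (i : Fin m) : 0 < roundedLoad f N O jobs x i :=
  div_pos (threshold_pos _ _ _) (by positivity)

lemma allocLoad_le_roundedLoad (hf : IsSmoothCost p f) (hO : 0 < O) (h0 : f 0 ≤ O)
    {x : Allocation n m r} (hcost : f (allocLoad N jobs x) ≤ O) {i : Fin m}
    (hi : ¬ IsFree f i) : allocLoad N jobs x i ≤ roundedLoad f N O jobs x i :=
  Nat.findGreatest_spec (P := fun h => allocLoad N jobs x i ≤ threshold f O i / 2 ^ h)
    (Nat.zero_le _) (by simpa using le_threshold hf hO h0 hi (allocLoad_nonneg x) hcost)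

/-- Either the next scale no longer covers the load, which gives the factor two, or the last scale
is reached, where `T` is at most `threshold / m`. -/
lemma roundedLoad_le (x : Allocation n m r) (i : Fin m) :
    roundedLoad f N O jobs x i ≤ 2 * allocLoad N jobs x i + threshold f O i / m := by
  have hτ := threshold_pos f O i
  have hm : (0 : ℝ) < m := by exact_mod_cast NeZero.pos m
  have hΛ := allocLoad_nonneg (N := N) (jobs := jobs) x i
  simp only [Pi.zero_apply] at hΛ
  rcases (Nat.lt_succ_iff.1 (loadScale f N O jobs x i).2).lt_or_eq with h | h
  · have h1 := Nat.findGreatest_is_greatest (Nat.lt_succ_self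
      (loadScale f N O jobs x i : ℕ)) h
    rw [not_le, pow_succ, ← div_div, div_lt_iff₀ two_pos] at h1
    have : 0 ≤ threshold f O i / m := by positivity
    have h2 : roundedLoad f N O jobs x i < allocLoad N jobs x i * 2 := h1
    linarith
  · have h1 : roundedLoad f N O jobs x i ≤ threshold f O i / m := by
      rw [roundedLoad, h]
      refine div_le_div_of_nonneg_left hτ.le hm ?_
      exact_mod_cast Nat.le_pow_clog one_lt_two m
    linarith

/-- The extra load `threshold / m` on all machines costs at most `2 * O` by averaging; the two parts
are combined by `add_le_rpow`. -/
lemma cost_roundedLoad_le (hf : IsSmoothCost p f) (hO : 0 < O) (h0 : f 0 ≤ O)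
    {x : Allocation n m r} (hcost : f (allocLoad N jobs x) ≤ O) :
    f (roundedLoad f N O jobs x) ≤ (4 : ℝ) ^ p * O := by
  have hm : 1 ≤ m := NeZero.pos m
  have hτ : (0 : Fin m → ℝ) ≤ fun i => threshold f O i / m := fun i =>
    div_nonneg (threshold_pos _ _ _).le (Nat.cast_nonneg _)
  have hΛ := allocLoad_nonneg (N := N) (jobs := jobs) x
  have h1 : f (roundedLoad f N O jobs x)
      ≤ f ((2 : ℝ) • allocLoad N jobs x + fun i => threshold f O i / m) :=
    hf.mono _ _ (fun i => (roundedLoad_pos x i).le) fun i => roundedLoad_le x i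
  have h2 := hf.add_le_rpow (smul_nonneg (zero_le_two (α := ℝ)) hΛ) hτ
  have h3 := hf.scale 2 _ one_le_two hΛ
  have h4 := cost_average_threshold_le hf hO h0 hm
  have h5 : (2 : ℝ) ≤ 2 ^ p := by
    conv_lhs => rw [← Real.rpow_one 2]
    exact Real.rpow_le_rpow_of_exponent_le one_le_two hf.one_le
  have h6 : (4 : ℝ) ^ p = 2 ^ p * 2 ^ p := by
    rw [← Real.mul_rpow two_pos.le two_pos.le]; norm_num
  have h7 : (2 : ℝ) ^ p * f (allocLoad N jobs x) ≤ 2 ^ p * O :=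
    mul_le_mul_of_nonneg_left hcost (by positivity)
  rw [h6]
  have h8 : f ((2 : ℝ) • allocLoad N jobs x) + f (fun i => threshold f O i / m)
      ≤ 2 * (2 ^ p * O) := by nlinarith
  refine h1.trans (h2.trans ?_)
  calc 1 / 2 * (2 : ℝ) ^ p * _ ≤ 1 / 2 * (2 : ℝ) ^ p * (2 * (2 ^ p * O)) :=
        mul_le_mul_of_nonneg_left h8 (by positivity)
    _ = _ := by ring

/-- The facility that an allocation uses for a job. -/
noncomputable def allocFacility (f : (Fin m → ℝ) → ℝ)
    (N : Fin m → Seminorm ℝ (Fin n × Fin r → ℝ))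
    (O : ℝ) (jobs : Fin n → Job m r) (x : Allocation n m r) (j : Fin n) : Facility n m :=
  ((x j).1, loadScale f N O jobs x (x j).1,
    ⟨sizeClass n (soloLoad N (jobs j) (x j).1) (roundedLoad f N O jobs x (x j).1),
      Nat.lt_succ_of_le (Nat.findGreatest_le _)⟩)

lemma alloc_mem_active {x : Allocation n m r} (hx : Feasible jobs x) {j : Fin n}
    (ha : (activeMachines f (jobs j)).Nonempty) :
    (x j).1 ∈ activeMachines f (jobs j) ∧ ¬ IsFree f (x j).1 := by
  have h := (mem_activeMachines ha.choose_spec).1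
  have h1 : jobs j (x j).1 (bestWay (jobs j) (x j).1) ≠ ⊤ :=
    ne_top_of_le_ne_top (hx j) (bestWay_le _ _ _)
  refine ⟨?_, fun hfree => h ⟨_, h1, Or.inl hfree⟩⟩
  rw [activeMachines, if_neg h]
  exact Finset.mem_filter.2 ⟨Finset.mem_univ _, h1⟩

/-- An allocation uses a facility for at most as many jobs as a copy of it can process. -/
lemma card_allocFacility_le (hf : IsSmoothCost p f) (hN : ∀ i, IsMonotoneSymmetricNorm (N i))
    (hn : 1 ≤ n) (hO : 0 < O) (h0 : f 0 ≤ O) {x : Allocation n m r} (hx : Feasible jobs x)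
    (hcost : f (allocLoad N jobs x) ≤ O) (F : Facility n m) (A : Finset (Fin n))
    (hA : ∀ j ∈ A, (activeMachines f (jobs j)).Nonempty ∧ allocFacility f N O jobs x j = F) :
    A.card ≤ facCap N F := by
  rcases A.eq_empty_or_nonempty with rfl | ⟨j₀, hj₀⟩
  · simp
  have hAn : A.card ≤ n := by simpa using Finset.card_le_univ A
  have hmach : ∀ j ∈ A, (x j).1 = F.1 := fun j hj => by rw [← (hA j hj).2]; rfl
  have hfree : ¬ IsFree f F.1 := by
    rw [← hmach j₀ hj₀]; exact (alloc_mem_active hx (hA j₀ hj₀).1).2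
  -- The last class gives no lower bound on the sizes, but its capacity is `n`. In the other classes
  -- maximality gives solo loads above `T / 2 ^ (s + 1)`, and the norm bound `T` limits their
  -- number.
  rcases (Nat.lt_succ_iff.1 F.2.2.2).lt_or_eq with hs | hs
  swap
  · rw [facCap, sizeCap_eq (hN F.1)]
    · exact hAn
    · rw [hs]
      exact (Nat.le_pow_clog one_lt_two n).trans (Nat.pow_le_pow_right two_pos (Nat.le_succ _))
  have hr : (Nonempty (Fin n × Fin r)) := ⟨(⟨0, hn⟩, 0)⟩
  have hpos := (hN F.1).sizeNorm_one_pos hr.some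
  set T := roundedLoad f N O jobs x F.1 with hT
  have hTpos : 0 < T := roundedLoad_pos x F.1
  refine le_sizeCap hAn ?_
  have h1 := mul_sizeNorm_le_allocLoad (N := N) (jobs := jobs) hN x hmach
    (c := T / (2 ^ ((F.2.2 : ℕ) + 1) * sizeNorm (N F.1) 1)) (by positivity) fun j hj => by
      have hcl : (F.2.2 : ℕ) = sizeClass n (soloLoad N (jobs j) F.1) T := by
        rw [← (hA j hj).2, hT, ← hmach j hj]; rfl
      have h2 := Nat.findGreatest_is_greatest (P := fun s => soloLoad N (jobs j) F.1 * 2 ^ s ≤ T)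
        (k := (F.2.2 : ℕ) + 1) (by rw [hcl]; exact Nat.lt_succ_self _) hs
      rw [not_le] at h2
      rw [div_le_iff₀ (by positivity)]
      have h3 : (jobs j F.1 (bestWay (jobs j) F.1)).toReal ≤ (jobs j F.1 (x j).2).toReal := by
        refine ENNReal.toReal_mono ?_ (bestWay_le _ _ _)
        rw [← hmach j hj]
        exact hx j
      have h4 : soloLoad N (jobs j) F.1 * 2 ^ ((F.2.2 : ℕ) + 1)
          ≤ (jobs j F.1 (x j).2).toReal * (2 ^ ((F.2.2 : ℕ) + 1) * sizeNorm (N F.1) 1) := by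
        rw [soloLoad, mul_assoc, mul_comm (sizeNorm (N F.1) 1)]
        exact mul_le_mul_of_nonneg_right h3 (by positivity)
      linarith
  have h2 := h1.trans (allocLoad_le_roundedLoad hf hO h0 hcost hfree)
  rw [div_mul_eq_mul_div, div_le_iff₀ (by positivity)] at h2
  exact le_of_mul_le_mul_left h2 hTpos

end OfflineSolution

/-! ### The charge of an offline allocation -/

section OfflineBound

variable {n m r : ℕ} [NeZero m] [NeZero r] {p : ℝ} {f : (Fin m → ℝ) → ℝ}
  {N : Fin m → Seminorm ℝ (Fin n × Fin r → ℝ)} {O : ℝ} {jobs : Fin n → Job m r}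

/-- The total boost of the facilities of one scale on one machine. -/
noncomputable def boostBudget (p : ℝ) (n m : ℕ) : ℝ :=
  (Nat.clog 2 n + 1) * p + 48 * p * Real.log (2 * scaleCount m) * logBudget n m

lemma log_two_scaleCount_nonneg : 0 ≤ Real.log (2 * scaleCount m) := by
  have hM : (1 : ℝ) ≤ scaleCount m := by exact_mod_cast (scaleCount_pos (m := m))
  exact Real.log_nonneg (by linarith)

/-- The offline solution uses one scale per machine, so only size classes are summed and the
logarithms telescope. -/
lemma sum_boost_le (hp : 1 ≤ p) (hN : ∀ i, IsMonotoneSymmetricNorm (N i)) (hn : 1 ≤ n)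
    (c : Fin m → Fin (scaleBound m + 1)) (i : Fin m) :
    ∑ F ∈ (Finset.univ.filter fun F : Facility n m => F.2.1 = c F.1 ∧ p ≤ facCap N F).filter
        (fun F => F.1 = i),
      ((facParams p N).p + 2 * (facParams p N).B F * Real.log (1 / (facParams p N).y₀))
      ≤ boostBudget p n m := by
  classical
  have hL := log_two_scaleCount_nonneg (m := m)
  set ℓ : Facility n m → ℝ := fun F =>
    Real.log (4 * facCap N F / (1 / (2 * scaleCount m) * fallbackCap N F)) with hℓ
  have hℓ0 : ∀ F, 0 ≤ ℓ F := fun F => log_ratio_nonneg hN hn F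
  have hterm : ∀ F ∈ (Finset.univ.filter fun F : Facility n m =>
      F.2.1 = c F.1 ∧ p ≤ facCap N F).filter (fun F => F.1 = i),
      (facParams p N).p + 2 * (facParams p N).B F * Real.log (1 / (facParams p N).y₀)
        = p + 48 * p * Real.log (2 * scaleCount m) * ℓ F := by
    intro F hF
    have hF' := (Finset.mem_filter.1 (Finset.mem_filter.1 hF).1).2.2
    simp only [facParams, max_eq_left hF', one_div_one_div, hℓ]
    ring
  rw [Finset.sum_congr rfl hterm]
  have hsub : (Finset.univ.filter fun F : Facility n m =>
      F.2.1 = c F.1 ∧ p ≤ facCap N F).filter (fun F => F.1 = i)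
      ⊆ Finset.univ.image fun s => ((i, c i, s) : Facility n m) := by
    intro F hF
    obtain ⟨h1, h2⟩ := Finset.mem_filter.1 hF
    have h3 := (Finset.mem_filter.1 h1).2.1
    refine Finset.mem_image.2 ⟨F.2.2, Finset.mem_univ _, ?_⟩
    rw [← h2, ← h3]
  refine (Finset.sum_le_sum_of_subset_of_nonneg hsub fun F _ _ => ?_).trans ?_
  · have := hℓ0 F
    positivity
  rw [Finset.sum_image fun s _ s' _ h => (Prod.mk.inj (Prod.mk.inj h).2).2,
    Finset.sum_add_distrib, ← Finset.mul_sum, boostBudget]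
  refine add_le_add (by simp) (mul_le_mul_of_nonneg_left (sum_log_ratio_le hN hn i (c i)) ?_)
  positivity

open Classical in
/-- An allocation of cost at most `O` as an offline solution. -/
noncomputable def offlineSolution (hf : IsSmoothCost p f)
    (hN : ∀ i, IsMonotoneSymmetricNorm (N i)) (hn : 1 ≤ n) (hO : 0 < O) (h0 : f 0 ≤ O)
    {x : Allocation n m r} (hx : Feasible jobs x) (hcost : f (allocLoad N jobs x) ≤ O) :
    Offline (facParams p N) (facLoad f O) (jobRequests p f N O jobs) n (boostBudget p n m)
      ((Nat.clog 2 n + 1) * p) (roundedLoad f N O jobs x) where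
  large := (Finset.univ.filter fun j : Fin n => (activeMachines f (jobs j)).Nonempty ∧
    p ≤ facCap N (allocFacility f N O jobs x j)).map Fin.valEmbedding
  small := (Finset.univ.filter fun j : Fin n => (activeMachines f (jobs j)).Nonempty ∧
    ¬ p ≤ facCap N (allocFacility f N O jobs x j)).map Fin.valEmbedding
  cover j hj ha := by
    have ha' : (activeMachines f (jobs ⟨j, hj⟩)).Nonempty := by
      rw [jobRequests, dif_pos hj] at ha; exact ha
    by_cases h : p ≤ facCap N (allocFacility f N O jobs x ⟨j, hj⟩)
    · exact Finset.mem_union_left _ (Finset.mem_map.2 ⟨⟨j, hj⟩, by simp [ha', h], rfl⟩)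
    · exact Finset.mem_union_right _ (Finset.mem_map.2
        ⟨⟨j, hj⟩, Finset.mem_filter.2 ⟨Finset.mem_univ _, ha', h⟩, rfl⟩)
  subset j hj := by
    rcases Finset.mem_union.1 hj with h | h <;> obtain ⟨k, hk, rfl⟩ := Finset.mem_map.1 h <;>
      refine ⟨k.2, ?_⟩ <;> rw [Fin.valEmbedding_apply, jobRequests_coe] <;>
      exact (Finset.mem_filter.1 hk).2.1
  disjoint := by
    rw [Finset.disjoint_map, Finset.disjoint_filter]
    exact fun j _ h h' => h'.2 h.2
  fac j := if h : j < n then allocFacility f N O jobs x ⟨j, h⟩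
    else allocFacility f N O jobs x ⟨0, hn⟩
  mach j := if h : j < n then (x ⟨j, h⟩).1 else 0
  coord F := F.1
  used := Finset.univ.filter fun F : Facility n m =>
    F.2.1 = loadScale f N O jobs x F.1 ∧ p ≤ facCap N F
  T_pos i := roundedLoad_pos x i
  w_eq F hF := by
    have h := (Finset.mem_filter.1 hF).2.1
    rw [facLoad, facSize, h, roundedLoad]
  fac_used j hj := by
    obtain ⟨k, hk, rfl⟩ := Finset.mem_map.1 hj
    rw [Fin.valEmbedding_apply, dif_pos k.2]
    exact Finset.mem_filter.2 ⟨Finset.mem_univ _, rfl, (Finset.mem_filter.1 hk).2.2⟩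
  fac_mem j hj := by
    obtain ⟨k, hk, rfl⟩ := Finset.mem_map.1 hj
    obtain ⟨_, ha, hp⟩ := Finset.mem_filter.1 hk
    rw [Fin.valEmbedding_apply, dif_pos k.2, jobRequests_coe]
    have h1 := alloc_mem_active hx ha
    exact Finset.mem_filter.2 ⟨Finset.mem_univ _, h1.1, (soloLoad_le_allocLoad hN hx k).trans
      (allocLoad_le_roundedLoad hf hO h0 hcost h1.2), rfl, hp⟩
  capacity F _ := by
    rw [Finset.filter_map, Finset.card_map]
    refine le_trans ?_ (le_max_left (facCap N F : ℝ) p)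
    refine Nat.cast_le.2 (card_allocFacility_le hf hN hn hO h0 hx hcost F _ fun j hj => ?_)
    obtain ⟨h1, h2⟩ := Finset.mem_filter.1 hj
    rw [Function.comp_apply, Fin.valEmbedding_apply, dif_pos j.2] at h2
    exact ⟨(Finset.mem_filter.1 h1).2.1, h2⟩
  mach_mem j hj := by
    obtain ⟨k, hk, rfl⟩ := Finset.mem_map.1 hj
    rw [Fin.valEmbedding_apply, dif_pos k.2, jobRequests_coe]
    exact (alloc_mem_active hx (Finset.mem_filter.1 hk).2.1).1
  u_le j hj := by
    obtain ⟨k, hk, rfl⟩ := Finset.mem_map.1 hj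
    rw [Fin.valEmbedding_apply, dif_pos k.2, jobRequests_coe]
    exact (soloLoad_le_allocLoad hN hx k).trans (allocLoad_le_roundedLoad hf hO h0 hcost
      (alloc_mem_active hx (Finset.mem_filter.1 hk).2.1).2)
  boost_le i := by convert sum_boost_le hf.one_le hN hn (loadScale f N O jobs x) i
  small_le i := by
    -- A facility of capacity below `p` is used for fewer than `p` jobs, each at most one full load:
    -- at most `p` for every size class.
    rw [Finset.filter_map, Finset.sum_map]
    set A := (Finset.univ.filter fun j : Fin n => (activeMachines f (jobs j)).Nonempty ∧
      ¬ p ≤ facCap N (allocFacility f N O jobs x j)).filter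
        ((fun j => (if h : j < n then (x ⟨j, h⟩).1 else 0) = i) ∘ Fin.valEmbedding) with hA
    have hmem : ∀ j ∈ A, (activeMachines f (jobs j)).Nonempty ∧
        ¬ p ≤ facCap N (allocFacility f N O jobs x j) ∧ (x j).1 = i := by
      intro j hj
      obtain ⟨h1, h2⟩ := Finset.mem_filter.1 hj
      rw [Function.comp_apply, Fin.valEmbedding_apply, dif_pos j.2] at h2
      exact ⟨(Finset.mem_filter.1 h1).2.1, (Finset.mem_filter.1 h1).2.2, h2⟩
    have h1 : ∑ j ∈ A, (jobRequests p f N O jobs (Fin.valEmbedding j)).u i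
        / roundedLoad f N O jobs x i ≤ ∑ j ∈ A, (1 : ℝ) := by
      refine Finset.sum_le_sum fun j hj => ?_
      obtain ⟨ha, _, hi⟩ := hmem j hj
      subst hi
      rw [div_le_one (roundedLoad_pos x _), Fin.valEmbedding_apply, jobRequests_coe]
      exact (soloLoad_le_allocLoad hN hx j).trans (allocLoad_le_roundedLoad hf hO h0 hcost
        (alloc_mem_active hx ha).2)
    refine h1.trans ?_
    have h2 : A.card = ∑ s : Fin (Nat.clog 2 n + 1),
        (A.filter fun j => (allocFacility f N O jobs x j).2.2 = s).card :=
      Finset.card_eq_sum_card_fiberwise fun _ _ => Finset.mem_univ _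
    rw [Finset.sum_const, nsmul_one, h2]
    push_cast
    have h3 : ∀ s : Fin (Nat.clog 2 n + 1),
        ((A.filter fun j => (allocFacility f N O jobs x j).2.2 = s).card : ℝ) ≤ p := by
      intro s
      set F : Facility n m := (i, loadScale f N O jobs x i, s) with hF
      have hFj : ∀ j ∈ A.filter fun j => (allocFacility f N O jobs x j).2.2 = s,
          allocFacility f N O jobs x j = F := by
        intro j hj
        obtain ⟨h1, h2⟩ := Finset.mem_filter.1 hj
        obtain ⟨_, _, hi⟩ := hmem j h1
        rw [hF, ← h2, ← hi]
        rfl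
      rcases (A.filter fun j => (allocFacility f N O jobs x j).2.2 = s).eq_empty_or_nonempty
        with he | ⟨j₀, hj₀⟩
      · rw [he, Finset.card_empty, Nat.cast_zero]
        exact hf.p_pos.le
      · have h4 := card_allocFacility_le hf hN hn hO h0 hx hcost F _ fun j hj =>
          ⟨(hmem j (Finset.mem_filter.1 hj).1).1, hFj j hj⟩
        have h5 := (hmem j₀ (Finset.mem_filter.1 hj₀).1).2.1
        rw [hFj j₀ hj₀] at h5
        exact (Nat.cast_le.2 h4).trans (not_le.1 h5).le
    refine (Finset.sum_le_sum fun s _ => h3 s).trans (le_of_eq ?_)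
    simp

/-- The expected cost of the fractional algorithm, in terms of an allocation of cost at most `O`. -/
theorem meanCost_core_le (hf : IsSmoothCost p f) (hN : ∀ i, IsMonotoneSymmetricNorm (N i))
    (hn : 1 ≤ n) (hO : 0 < O) (h0 : f 0 ≤ O) {x : Allocation n m r} (hx : Feasible jobs x)
    (hcost : f (allocLoad N jobs x) ≤ O) {γ : ℝ} (hγ1 : 1 ≤ γ)
    (hγ : 2 * (boostBudget p n m + (Nat.clog 2 n + 1) * p) ≤ γ)
    {s : LoadState m (Facility n m)}
    (hs : s = fracRun (facParams p N) f (facLoad f O) (jobRequests p f N O jobs) n) :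
    meanCost f (facLoad f O) s.D s.z ≤ (18 * γ * p) ^ p * O := by
  have hset := setting_core hf hN hn O jobs
  have hp := hf.one_le
  have hM : (1 : ℝ) ≤ scaleCount m := by exact_mod_cast (scaleCount_pos (m := m))
  have hy : (facParams p N).y₀ ≤ 1 := by
    change 1 / (2 * (scaleCount m : ℝ)) ≤ 1
    rw [div_le_one (by positivity)]
    linarith
  have h1 := meanCost_fracRun_le_offline hf hset.w_nonneg hset.valid hy hset.u_nonneg
    (offlineSolution hf hN hn hO h0 hx hcost) hγ1 hγ
  rw [← hs] at h1
  have hγp : 1 ≤ γ * p := one_le_mul_of_one_le_of_one_le hγ1 hp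
  have h2 := hf.scale (4 * γ * p) (roundedLoad f N O jobs x) (by nlinarith)
    fun i => (roundedLoad_pos x i).le
  have h3 := cost_roundedLoad_le hf hO h0 hcost
  have h4 : (4 * γ * p) ^ p * f (roundedLoad f N O jobs x) ≤ (16 * γ * p) ^ p * O := by
    refine (mul_le_mul_of_nonneg_left h3 (by positivity)).trans (le_of_eq ?_)
    rw [← mul_assoc, ← Real.mul_rpow (by positivity) (by norm_num)]
    congr 2
    ring
  have h5 : (2 : ℝ) ≤ (2 * γ * p) ^ p := by
    calc (2 : ℝ) ≤ 2 * γ * p := by nlinarith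
      _ = (2 * γ * p) ^ (1 : ℝ) := (Real.rpow_one _).symm
      _ ≤ _ := Real.rpow_le_rpow_of_exponent_le (by nlinarith) hp
  -- `16 = 4 * 4` comes from the absorption and from the rounded loads, and the `2` pays for `2 * f
  -- 0`.
  have h6 : (16 * γ * p) ^ p + (2 * γ * p) ^ p ≤ (18 * γ * p) ^ p := by
    refine (Real.add_rpow_le_rpow_add (by positivity) (by positivity) hp).trans (le_of_eq ?_)
    congr 1
    ring
  calc meanCost f (facLoad f O) s.D s.z ≤ 2 * O + (16 * γ * p) ^ p * O := by linarith
    _ ≤ ((16 * γ * p) ^ p + (2 * γ * p) ^ p) * O := by nlinarith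
    _ ≤ _ := mul_le_mul_of_nonneg_right h6 hO.le

end OfflineBound

/-! ### The expected cost of fallbacks at one facility -/

section FallbackCost

variable {ι : Type} [Fintype ι] [DecidableEq ι] {m : ℕ} {p : ℝ} {f : (Fin m → ℝ) → ℝ}
  {w : ι → Fin m → ℝ}

lemma IsSmoothCost.two_le_rpow (hf : IsSmoothCost p f) : (2 : ℝ) ≤ 2 ^ p := by
  conv_lhs => rw [← Real.rpow_one 2]
  exact Real.rpow_le_rpow_of_exponent_le one_le_two hf.one_le

lemma smul_le_openLoad (hw : ∀ F, 0 ≤ w F) {D : Fin m → ℝ} (hD : 0 ≤ D) (a : ι → ℕ) (F : ι) :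
    (a F : ℝ) • w F ≤ openLoad w D a :=
  (Finset.single_le_sum (f := fun F => (a F : ℝ) • w F)
    (fun G _ => smul_nonneg (Nat.cast_nonneg _) (hw G)) (Finset.mem_univ F)).trans
    (le_add_of_nonneg_left hD)

/-- If a facility is open at least once in expectation, then it pays for its expectation. -/
lemma cost_smul_le_meanCost (hf : IsSmoothCost p f) (hw : ∀ F, 0 ≤ w F) {D : Fin m → ℝ}
    (hD : 0 ≤ D) {z : ι → ℝ} (hz : 0 ≤ z) {F : ι} (h1 : 1 ≤ z F) :
    f (z F • w F) ≤ 2 ^ p * meanCost f w D z := by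
  have hpt : ∀ U : ι → I, f (z F • w F) ≤ 2 ^ p * f (openLoad w D (copies z U)) := by
    intro U
    have hX := openLoad_nonneg hw hD (copies z U)
    refine le_trans ?_ (hf.scale 2 _ one_le_two hX)
    refine hf.mono _ _ (smul_nonneg (hz F) (hw F)) ?_
    have hc : z F ≤ 2 * (copies z U F : ℝ) := by
      have h2 : (1 : ℝ) ≤ copies z U F := by
        exact_mod_cast Nat.le_floor (by push_cast; linarith [(U F).2.1])
      have h3 := Nat.lt_floor_add_one (z F + U F)
      have h4 := (U F).2.1
      change z F + U F < (copies z U F : ℝ) + 1 at h3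
      linarith
    calc z F • w F ≤ (2 * (copies z U F : ℝ)) • w F := smul_le_smul_of_nonneg_right hc (hw F)
      _ = (2 : ℝ) • (copies z U F : ℝ) • w F := by rw [smul_smul]
      _ ≤ _ := smul_le_smul_of_nonneg_left (smul_le_openLoad hw hD _ F) zero_le_two
  have := integral_mono (μ := (volume : Measure (ι → I))) (integrable_const _)
    ((integrable_meanCost hz D).const_mul _) hpt
  rw [integral_const_mul, integral_const] at this
  simpa [meanCost] using this

/-- The expected cost of the fallbacks at a facility, given their moments. -/
lemma integral_cost_smul_le (hf : IsSmoothCost p f) (hw : ∀ F, 0 ≤ w F) {D : Fin m → ℝ}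
    (hD : 0 ≤ D) {z : ι → ℝ} (hz : 0 ≤ z) {F : ι} {b : (ι → I) → ℝ} (hb : IsFinitary b)
    (hb0 : ∀ U, 0 ≤ b U) (hmom : ∫ U, b U ^ p ≤ z F ^ p) {c : ℝ} (hc : f (w F) ≤ c) :
    ∫ U, f (b U • w F) ≤ 2 * c + 2 * (2 ^ p * meanCost f w D z) := by
  have hp := hf.p_pos
  -- Normalizing by `y` covers both regimes: a single load costs at most `c`, and for `z F ≥ 1` the
  -- open copies already pay for `z F` loads.
  set y := max (z F) 1 with hy
  have hy1 : 1 ≤ y := le_max_right _ _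
  have hy0 : 0 < y := one_pos.trans_le hy1
  have hc0 : 0 ≤ c := (hf.nonneg _ (hw F)).trans hc
  have hG0 : 0 ≤ meanCost f w D z :=
    integral_nonneg fun U => hf.nonneg _ (openLoad_nonneg hw hD _)
  have hyw : f (y • w F) ≤ c + 2 ^ p * meanCost f w D z := by
    have hE : (0 : ℝ) < 2 ^ p := by positivity
    rcases le_total (z F) 1 with h | h
    · rw [hy, max_eq_right h, one_smul]
      have := mul_nonneg hE.le hG0
      linarith
    · rw [hy, max_eq_left h]
      linarith [cost_smul_le_meanCost hf hw hD hz h]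
  have hpt : ∀ U, f (b U • w F) ≤ (1 + (y ^ p)⁻¹ * b U ^ p) * f (y • w F) := by
    intro U
    have h1 := hf.scale_mul_le (div_nonneg (hb0 U) hy0.le) (smul_nonneg hy0.le (hw F))
    rw [smul_smul, div_mul_cancel₀ _ hy0.ne', Real.div_rpow (hb0 U) hy0.le] at h1
    rwa [inv_mul_eq_div]
  have hint : Integrable fun U => b U ^ p := (hb.comp fun t => t ^ p).integrable
  have hR : Integrable fun U => 1 + (y ^ p)⁻¹ * b U ^ p :=
    (integrable_const (1 : ℝ)).add (hint.const_mul (y ^ p)⁻¹)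
  have h2 := integral_mono (μ := (volume : Measure (ι → I)))
    (hb.comp fun t => f (t • w F)).integrable (hR.mul_const _) hpt
  refine h2.trans ?_
  rw [integral_mul_const]
  have h3 : ∫ U, (1 + (y ^ p)⁻¹ * b U ^ p) ≤ 2 := by
    rw [integral_add (integrable_const _) (hint.const_mul _), integral_const_mul]
    have h4 : (y ^ p)⁻¹ * ∫ U, b U ^ p ≤ 1 := by
      rw [inv_mul_le_one₀ (by positivity)]
      exact hmom.trans (Real.rpow_le_rpow (hz F) (le_max_left _ _) hp.le)
    simp only [integral_const, probReal_univ, smul_eq_mul, mul_one]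
    linarith
  calc _ ≤ 2 * f (y • w F) := mul_le_mul_of_nonneg_right h3
        (hf.nonneg _ (smul_nonneg hy0.le (hw F)))
    _ ≤ _ := by linarith

end FallbackCost

/-! ### The guarantee for a known positive bound of the optimum -/

section CoreBound

variable {n m r : ℕ} [NeZero m] [NeZero r] {p : ℝ} {f : (Fin m → ℝ) → ℝ}
  {N : Fin m → Seminorm ℝ (Fin n × Fin r → ℝ)} {O : ℝ} {jobs : Fin n → Job m r}

lemma cost_facLoad_le (hf : IsSmoothCost p f) (hO : 0 < O) (h0 : f 0 ≤ O) (F : Facility n m) :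
    f (facLoad f O F) ≤ 2 * O := by
  refine (hf.mono _ _ (facLoad_nonneg F) ?_).trans (cost_threshold_le hf hO h0 F.1)
  refine Pi.single_le_single.2 (div_le_self (threshold_pos _ _ _).le (one_le_pow₀ one_le_two))

/-- The cost of the fallback loads, averaged over the facilities. -/
lemma cost_fallback_le (hf : IsSmoothCost p f) {b : Facility n m → ℝ} (hb : 0 ≤ b) :
    f (∑ F, ((1 / 2) ^ gapBound n m * (1 + b F)) • facLoad f O F)
      ≤ ∑ F : Facility n m, 1 / (Fintype.card (Facility n m) : ℝ) *
        (1 / 2 * 2 ^ p * (f (facLoad f O F) + f (b F • facLoad f O F))) := by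
  have hw := facLoad_nonneg (f := f) (O := O) (n := n)
  have hcard : (Fintype.card (Facility n m) : ℝ) ≤ 2 ^ gapBound n m := by
    have h1 := card_facility_le (n := n) (m := m)
    have h2 : Fintype.card (Facility n m) = scaleCount m * (Nat.clog 2 n + 1) := by
      simp [scaleCount, mul_assoc]
    have h3 : Fintype.card (Facility n m) ≤ 2 ^ gapBound n m := by rw [h2]; omega
    exact_mod_cast h3
  have hne : Nonempty (Facility n m) := ⟨(0, 0, 0)⟩
  have hpos : (0 : ℝ) < Fintype.card (Facility n m) := by exact_mod_cast Fintype.card_pos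
  have h1b : ∀ F, 0 ≤ 1 + b F := fun F => add_nonneg zero_le_one (hb F)
  -- By the choice of `gapBound` the coefficients lie below uniform weights over the facilities.
  -- Jensen's inequality then replaces the sum of the loads by an average of costs.
  have h1 : f (∑ F, ((1 / 2) ^ gapBound n m * (1 + b F)) • facLoad f O F)
      ≤ f (∑ F, (1 / (Fintype.card (Facility n m) : ℝ)) • (1 + b F) • facLoad f O F) := by
    refine hf.mono _ _ (Finset.sum_nonneg fun F _ =>
      smul_nonneg (mul_nonneg (by positivity) (h1b F)) (hw F)) (Finset.sum_le_sum fun F _ => ?_)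
    rw [smul_smul]
    refine smul_le_smul_of_nonneg_right (mul_le_mul_of_nonneg_right ?_ (h1b F)) (hw F)
    rw [one_div_pow]
    exact one_div_le_one_div_of_le hpos hcard
  refine h1.trans ?_
  have h2 := hf.sum_le_average Finset.univ Finset.univ_nonempty
    (fun F : Facility n m => (1 + b F) • facLoad f O F) fun F _ => smul_nonneg (h1b F) (hw F)
  rw [Finset.card_univ] at h2
  refine h2.trans (Finset.sum_le_sum fun F _ => mul_le_mul_of_nonneg_left ?_ (by positivity))
  rw [add_smul, one_smul]
  exact hf.add_le_rpow (hw F) (smul_nonneg (hb F) (hw F))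

/-- The expected cost of the online algorithm that knows an upper bound of the optimal cost. -/
theorem integral_cost_core_le (hf : IsSmoothCost p f) (hN : ∀ i, IsMonotoneSymmetricNorm (N i))
    (hn : 1 ≤ n) (hO : 0 < O) (h0 : f 0 ≤ O) {x : Allocation n m r} (hx : Feasible jobs x)
    (hcost : f (allocLoad N jobs x) ≤ O) {γ : ℝ} (hγ1 : 1 ≤ γ)
    (hγ : 2 * (boostBudget p n m + (Nat.clog 2 n + 1) * p) ≤ γ) :
    ∫ U, cost f N jobs (coreAlloc p f N O jobs U) ≤ (170000 * γ * p) ^ p * O := by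
  have hset := setting_core hf hN hn O jobs
  have hp := hf.one_le
  have hp0 := hf.p_pos
  set s := fracRun (facParams p N) f (facLoad f O) (jobRequests p f N O jobs) n with hs
  set w : Facility n m → Fin m → ℝ := facLoad f O with hw
  have hw0 : ∀ F, 0 ≤ w F := facLoad_nonneg
  have hD0 : 0 ≤ s.D := fracRun_D_nonneg hset.smooth hset.w_nonneg hset.valid hset.u_nonneg n
  have hz0 : 0 ≤ s.z := hset.z_nonneg n
  set G := meanCost f w s.D s.z with hG
  have hGle : G ≤ (18 * γ * p) ^ p * O := meanCost_core_le hf hN hn hO h0 hx hcost hγ1 hγ hs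
  have hG0 : 0 ≤ G := integral_nonneg fun U => hf.nonneg _ (openLoad_nonneg hw0 hD0 _)
  set E : ℝ := 2 ^ p with hE
  have hE2 : 2 ≤ E := hf.two_le_rpow
  set b : (Facility n m → I) → Facility n m → ℝ := fun U F =>
    (Setting.badCount (facParams p N) f w (jobRequests p f N O jobs) n F U : ℝ)
      / fallbackCap N F with hb
  have hbfin : ∀ F, IsFinitary fun U => b U F := fun F =>
    (Setting.isFinitary_badCount (P := facParams p N) (f := f) (w := w)
      (q := jobRequests p f N O jobs) n F).comp fun c : ℕ => (c : ℝ) / fallbackCap N F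
  have hb0 : ∀ U, 0 ≤ b U := fun U F =>
    div_nonneg (Nat.cast_nonneg _) (fallbackCap_pos hN hn F).le
  have hmom : ∀ F, ∫ U, b U F ^ p ≤ s.z F ^ p := fun F =>
    hset.integral_badCount_le n F (fallbackCap_pos hN hn F) le_rfl
  have hbad : ∀ F, ∫ U, f (b U F • w F) ≤ 4 * O + 2 * (E * G) := fun F => by
    have := integral_cost_smul_le hf hw0 hD0 hz0 (hbfin F) (fun U => hb0 U F) (hmom F)
      (cost_facLoad_le hf hO h0 F)
    linarith
  set Z : (Facility n m → I) → Fin m → ℝ := fun U =>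
    greedyRun (facParams p N) f w (jobRequests p f N O jobs) U n with hZ
  set X : (Facility n m → I) → Fin m → ℝ := fun U => openLoad w s.D (copies s.z U) with hX
  have hX0 : ∀ U, 0 ≤ X U := fun U => openLoad_nonneg hw0 hD0 _
  have hZ0 : ∀ U, 0 ≤ Z U := fun U => hset.greedyRun_nonneg U n
  have hW0 : ∀ U, 0 ≤ ∑ F, ((1 / 2) ^ gapBound n m * (1 + b U F)) • w F := fun U =>
    Finset.sum_nonneg fun F _ => smul_nonneg
      (mul_nonneg (by positivity) (add_nonneg zero_le_one (hb0 U F))) (hw0 F)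
  have hZX : ∀ U, f (Z U) ≤ 2 * O + 1152 ^ p * f (X U) := by
    intro U
    have h1 := hset.greedyRun_cost_le U n
    have h2 : f ((1152 : ℝ) • openLoad w 0 (copies s.z U)) ≤ f ((1152 : ℝ) • X U) :=
      hf.mono _ _ (smul_nonneg (by norm_num) (openLoad_nonneg hw0 le_rfl _))
        (smul_le_smul_of_nonneg_left (openLoad_mono hw0 hD0 le_rfl) (by norm_num))
    have h3 := hf.scale 1152 _ (by norm_num) (hX0 U)
    change f (Z U) ≤ 2 * f 0 + f ((1152 : ℝ) • openLoad w 0 (copies s.z U)) at h1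
    linarith
  set c : ℝ := 1 / (Fintype.card (Facility n m) : ℝ) with hc
  set V : (Facility n m → I) → ℝ := fun U =>
    ∑ F : Facility n m, c * (1 / 2 * E * (f (w F) + f (b U F • w F))) with hV
  have hpt : ∀ U, cost f N jobs (coreAlloc p f N O jobs U)
      ≤ (E ^ 3 / 2 * O + E ^ 3 / 4 * (1 + 1152 ^ p) * f (X U)) + E / 2 * V U := by
    intro U
    have h1 : cost f N jobs (coreAlloc p f N O jobs U) ≤ f ((2 : ℝ) • X U + (2 : ℝ) • Z U
        + ∑ F, ((1 / 2) ^ gapBound n m * (1 + b U F)) • w F) := by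
      refine hf.le_of_le_on_nonfree (fun i => apply_nonneg _ _) ?_ fun i hi =>
        norm_loadVector_le hf hN hn ⟨x, hx⟩ U hi hs rfl rfl
      exact add_nonneg (add_nonneg (smul_nonneg zero_le_two (hX0 U))
        (smul_nonneg zero_le_two (hZ0 U))) (hW0 U)
    have h2X := smul_nonneg (zero_le_two (α := ℝ)) (hX0 U)
    have h2Z := smul_nonneg (zero_le_two (α := ℝ)) (hZ0 U)
    have h2 := hf.add_le_rpow (add_nonneg h2X h2Z) (hW0 U)
    have h3 := hf.add_le_rpow h2X h2Z
    have h4 := hf.scale 2 _ one_le_two (hX0 U)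
    have h5 := hf.scale 2 _ one_le_two (hZ0 U)
    have h6 : f (∑ F, ((1 / 2) ^ gapBound n m * (1 + b U F)) • w F) ≤ V U :=
      cost_fallback_le hf (hb0 U)
    have h7 := hZX U
    have h8 : f ((2 : ℝ) • X U + (2 : ℝ) • Z U)
        ≤ 1 / 2 * E * (E * f (X U) + E * (2 * O + 1152 ^ p * f (X U))) := by
      refine h3.trans (mul_le_mul_of_nonneg_left (add_le_add h4 (h5.trans ?_)) (by positivity))
      exact mul_le_mul_of_nonneg_left h7 (by positivity)
    calc _ ≤ 1 / 2 * E * (f ((2 : ℝ) • X U + (2 : ℝ) • Z U)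
          + f (∑ F, ((1 / 2) ^ gapBound n m * (1 + b U F)) • w F)) := h1.trans h2
      _ ≤ 1 / 2 * E * (1 / 2 * E * (E * f (X U) + E * (2 * O + 1152 ^ p * f (X U))) + V U) :=
        mul_le_mul_of_nonneg_left (add_le_add h8 h6) (by positivity)
      _ = _ := by ring
  have hXint : Integrable fun U => f (X U) := integrable_meanCost hz0 s.D
  have hFint : ∀ F, Integrable fun U => f (b U F • w F) := fun F =>
    ((hbfin F).comp fun t => f (t • w F)).integrable
  have hVterm : ∀ F, Integrable fun U => c * (1 / 2 * E * (f (w F) + f (b U F • w F))) :=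
    fun F => (((integrable_const _).add (hFint F)).const_mul _).const_mul _
  have hVint : Integrable V := integrable_finsetSum _ fun F _ => hVterm F
  have hne : Nonempty (Facility n m) := ⟨(0, 0, 0)⟩
  have hcpos : (0 : ℝ) < Fintype.card (Facility n m) := by exact_mod_cast Fintype.card_pos
  have hVle : ∫ U, V U ≤ 1 / 2 * E * (6 * O + 2 * (E * G)) := by
    rw [hV, integral_finsetSum _ fun F _ => hVterm F]
    have h1 : ∀ F, ∫ U, c * (1 / 2 * E * (f (w F) + f (b U F • w F)))
        ≤ c * (1 / 2 * E * (6 * O + 2 * (E * G))) := by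
      intro F
      rw [integral_const_mul, integral_const_mul,
        integral_add (integrable_const _) (hFint F)]
      refine mul_le_mul_of_nonneg_left (mul_le_mul_of_nonneg_left ?_ (by positivity))
        (by positivity)
      have h2 := cost_facLoad_le hf hO h0 F
      have h3 := hbad F
      simp only [integral_const, probReal_univ, smul_eq_mul, one_mul]
      linarith
    refine (Finset.sum_le_sum fun F _ => h1 F).trans (le_of_eq ?_)
    rw [Finset.sum_const, Finset.card_univ, nsmul_eq_mul, hc]
    field_simp
  have hcint : Integrable fun U => cost f N jobs (coreAlloc p f N O jobs U) :=
    (isFinitary_coreAlloc.comp fun x => cost f N jobs x).integrable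
  have hRint : Integrable fun U : Facility n m → I =>
      E ^ 3 / 2 * O + E ^ 3 / 4 * (1 + 1152 ^ p) * f (X U) :=
    (integrable_const _).add (hXint.const_mul _)
  have h1 := integral_mono (μ := (volume : Measure (Facility n m → I))) hcint
    (hRint.add (hVint.const_mul (E / 2))) hpt
  have h2 : ∫ U : Facility n m → I, (E ^ 3 / 2 * O + E ^ 3 / 4 * (1 + 1152 ^ p) * f (X U))
      = E ^ 3 / 2 * O + E ^ 3 / 4 * (1 + 1152 ^ p) * G := by
    rw [integral_add (integrable_const _) (hXint.const_mul _),
      integral_const_mul (E ^ 3 / 4 * (1 + 1152 ^ p))]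
    simp only [integral_const, probReal_univ, smul_eq_mul, one_mul]
    rfl
  have h3 : ∫ U, cost f N jobs (coreAlloc p f N O jobs U)
      ≤ (E ^ 3 / 2 * O + E ^ 3 / 4 * (1 + 1152 ^ p) * G)
        + E / 2 * (1 / 2 * E * (6 * O + 2 * (E * G))) := by
    refine h1.trans ?_
    simp only [Pi.add_apply]
    rw [integral_add hRint (hVint.const_mul _), h2, integral_const_mul]
    linarith [mul_le_mul_of_nonneg_left hVle (by positivity : 0 ≤ E / 2)]
  have h1152 : (1 : ℝ) ≤ 1152 ^ p := Real.one_le_rpow (by norm_num) hp0.le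
  have h4 : (E ^ 3 / 2 * O + E ^ 3 / 4 * (1 + 1152 ^ p) * G)
        + E / 2 * (1 / 2 * E * (6 * O + 2 * (E * G))) ≤ E ^ 3 * (1152 ^ p * G + 2 * O) := by
    have h5 : E ^ 2 * O * 2 ≤ E ^ 2 * O * E := mul_le_mul_of_nonneg_left hE2 (by positivity)
    have h6 : E ^ 3 * G * 1 ≤ E ^ 3 * G * 1152 ^ p :=
      mul_le_mul_of_nonneg_left h1152 (by positivity)
    have h7 : 0 ≤ E ^ 3 * O := by positivity
    nlinarith
  have hγp : 1 ≤ γ * p := one_le_mul_of_one_le_of_one_le hγ1 hp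
  have h5 : (2 : ℝ) ≤ (2 * γ * p) ^ p := by
    calc (2 : ℝ) ≤ 2 * γ * p := by nlinarith
      _ = (2 * γ * p) ^ (1 : ℝ) := (Real.rpow_one _).symm
      _ ≤ _ := Real.rpow_le_rpow_of_exponent_le (by nlinarith) hp
  -- `20738 = 1152 * 18 + 2`; the final step uses `8 * 20738 ≤ 170000`.
  have h6 : 1152 ^ p * G + 2 * O ≤ (20738 * γ * p) ^ p * O := by
    have h7 : (1152 : ℝ) ^ p * (18 * γ * p) ^ p + (2 * γ * p) ^ p ≤ (20738 * γ * p) ^ p := by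
      rw [← Real.mul_rpow (by norm_num) (by positivity)]
      refine (Real.add_rpow_le_rpow_add (by positivity) (by positivity) hp).trans (le_of_eq ?_)
      congr 1
      ring
    calc 1152 ^ p * G + 2 * O ≤ 1152 ^ p * ((18 * γ * p) ^ p * O) + (2 * γ * p) ^ p * O :=
          add_le_add (mul_le_mul_of_nonneg_left hGle (by positivity))
            (mul_le_mul_of_nonneg_right h5 hO.le)
      _ = (1152 ^ p * (18 * γ * p) ^ p + (2 * γ * p) ^ p) * O := by ring
      _ ≤ _ := mul_le_mul_of_nonneg_right h7 hO.le
  have h7 : E ^ 3 = (8 : ℝ) ^ p := by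
    rw [hE, pow_succ, pow_two, ← Real.mul_rpow two_pos.le two_pos.le,
      ← Real.mul_rpow (by norm_num) two_pos.le]
    norm_num
  calc _ ≤ E ^ 3 * (1152 ^ p * G + 2 * O) := h3.trans h4
    _ ≤ E ^ 3 * ((20738 * γ * p) ^ p * O) := mul_le_mul_of_nonneg_left h6 (by positivity)
    _ = (8 * (20738 * γ * p)) ^ p * O := by
        rw [h7, ← mul_assoc, Real.mul_rpow (x := 8) (y := 20738 * γ * p) (by norm_num)
          (by positivity)]
    _ ≤ _ := mul_le_mul_of_nonneg_right (Real.rpow_le_rpow (by positivity)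
        (by nlinarith) hp0.le) hO.le

end CoreBound

/-! ### Optimum zero -/

section ZeroCost

variable {n m r : ℕ} [NeZero m] [NeZero r] {p : ℝ} {f : (Fin m → ℝ) → ℝ}
  {N : Fin m → Seminorm ℝ (Fin n × Fin r → ℝ)} {O : ℝ} {jobs : Fin n → Job m r}

/-- By `scale` all multiples of a load vector of cost zero above it cost nothing, and they dominate
every load of machine `i`. -/
lemma isFree_of_cost_zero (hf : IsSmoothCost p f) {y : Fin m → ℝ} (hy : 0 ≤ y) (h : f y ≤ 0)
    {i : Fin m} (hi : 0 < y i) : IsFree f i := by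
  intro t ht
  have h00 : f 0 ≤ 0 := (hf.mono _ _ le_rfl hy).trans h
  have hc : (1 : ℝ) ≤ max 1 (t / y i) := le_max_left _ _
  have h1 := hf.scale (max 1 (t / y i)) y hc hy
  have h2 : (Pi.single i t : Fin m → ℝ) ≤ max 1 (t / y i) • y := by
    intro j
    rcases eq_or_ne j i with rfl | hj
    · rw [Pi.single_eq_same, Pi.smul_apply, smul_eq_mul, ← div_le_iff₀ hi]
      exact le_max_right _ _
    · rw [Pi.single_eq_of_ne hj]
      exact smul_nonneg (zero_le_one.trans hc) (hy j)
  have h3 := hf.mono _ _ (Pi.single_nonneg.2 ht) h2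
  have h4 := mul_nonpos_of_nonneg_of_nonpos
    (Real.rpow_nonneg (zero_le_one.trans hc) p) h
  have h5 := hf.nonneg _ (Pi.single_nonneg.2 ht : (0 : Fin m → ℝ) ≤ Pi.single i t)
  have h6 := hf.nonneg 0 le_rfl
  linarith

/-- If the jobs can be processed for free, then the online algorithm does so. -/
lemma cost_core_of_cost_zero (hf : IsSmoothCost p f) (hN : ∀ i, IsMonotoneSymmetricNorm (N i))
    {x : Allocation n m r} (hx : Feasible jobs x) (hcost : f (allocLoad N jobs x) ≤ 0)
    (U : Facility n m → I) : cost f N jobs (coreAlloc p f N O jobs U) ≤ 0 := by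
  have htriv : ∀ j, ∃ i, IsTrivialOption f (jobs j) i := by
    intro j
    refine ⟨(x j).1, ne_top_of_le_ne_top (hx j) (bestWay_le _ _ _), ?_⟩
    rcases (allocLoad_nonneg (N := N) (jobs := jobs) x (x j).1).lt_or_eq with h | h
    · exact Or.inl (isFree_of_cost_zero hf (allocLoad_nonneg x) hcost h)
    · have h1 := congrFun ((hN (x j).1).definite _ h.symm) (j, (x j).2)
      rw [loadVector, if_pos rfl, Pi.zero_apply, ENNReal.toReal_eq_zero_iff] at h1
      refine Or.inr (le_antisymm ?_ zero_le)
      rw [← h1.resolve_right (hx j)]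
      exact bestWay_le _ _ _
  have h0 : f 0 ≤ 0 := (hf.mono _ _ le_rfl (allocLoad_nonneg x)).trans hcost
  refine le_trans (hf.le_of_le_on_nonfree (fun i => apply_nonneg _ _) le_rfl fun i hi => ?_) h0
  have hz : loadVector jobs (coreAlloc p f N O jobs U) i = 0 := by
    funext a
    rw [loadVector]
    split_ifs with ha
    · have h1 := assignedMachine_of_trivial (htriv a.1) (coreOutcome p f N O jobs a.1 U).machine
      have h2 : assignedMachine f (jobs a.1) (coreOutcome p f N O jobs a.1 U).machine = i :=
        congrArg Prod.fst ha
      have h3 : bestWay (jobs a.1) i = a.2 := by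
        have := congrArg Prod.snd ha
        simpa only [coreAlloc, h2] using this
      rw [h2] at h1
      have h4 := h1.2.resolve_left hi
      rw [h3] at h4
      rw [h4, ENNReal.toReal_zero, Pi.zero_apply]
    · rfl
  rw [hz, map_zero, Pi.zero_apply]

/-- The guarantee of the online algorithm that knows an upper bound of the optimal cost. -/
theorem integral_cost_core_le' (hf : IsSmoothCost p f) (hN : ∀ i, IsMonotoneSymmetricNorm (N i))
    (hn : 1 ≤ n) (hO : 0 ≤ O) {x : Allocation n m r} (hx : Feasible jobs x)
    (hcost : f (allocLoad N jobs x) ≤ O) {γ : ℝ} (hγ1 : 1 ≤ γ)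
    (hγ : 2 * (boostBudget p n m + (Nat.clog 2 n + 1) * p) ≤ γ) :
    ∫ U, cost f N jobs (coreAlloc p f N O jobs U) ≤ (170000 * γ * p) ^ p * O := by
  -- The threshold bounds need `O > 0`. For `O = 0` every job has a trivial option and the algorithm
  -- takes it.
  rcases hO.lt_or_eq with h | h
  · exact integral_cost_core_le hf hN hn h
      ((hf.mono _ _ le_rfl (allocLoad_nonneg x)).trans hcost) hx hcost hγ1 hγ
  · subst h
    rw [mul_zero]
    exact integral_nonpos fun U => cost_core_of_cost_zero hf hN hx hcost U

end ZeroCost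

/-! ### Rounding guesses to powers -/

section Guess

/-- The least power of `β` that is at least `c`, or zero if `c` is not positive. -/
noncomputable def roundPow (β c : ℝ) : ℝ :=
  open Classical in
  if h : 0 < c ∧ 1 < β then β ^ ((exists_mem_Ioc_zpow h.1 h.2).choose + 1) else 0

variable {β : ℝ}

lemma roundPow_of_nonpos {c : ℝ} (hc : c ≤ 0) : roundPow β c = 0 := by
  rw [roundPow, dif_neg fun h => (not_lt.2 hc) h.1]

lemma roundPow_spec (hβ : 1 < β) {c : ℝ} (hc : 0 < c) :
    ∃ k : ℤ, roundPow β c = β ^ (k + 1) ∧ β ^ k < c ∧ c ≤ β ^ (k + 1) := by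
  refine ⟨(exists_mem_Ioc_zpow hc hβ).choose, ?_, (exists_mem_Ioc_zpow hc hβ).choose_spec⟩
  rw [roundPow, dif_pos ⟨hc, hβ⟩]

lemma le_roundPow (hβ : 1 < β) (c : ℝ) : c ≤ roundPow β c := by
  rcases le_or_gt c 0 with h | h
  · rw [roundPow_of_nonpos h]; exact h
  · obtain ⟨k, hk, _, h2⟩ := roundPow_spec hβ h
    rw [hk]; exact h2

lemma roundPow_nonneg (hβ : 1 < β) (c : ℝ) : 0 ≤ roundPow β c := by
  rcases le_or_gt c 0 with h | h
  · rw [roundPow_of_nonpos h]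
  · exact h.le.trans (le_roundPow hβ c)

lemma roundPow_le (hβ : 1 < β) {c : ℝ} (hc : 0 ≤ c) : roundPow β c ≤ β * c := by
  have hβ0 : 0 < β := one_pos.trans hβ
  rcases hc.lt_or_eq with h | h
  · obtain ⟨k, hk, h1, _⟩ := roundPow_spec hβ h
    rw [hk, zpow_add_one₀ hβ0.ne', mul_comm]
    exact mul_le_mul_of_nonneg_left h1.le hβ0.le
  · rw [← h, roundPow_of_nonpos le_rfl, mul_zero]

/-- Distinct guesses are separated by the factor `β`, so the phases contribute geometrically. -/
lemma roundPow_gap (hβ : 1 < β) {c c' : ℝ} (h : roundPow β c < roundPow β c') :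
    β * roundPow β c ≤ roundPow β c' := by
  have hβ0 : 0 < β := one_pos.trans hβ
  rcases le_or_gt c 0 with hc | hc
  · rw [roundPow_of_nonpos hc, mul_zero]; exact roundPow_nonneg hβ c'
  rcases le_or_gt c' 0 with hc' | hc'
  · rw [roundPow_of_nonpos hc'] at h
    exact absurd (roundPow_nonneg hβ c) (not_le.2 h)
  obtain ⟨k, hk, _⟩ := roundPow_spec hβ hc
  obtain ⟨k', hk', _⟩ := roundPow_spec hβ hc'
  rw [hk, hk'] at h ⊢
  rw [mul_comm, ← zpow_add_one₀ hβ0.ne']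
  exact zpow_le_zpow_right₀ hβ.le ((zpow_lt_zpow_iff_right₀ hβ).1 h)

end Guess

/-! ### Adding up the phases -/

section PhaseSum

variable {Ω : Type} [MeasurableSpace Ω] {μ : Measure Ω} [IsProbabilityMeasure μ] {m : ℕ} {p : ℝ}
  {f : (Fin m → ℝ) → ℝ}

/-- The total loads of phases with geometrically increasing guarantees. -/
lemma integral_cost_sum_le (hf : IsSmoothCost p f) {L : ℝ → Ω → Fin m → ℝ}
    (hL0 : ∀ a ω, 0 ≤ L a ω) (hL : ∀ a, IsFinitary (L a)) {R : ℝ} (hR : 0 ≤ R) (s : Finset ℝ)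
    (hgap : ∀ a ∈ s, ∀ a' ∈ s, a < a' → 2 ^ p * a ≤ a')
    (hbound : ∀ a ∈ s, ∫ ω, f (L a ω) ∂μ ≤ R * a) (hs0 : ∀ a ∈ s, 0 ≤ a) (hs : s.Nonempty) :
    ∀ b, (∀ a ∈ s, a ≤ b) → ∫ ω, f (∑ a ∈ s, L a ω) ∂μ ≤ 2 ^ p * R * b := by
  classical
  have hE : (2 : ℝ) ≤ 2 ^ p := hf.two_le_rpow
  have hfin : ∀ s : Finset ℝ, IsFinitary fun ω => ∑ a ∈ s, L a ω := by
    intro s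
    induction s using Finset.induction_on with
    | empty => simpa using IsFinitary.const (0 : Fin m → ℝ)
    | insert a s ha ih =>
      simp only [Finset.sum_insert ha]
      exact ((hL a).prodMk ih).comp fun c => c.1 + c.2
  have hint : ∀ s : Finset ℝ, Integrable (fun ω => f (∑ a ∈ s, L a ω)) μ := fun s =>
    ((hfin s).comp f).integrable
  induction s using Finset.induction_on_max with
  | empty => exact absurd hs (by simp)
  | insert a s hmax ih =>
    intro b hb
    have ha : a ∉ s := fun h => lt_irrefl _ (hmax a h)
    have ha0 := hs0 a (Finset.mem_insert_self _ _)
    have hab := hb a (Finset.mem_insert_self _ _)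
    have hRa := mul_nonneg hR ha0
    have h1 := hbound a (Finset.mem_insert_self _ _)
    have h2 : 2 ^ p * R * a ≤ 2 ^ p * R * b :=
      mul_le_mul_of_nonneg_left hab (by positivity)
    rcases s.eq_empty_or_nonempty with rfl | hne
    · simp only [insert_empty_eq, Finset.sum_singleton]
      nlinarith
    have ih' := ih (fun c hc c' hc' => hgap c (Finset.mem_insert_of_mem hc) c'
      (Finset.mem_insert_of_mem hc')) (fun c hc => hbound c (Finset.mem_insert_of_mem hc))
      (fun c hc => hs0 c (Finset.mem_insert_of_mem hc)) hne (s.max' hne)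
      fun c hc => s.le_max' c hc
    -- The gap `2 ^ p` matches the loss in `add_le_rpow`: all earlier phases together cost at most
    -- `R * a`, like the last one, and the induction closes with the same constant.
    have h3 := hgap _ (Finset.mem_insert_of_mem (s.max'_mem hne)) a (Finset.mem_insert_self _ _)
      (hmax _ (s.max'_mem hne))
    have hpt : ∀ ω, f (∑ c ∈ insert a s, L c ω)
        ≤ 1 / 2 * 2 ^ p * (f (L a ω) + f (∑ c ∈ s, L c ω)) := by
      intro ω
      rw [Finset.sum_insert ha]
      exact hf.add_le_rpow (hL0 a ω) (Finset.sum_nonneg fun c _ => hL0 c ω)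
    have hLa : Integrable (fun ω => f (L a ω)) μ := ((hL a).comp f).integrable
    have h4 := integral_mono (hint (insert a s)) ((hLa.add (hint s)).const_mul (1 / 2 * 2 ^ p)) hpt
    rw [integral_const_mul] at h4
    have h5 : ∫ ω, ((fun ω => f (L a ω)) + fun ω => f (∑ c ∈ s, L c ω)) ω ∂μ
        ≤ R * a + R * a := by
      simp only [Pi.add_apply]
      rw [integral_add hLa (hint s)]
      refine add_le_add h1 (ih'.trans ?_)
      rw [mul_comm (2 ^ p) R, mul_assoc]
      exact mul_le_mul_of_nonneg_left h3 hR
    refine h4.trans ((mul_le_mul_of_nonneg_left h5 (by positivity)).trans (le_trans ?_ h2))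
    exact le_of_eq (by ring)

end PhaseSum

/-! ### Guessing the optimum online -/

section Doubling

variable {n m r : ℕ} [NeZero m] [NeZero r] {p : ℝ} {f : (Fin m → ℝ) → ℝ}
  {N : Fin m → Seminorm ℝ (Fin n × Fin r → ℝ)} {jobs : Fin n → Job m r}

open Classical in
/-- Replace the jobs outside of `s` by jobs without loads. -/
noncomputable def maskJobs (s : Set (Fin n)) (jobs : Fin n → Job m r) : Fin n → Job m r :=
  fun j => if j ∈ s then jobs j else 0

lemma maskJobs_of_mem {s : Set (Fin n)} {j : Fin n} (h : j ∈ s) :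
    maskJobs s jobs j = jobs j := if_pos h

lemma maskJobs_of_notMem {s : Set (Fin n)} {j : Fin n} (h : j ∉ s) : maskJobs s jobs j = 0 :=
  if_neg h

lemma feasible_maskJobs_mono {s t : Set (Fin n)} (h : s ⊆ t) {x : Allocation n m r}
    (hx : Feasible (maskJobs t jobs) x) : Feasible (maskJobs s jobs) x := fun j => by
  by_cases hj : j ∈ s
  · have := hx j
    rwa [maskJobs_of_mem (h hj), ← maskJobs_of_mem (jobs := jobs) hj] at this
  · rw [maskJobs_of_notMem hj]; simp

lemma maskJobs_univ : maskJobs Set.univ jobs = jobs :=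
  funext fun _ => maskJobs_of_mem (Set.mem_univ _)

lemma allocLoad_maskJobs_mono (hN : ∀ i, IsMonotoneSymmetricNorm (N i)) {s t : Set (Fin n)}
    (h : s ⊆ t) (x : Allocation n m r) :
    allocLoad N (maskJobs s jobs) x ≤ allocLoad N (maskJobs t jobs) x := fun i => by
  refine (hN i).monotone _ _ (loadVector_nonneg _ _) fun a => ?_
  by_cases ha : a.1 ∈ s
  · rw [loadVector, loadVector, maskJobs_of_mem ha, maskJobs_of_mem (h ha)]
  · rw [loadVector, maskJobs_of_notMem ha]
    simpa using loadVector_nonneg (jobs := maskJobs t jobs) x i a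

lemma exists_optimal (f : (Fin m → ℝ) → ℝ) (N : Fin m → Seminorm ℝ (Fin n × Fin r → ℝ))
    (h : ∃ x, Feasible jobs x) : ∃ x, Feasible jobs x ∧ f (allocLoad N jobs x) = opt f N jobs := by
  have hfin : {c | ∃ x, Feasible jobs x ∧ c = cost f N jobs x}.Finite :=
    (Set.finite_range fun x => cost f N jobs x).subset fun c ⟨x, _, hc⟩ => ⟨x, hc.symm⟩
  obtain ⟨x₀, hx₀⟩ := h
  obtain ⟨x, hx, hc⟩ := Set.Nonempty.csInf_mem
    (s := {c | ∃ x, Feasible jobs x ∧ c = cost f N jobs x}) ⟨_, x₀, hx₀, rfl⟩ hfin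
  exact ⟨x, hx, hc.symm⟩

lemma opt_le (f : (Fin m → ℝ) → ℝ) (N : Fin m → Seminorm ℝ (Fin n × Fin r → ℝ))
    {x : Allocation n m r} (hx : Feasible jobs x) : opt f N jobs ≤ f (allocLoad N jobs x) := by
  have hfin : {c | ∃ x, Feasible jobs x ∧ c = cost f N jobs x}.Finite :=
    (Set.finite_range fun x => cost f N jobs x).subset fun c ⟨x, _, hc⟩ => ⟨x, hc.symm⟩
  exact csInf_le hfin.bddBelow ⟨x, hx, rfl⟩

/-- The guess of the optimal cost after the arrival of job `j`. -/
noncomputable def guess (p : ℝ) (f : (Fin m → ℝ) → ℝ)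
    (N : Fin m → Seminorm ℝ (Fin n × Fin r → ℝ)) (jobs : Fin n → Job m r) (j : Fin n) : ℝ :=
  roundPow (2 ^ p) (opt f N (maskJobs (Set.Iic j) jobs))

/-- The jobs that arrive while the guess of the optimal cost is `O`. -/
noncomputable def phaseJobs (p : ℝ) (f : (Fin m → ℝ) → ℝ)
    (N : Fin m → Seminorm ℝ (Fin n × Fin r → ℝ)) (jobs : Fin n → Job m r) (O : ℝ) :
    Fin n → Job m r :=
  maskJobs {j | guess p f N jobs j = O} jobs

/-- The online algorithm that guesses the optimal cost. -/
noncomputable def doublingAlloc (p : ℝ) (f : (Fin m → ℝ) → ℝ)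
    (N : Fin m → Seminorm ℝ (Fin n × Fin r → ℝ)) (jobs : Fin n → Job m r)
    (U : Facility n m → I) : Allocation n m r := fun j =>
  -- All phases share the same seeds; only their expected costs are added, so no independence is
  -- needed. Masked jobs have trivial options and pose no request.
  coreAlloc p f N (guess p f N jobs j) (phaseJobs p f N jobs (guess p f N jobs j)) U j

lemma guess_congr {jobs' : Fin n → Job m r} {j : Fin n} (h : ∀ k ≤ j, jobs k = jobs' k) :
    guess p f N jobs j = guess p f N jobs' j := by
  have : maskJobs (Set.Iic j) jobs = maskJobs (Set.Iic j) jobs' := by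
    funext k
    by_cases hk : k ∈ Set.Iic j
    · rw [maskJobs_of_mem hk, maskJobs_of_mem hk, h k hk]
    · rw [maskJobs_of_notMem hk, maskJobs_of_notMem hk]
  rw [guess, guess, this]

lemma doublingAlloc_congr {jobs' : Fin n → Job m r} {j : Fin n} (h : ∀ k ≤ j, jobs k = jobs' k)
    (U : Facility n m → I) : doublingAlloc p f N jobs U j = doublingAlloc p f N jobs' U j := by
  rw [doublingAlloc, doublingAlloc, guess_congr h]
  refine coreAlloc_congr (fun k hk => ?_) U
  have hg : guess p f N jobs k = guess p f N jobs' k :=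
    guess_congr fun l hl => h l (hl.trans hk)
  simp only [phaseJobs, maskJobs, Set.mem_ofPred_eq, hg, h k hk]

/-- The online algorithm for generalized scheduling. -/
noncomputable def doublingAlgorithm (p : ℝ) (f : (Fin m → ℝ) → ℝ)
    (N : Fin m → Seminorm ℝ (Fin n × Fin r → ℝ)) : OnlineAlgorithm n m r where
  Ω := Facility n m → I
  P := volume
  alloc := doublingAlloc p f N
  measurable_alloc jobs j := (isFinitary_coreAlloc (p := p) (f := f) (N := N)
    (O := guess p f N jobs j) (jobs := phaseJobs p f N jobs (guess p f N jobs j))).comp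
      (fun x => x j) |>.measurable
  online _ _ _ h U := doublingAlloc_congr h U

lemma feasible_doublingAlloc (h : ∃ x, Feasible jobs x) (U : Facility n m → I) :
    Feasible jobs (doublingAlloc p f N jobs U) := by
  intro j
  obtain ⟨x, hx⟩ := h
  have hx' : Feasible (phaseJobs p f N jobs (guess p f N jobs j)) x :=
    feasible_maskJobs_mono (Set.subset_univ _) (by rwa [maskJobs_univ])
  have := feasible_coreAlloc (p := p) (f := f) (N := N) (O := guess p f N jobs j) ⟨x, hx'⟩ U j
  rwa [phaseJobs, maskJobs_of_mem (show j ∈ {k | guess p f N jobs k = guess p f N jobs j} from rfl)]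
    at this

/-- The loads are at most the sums of the loads of the phases. -/
lemma allocLoad_doublingAlloc_le (U : Facility n m → I) :
    allocLoad N jobs (doublingAlloc p f N jobs U)
      ≤ ∑ O ∈ Finset.univ.image (guess p f N jobs), allocLoad N (phaseJobs p f N jobs O)
        (coreAlloc p f N O (phaseJobs p f N jobs O) U) := by
  intro i
  have hsum : loadVector jobs (doublingAlloc p f N jobs U) i
      = ∑ O ∈ Finset.univ.image (guess p f N jobs), loadVector (phaseJobs p f N jobs O)
        (coreAlloc p f N O (phaseJobs p f N jobs O) U) i := by
    funext a
    rw [Finset.sum_apply, Finset.sum_eq_single (guess p f N jobs a.1)]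
    · rw [loadVector, loadVector, doublingAlloc]
      have : phaseJobs p f N jobs (guess p f N jobs a.1) a.1 = jobs a.1 :=
        maskJobs_of_mem rfl
      rw [this]
    · intro O _ hO
      have : phaseJobs p f N jobs O a.1 = 0 := maskJobs_of_notMem fun h => hO (Eq.symm h)
      rw [loadVector, this]
      simp
    · intro h
      exact absurd (Finset.mem_image_of_mem _ (Finset.mem_univ _)) h
  rw [Finset.sum_apply]
  change N i _ ≤ _
  rw [hsum]
  exact Finset.le_sum_of_subadditive (N i) (map_zero _).le (map_add_le_add _) _ _

/-- Every phase has an offline solution whose cost is at most its guess. -/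
lemma exists_phase_solution (hf : IsSmoothCost p f) (hN : ∀ i, IsMonotoneSymmetricNorm (N i))
    (h : ∃ x, Feasible jobs x) {O : ℝ} (hO : O ∈ Finset.univ.image (guess p f N jobs)) :
    ∃ x, Feasible (phaseJobs p f N jobs O) x ∧ f (allocLoad N (phaseJobs p f N jobs O) x) ≤ O := by
  classical
  have hβ : (1 : ℝ) < 2 ^ p := one_lt_two.trans_le hf.two_le_rpow
  obtain ⟨j₀, _, hj₀⟩ := Finset.mem_image.1 hO
  -- The prefix up to the last job of the phase contains the whole phase, and its optimum is at most
  -- the guess.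
  obtain ⟨j, hj, hmax⟩ := (Finset.univ.filter fun j => guess p f N jobs j = O).exists_max_image id
    ⟨j₀, Finset.mem_filter.2 ⟨Finset.mem_univ _, hj₀⟩⟩
  have hjO := (Finset.mem_filter.1 hj).2
  have hsub : {k | guess p f N jobs k = O} ⊆ Set.Iic j := fun k hk =>
    hmax k (Finset.mem_filter.2 ⟨Finset.mem_univ _, hk⟩)
  obtain ⟨y, hy⟩ := h
  obtain ⟨x, hx, hxc⟩ := exists_optimal (jobs := maskJobs (Set.Iic j) jobs) f N
    ⟨y, feasible_maskJobs_mono (Set.subset_univ _) (by rwa [maskJobs_univ])⟩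
  refine ⟨x, feasible_maskJobs_mono hsub hx, ?_⟩
  refine (hf.mono _ _ (allocLoad_nonneg x) (allocLoad_maskJobs_mono hN hsub x)).trans ?_
  rw [hxc, ← hjO]
  exact le_roundPow hβ _

/-- The guesses are at most a constant factor larger than the optimal cost. -/
lemma guess_le (hf : IsSmoothCost p f) (hN : ∀ i, IsMonotoneSymmetricNorm (N i))
    (h : ∃ x, Feasible jobs x) (j : Fin n) : guess p f N jobs j ≤ 2 ^ p * opt f N jobs := by
  have hβ : (1 : ℝ) < 2 ^ p := one_lt_two.trans_le hf.two_le_rpow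
  obtain ⟨x, hx, hxc⟩ := exists_optimal f N h
  have hmono : opt f N (maskJobs (Set.Iic j) jobs) ≤ opt f N jobs := by
    rw [← maskJobs_univ (jobs := jobs)] at hx
    have h1 := opt_le f N (feasible_maskJobs_mono (Set.subset_univ (Set.Iic j)) hx)
    have h2 := hf.mono _ _ (allocLoad_nonneg x)
      (allocLoad_maskJobs_mono (jobs := jobs) hN (Set.subset_univ (Set.Iic j)) x)
    rw [maskJobs_univ, hxc] at h2
    exact h1.trans h2
  have hopt : 0 ≤ opt f N jobs := by rw [← hxc]; exact hf.nonneg _ (allocLoad_nonneg x)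
  rcases le_or_gt (opt f N (maskJobs (Set.Iic j) jobs)) 0 with hc | hc
  · rw [guess, roundPow_of_nonpos hc]
    exact mul_nonneg (zero_le_one.trans hβ.le) hopt
  · exact (roundPow_le hβ hc.le).trans
      (mul_le_mul_of_nonneg_left hmono (zero_le_one.trans hβ.le))

/-- `680000 = 4 * 170000`: one factor `2 ^ p` is lost in summing the phases and one in rounding the
guesses. -/
theorem isCompetitive_doublingAlgorithm (hf : IsSmoothCost p f)
    (hN : ∀ i, IsMonotoneSymmetricNorm (N i)) (hn : 1 ≤ n) {γ : ℝ} (hγ1 : 1 ≤ γ)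
    (hγ : 2 * (boostBudget p n m + (Nat.clog 2 n + 1) * p) ≤ γ) :
    (doublingAlgorithm (n := n) (r := r) p f N).IsCompetitive f N ((680000 * γ * p) ^ p) := by
  intro jobs hfeas
  refine ⟨fun U => feasible_doublingAlloc hfeas U, ?_⟩
  have hp0 := hf.p_pos
  have hβ : (1 : ℝ) < 2 ^ p := one_lt_two.trans_le hf.two_le_rpow
  set s := Finset.univ.image (guess p f N jobs) with hs
  have hγ0 : 0 < γ := one_pos.trans_le hγ1
  set R : ℝ := (170000 * γ * p) ^ p with hR
  set L : ℝ → (Facility n m → I) → Fin m → ℝ := fun O U =>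
    allocLoad N (phaseJobs p f N jobs O) (coreAlloc p f N O (phaseJobs p f N jobs O) U) with hL
  have hLfin : ∀ O, IsFinitary (L O) := fun O =>
    (isFinitary_coreAlloc (p := p) (f := f) (N := N) (O := O)
      (jobs := phaseJobs p f N jobs O)).comp fun x => allocLoad N (phaseJobs p f N jobs O) x
  have hL0 : ∀ O U, 0 ≤ L O U := fun O U => allocLoad_nonneg _
  have hs0 : ∀ O ∈ s, 0 ≤ O := fun O hO => by
    obtain ⟨j, _, rfl⟩ := Finset.mem_image.1 hO
    exact roundPow_nonneg hβ _
  have hgap : ∀ a ∈ s, ∀ a' ∈ s, a < a' → 2 ^ p * a ≤ a' := fun a ha a' ha' hlt => by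
    obtain ⟨j, _, rfl⟩ := Finset.mem_image.1 ha
    obtain ⟨j', _, rfl⟩ := Finset.mem_image.1 ha'
    exact roundPow_gap hβ hlt
  have hbound : ∀ O ∈ s, ∫ U, f (L O U) ≤ R * O := fun O hO => by
    obtain ⟨x, hx, hxc⟩ := exists_phase_solution hf hN hfeas hO
    exact integral_cost_core_le' hf hN hn (hs0 O hO) hx hxc hγ1 hγ
  have hne : s.Nonempty := ⟨_, Finset.mem_image_of_mem _ (Finset.mem_univ (⟨0, hn⟩ : Fin n))⟩
  have h1 := integral_cost_sum_le (μ := (volume : Measure (Facility n m → I))) hf hL0 hLfin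
    (by positivity : 0 ≤ R) s hgap hbound hs0 hne (2 ^ p * opt f N jobs) fun O hO => by
      obtain ⟨j, _, rfl⟩ := Finset.mem_image.1 hO
      exact guess_le hf hN hfeas j
  have hsumfin : IsFinitary fun U : Facility n m → I => ∑ O ∈ s, L O U := by
    have h2 := (IsFinitary.pi (κ := s) fun O => hLfin O).comp fun v => ∑ O, v O
    have e : (fun U : Facility n m → I => ∑ O ∈ s, L O U) = fun U => ∑ O : s, L O U :=
      funext fun U => (Finset.sum_coe_sort s fun O => L O U).symm
    rw [e]
    exact h2
  have hcfin : IsFinitary (doublingAlloc p f N jobs) := by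
    refine IsFinitary.pi fun j => ?_
    exact (isFinitary_coreAlloc (p := p) (f := f) (N := N)
      (O := guess p f N jobs j) (jobs := phaseJobs p f N jobs (guess p f N jobs j))).comp
      fun x => x j
  have h2 : ∫ U, cost f N jobs (doublingAlloc p f N jobs U) ≤ ∫ U, f (∑ O ∈ s, L O U) :=
    integral_mono (hcfin.comp fun x => cost f N jobs x).integrable (hsumfin.comp f).integrable
      fun U => hf.mono _ _ (allocLoad_nonneg _) (allocLoad_doublingAlloc_le U)
  change ∫ U, cost f N jobs (doublingAlloc p f N jobs U) ≤ _
  refine (h2.trans h1).trans (le_of_eq ?_)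
  have h3 : (680000 * γ * p) ^ p = 2 ^ p * (2 ^ p * R) := by
    rw [hR, ← Real.mul_rpow two_pos.le (by positivity), ← Real.mul_rpow two_pos.le (by positivity)]
    congr 1
    ring
  rw [h3]
  ring

end Doubling

/-! ### Explicit constants -/

section Constants

/-- For `k > 1` this follows from `2 ^ (clog 2 k - 1) < k` and `log 2 > 1 / 2`. -/
lemma clog_two_add_one_le {k : ℕ} (hk : 1 ≤ k) : (Nat.clog 2 k : ℝ) + 1 ≤ 2 * (1 + Real.log k) := by
  have hlog2 := Real.log_two_gt_d9
  rcases Nat.lt_or_ge 1 k with h | h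
  · have h1 := Nat.pow_pred_clog_lt_self one_lt_two h
    have h2 : (2 : ℝ) ^ (Nat.clog 2 k).pred ≤ k := by exact_mod_cast h1.le
    have h3 := Real.log_le_log (by positivity) h2
    rw [Real.log_pow] at h3
    have h4 : 0 < Nat.clog 2 k := Nat.clog_pos one_lt_two h
    have h5 : ((Nat.clog 2 k).pred : ℝ) = Nat.clog 2 k - 1 := by
      rw [Nat.pred_eq_sub_one, Nat.cast_sub h4, Nat.cast_one]
    rw [h5] at h3
    have h6 : (0 : ℝ) ≤ Nat.clog 2 k - 1 := by
      have : (1 : ℝ) ≤ Nat.clog 2 k := by exact_mod_cast h4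
      linarith
    nlinarith
  · have : k = 1 := le_antisymm h hk
    subst this
    simp

/-- With `a`, `b`, `c` for the factors in `m`, `n` and `log n`, `gapBound` is `O(a c)` and
`logBudget` is `O(a b c)`; the second factor `a` is `log (1 / y₀)`. The constant is `2 * (2 + 48 * 2
* 26 + 2) = 5000`. -/
lemma two_mul_boostBudget_le {p : ℝ} (hp : 1 ≤ p) {n m : ℕ} (hn : 1 ≤ n) (hm : 1 ≤ m) :
    2 * (boostBudget p n m + (Nat.clog 2 n + 1) * p)
      ≤ 5000 * (p * (1 + Real.log m) ^ 2 * (1 + Real.log n)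
        * (1 + Real.log (1 + Real.log n))) := by
  have hn' : (1 : ℝ) ≤ n := by exact_mod_cast hn
  have hm' : (1 : ℝ) ≤ m := by exact_mod_cast hm
  set a := 1 + Real.log m with ha
  set b := 1 + Real.log n with hb
  set c := 1 + Real.log b with hc
  have ha1 : 1 ≤ a := by have := Real.log_nonneg hm'; linarith
  have hb1 : 1 ≤ b := by have := Real.log_nonneg hn'; linarith
  have hc1 : 1 ≤ c := by have := Real.log_nonneg hb1; linarith
  have hS : (Nat.clog 2 n : ℝ) + 1 ≤ 2 * b := clog_two_add_one_le hn
  have hH : (Nat.clog 2 m : ℝ) + 1 ≤ 2 * a := clog_two_add_one_le hm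
  have hM : (scaleCount m : ℝ) ≤ m * (2 * a) := by
    rw [scaleCount, scaleBound]
    push_cast
    exact mul_le_mul_of_nonneg_left hH (by positivity)
  have hM0 : (1 : ℝ) ≤ scaleCount m := by
    exact_mod_cast Nat.mul_pos hm (Nat.succ_pos _)
  have hlog2 := Real.log_two_lt_d9
  have hlog20 := Real.log_two_gt_d9
  have hloga : Real.log a ≤ a - 1 := Real.log_le_sub_one_of_pos (by linarith)
  have hlogM : Real.log (scaleCount m) ≤ Real.log 2 + 2 * (a - 1) := by
    refine (Real.log_le_log (by linarith) hM).trans ?_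
    rw [Real.log_mul (by positivity) (by positivity), Real.log_mul two_ne_zero (by positivity)]
    have : Real.log m = a - 1 := by rw [ha]; ring
    linarith
  have h2M : Real.log (2 * scaleCount m) ≤ 2 * a := by
    rw [Real.log_mul two_ne_zero (by linarith)]
    linarith
  have h8M : Real.log (8 * scaleCount m) ≤ 3 * a := by
    rw [Real.log_mul (by norm_num) (by linarith), show (8 : ℝ) = 2 ^ 3 by norm_num, Real.log_pow]
    push_cast
    linarith
  have hg : (gapBound n m : ℝ) + 1 ≤ 8 * (a * c) := by
    refine (clog_two_add_one_le (k := 2 * (scaleCount m * (Nat.clog 2 n + 1)))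
      (Nat.mul_pos two_pos (Nat.mul_pos (Nat.mul_pos hm (Nat.succ_pos _))
        (Nat.succ_pos _)))).trans ?_
    push_cast
    rw [← mul_assoc, Real.log_mul (by positivity) (by positivity)]
    have h1 : Real.log ((Nat.clog 2 n : ℝ) + 1) ≤ Real.log 2 + Real.log b := by
      rw [← Real.log_mul two_ne_zero (by linarith)]
      exact Real.log_le_log (by positivity) hS
    have h3 : Real.log b = c - 1 := by rw [hc]; ring
    nlinarith
  have hac : 1 ≤ a * c := one_le_mul_of_one_le_of_one_le ha1 hc1
  have hbudget : logBudget n m ≤ 26 * (a * c * b) := by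
    rw [logBudget]
    have hlogn : Real.log n ≤ b := by rw [hb]; linarith
    have h1 : ((gapBound n m : ℝ) + 1) * Real.log n ≤ 8 * (a * c) * b :=
      mul_le_mul hg hlogn (Real.log_nonneg hn') (by positivity)
    have h2 : (gapBound n m : ℝ) * Real.log 2 ≤ 8 * (a * c) * 0.7 := by
      refine mul_le_mul (by linarith) (by linarith) (by linarith) (by positivity)
    have h3 : Real.log (8 * scaleCount m) + gapBound n m * Real.log 2 ≤ 8.6 * (a * c) := by
      have : a ≤ a * c := le_mul_of_one_le_right (by linarith) hc1
      linarith
    have h4 : ((Nat.clog 2 n : ℝ) + 1)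
        * (Real.log (8 * scaleCount m) + gapBound n m * Real.log 2) ≤ 2 * b * (8.6 * (a * c)) := by
      refine mul_le_mul hS h3 ?_ (by positivity)
      exact add_nonneg (Real.log_nonneg (by linarith)) (by positivity)
    have h5 : 0 ≤ a * c * b := by positivity
    nlinarith
  have hprod : 48 * p * Real.log (2 * scaleCount m) * logBudget n m
      ≤ 48 * p * (2 * a) * (26 * (a * c * b)) := by
    have h0 : 0 ≤ Real.log (2 * scaleCount m) := Real.log_nonneg (by linarith)
    have h1 : 48 * p * Real.log (2 * scaleCount m) ≤ 48 * p * (2 * a) :=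
      mul_le_mul_of_nonneg_left h2M (by positivity)
    exact (mul_le_mul_of_nonneg_left hbudget (by positivity)).trans
      (mul_le_mul_of_nonneg_right h1 (by positivity))
  rw [boostBudget]
  have h1 : ((Nat.clog 2 n : ℝ) + 1) * p ≤ 2 * b * p :=
    mul_le_mul_of_nonneg_right hS (by linarith)
  have h2 : b * p * 1 ≤ b * p * (a * (a * c)) :=
    mul_le_mul_of_nonneg_left (one_le_mul_of_one_le_of_one_le ha1 hac) (by positivity)
  nlinarith

end Constants

end GenSched

theorem theorem1 :
    ∃ K : ℝ, 0 < K ∧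
      ∀ (n m r : ℕ), 1 ≤ n → 1 ≤ m → 1 ≤ r →
      ∀ (p : ℝ) (f : (Fin m → ℝ) → ℝ) (N : Fin m → Seminorm ℝ (Fin n × Fin r → ℝ)),
        GenSched.IsPBounded p f →
        (∀ i, GenSched.IsMonotoneSymmetricNorm (N i)) →
        ∃ A : GenSched.OnlineAlgorithm n m r,
          A.IsCompetitive f N
            ((K * p ^ 2 * (1 + Real.log m) ^ 2 * (1 + Real.log n)
              * (1 + Real.log (1 + Real.log n))) ^ p) := by
  -- `3400000000 = 680000 * 5000`; one factor `p` comes from `γ` and the other from the absorption.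
  refine ⟨3400000000, by norm_num, fun n m r hn hm hr p f N hf hN => ?_⟩
  have : NeZero m := ⟨by omega⟩
  have : NeZero r := ⟨by omega⟩
  have hs := hf.isSmoothCost
  have h1 : 0 ≤ Real.log m := Real.log_nonneg (by exact_mod_cast hm)
  have h2 : 0 ≤ Real.log n := Real.log_nonneg (by exact_mod_cast hn)
  have h3 : 0 ≤ Real.log (1 + Real.log n) := Real.log_nonneg (by linarith)
  have hγ1 : 1 ≤ 5000 * (p * (1 + Real.log m) ^ 2 * (1 + Real.log n)
      * (1 + Real.log (1 + Real.log n))) := by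
    have h4 : 1 ≤ p * (1 + Real.log m) ^ 2 * (1 + Real.log n) * (1 + Real.log (1 + Real.log n)) :=
      one_le_mul_of_one_le_of_one_le (one_le_mul_of_one_le_of_one_le
        (one_le_mul_of_one_le_of_one_le hs.one_le (one_le_pow₀ (by linarith))) (by linarith))
        (by linarith)
    linarith
  have h := GenSched.isCompetitive_doublingAlgorithm (r := r) hs hN hn hγ1
    (GenSched.two_mul_boostBudget_le hs.one_le hn hm)
  refine ⟨GenSched.doublingAlgorithm p f N, ?_⟩
  convert h using 2
  ring
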